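/- **Setting.** Let $\mathfrak{so}(4)$ be the skew real $4\times4$ matrices. Identify $\mathfrak{so}(4)^*$ with skew matrices through $\langle b,\omega\rangle=\tfrac12\sum_{i,j} b_{ij}\omega_{ij}$ and $\mathbb R^{4*}$ with $\mathbb R^4$ through the dot product. In $\mathfrak{iso}(4)\ltimes\mathfrak{iso}(4)^*$ one has $[\omega,x]=\omega x=-[x,\omega]$ for $\omega\in\mathfrak{so}(4)$, $x\in\mathbb R^4$, and for $V\in\mathbb R^{4*}$ the bracket $[V,x]=xV^{T}-Vx^{T}\in\mathfrak{so}(4)^*$ is the one for which the pairing is invariant. Rotations act by conjugation on matrices and by $hvh^{-1}:=h\,v$ on $\mathbb R^4$, $\mathbb R^{4*}$. Let $M$ be a closed smooth 3-manifold with a finite, coherently oriented decomposition into smoothly embedded tetrahedra $c^*$ such that every triangle is a face of exactly two tetrahedra. To each triangle belongs an oriented dual link $(cc')$; the triangle $(cc')^*$ is oriented as part of $\partial c^*$. For each $c$ let there be given near $c^*$ smooth fields $g_c$ (an $\mathrm{SO}(4)$-valued function), $c_c$ (an $\mathbb R^4$-valued function), $\sigma_c$ (an $\mathbb R^{4*}$-valued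 1-form) and $b_c$ (an $\mathfrak{so}(4)^*$-valued 1-form), depending smoothly on a parameter $t\in\mathbb R$; $\delta$ denotes $\frac{d}{dt}\big|_{t=0}$. The corresponding on-shell fields in $c^*$ are $$A_c=g_c^{-1}dg_c,\quad C_c=g_c^{-1}dc_c\,g_c,\quad \Sigma_c=g_c^{-1}d\sigma_c\,g_c,\quad B_c=g_c^{-1}(db_c+[d\sigma_c,c_c])g_c .$$ Assume that, for every $t$ and every link $(cc')$, the restrictions to the triangle $(cc')^*$ of $A_c,B_c,C_c,\Sigma_c$ agree with those of $A_{c'},B_{c'},C_{c'},\Sigma_{c'}$. Let $$\Theta_{BFCG}=\sum_c\Big(\int_{c^*}\langle B_c\wedge\delta A_c\rangle-\int_{c^*}\langle C_c\wedge\delta\Sigma_c\rangle\Big).$$ **Proposition.** 1. For every link $(cc')$ and every $t$ there are unique constants $h_{cc'}\in\mathrm{SO}(4)$ and $x_c^{c'}\in\mathbb R^4$ such that $g_c=h_{cc'}g_{c'}$ and $c_{c'}=h_{cc'}^{-1}(c_c+x_c^{c'})h_{cc'}$ on $(cc')^*$. They are smooth in $t$, and on $(cc')^*$ one has $d\sigma_{c'}=h_{cc'}^{-1}d\sigma_c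 h_{cc'}$ and $db_{c'}=h_{cc'}^{-1}(db_c-[d\sigma_c,x_c^{c'}])h_{cc'}$. 2. Put $\Delta g_c=\delta g_c\,g_c^{-1}$, $\Delta h_{(cc')}=\delta h_{cc'}\,h_{cc'}^{-1}$, and let the link carry $h_{(cc')}=h_{cc'}$, $x_{(cc')}=x_c^{c'}$ and its dual triangle $b_{(cc')^*}=\int_{(cc')^*}db_c\in\mathfrak{so}(4)^*$, $V_{(cc')^*}=\int_{(cc')^*}d\sigma_c\in\mathbb R^{4*}$; these are differentiable in $t$. Then $$\Theta_{BFCG}=\sum_c\int_{\partial c^*}\big(\langle db_c,\Delta g_c\rangle+\langle[d\sigma_c,c_c],\Delta g_c\rangle-\langle c_c,d\delta\sigma_c\rangle\big)$$ $$=\sum_{(cc')}\Big(\langle\Delta h_{(cc')},b_{(cc')^*}\rangle+\langle[\Delta h_{(cc')},x_{(cc')}],V_{(cc')^*}\rangle+\langle x_{(cc')},\delta V_{(cc')^*}\rangle\Big).$$ 3. Each summand is a potential of the phase space $T^*\mathrm{ISO}(4)$, and it differs from the one of the BF discretization only by the sign of the $(x,V)$ sector. Precisely, on $\mathrm{SO}(4)\times\mathbb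 R^4\times\mathfrak{so}(4)^*\times\mathbb R^{4*}\ni(h,x,b,V)$, with $\Delta h=\delta h\,h^{-1}$, consider the one-forms $$\theta'=\langle\Delta h,b\rangle+\langle[\Delta h,x],V\rangle+\langle x,\delta V\rangle,\qquad \theta_{BF}=\langle b,\Delta h\rangle+\langle V,\delta x\rangle+\langle V,[x,\Delta h]\rangle .$$ Then $\theta_{BF}=\langle\beta,\delta\mathcal G\,\mathcal G^{-1}\rangle$ is the canonical one-form of $T^*\mathrm{ISO}(4)\cong\mathrm{ISO}(4)\times\mathfrak{iso}(4)^*$ at $\mathcal G=e^xh$, $\beta=b+V$. With $\kappa(h,x,b,V)=(h,x,b,-V)$ one has $\theta'=\kappa^*\theta_{BF}+\delta\langle x,V\rangle$, hence $\delta\theta'=\kappa^*\delta\theta_{BF}$, and this two-form is non-degenerate. -/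

import Mathlib

open Set MeasureTheory Matrix
open scoped Manifold ContDiff

attribute [local instance] Matrix.normedAddCommGroup Matrix.normedSpace
attribute [-instance] instTopologicalSpaceMatrix Matrix.instUniformSpace

noncomputable section

namespace BFCG

/-! ### The Lie algebra data

`so(4)` is the space of skew matrices, `so(4)*` is identified with skew matrices through
`⟨b, α⟩ = ½ ∑ b_{ij} α_{ij}`, and `ℝ⁴*` with `ℝ⁴` through the dot product. In the double
`iso(4) ⋉ iso(4)*`, `[α, x] = α x` for `α ∈ so(4)`, `x ∈ ℝ⁴`, and the mixed bracket
`[V, x] ∈ so(4)*` of `V ∈ ℝ⁴*` and `x ∈ ℝ⁴` is fixed by the invariance of the pairing. -/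

abbrev Mat4 : Type := Matrix (Fin 4) (Fin 4) ℝ
abbrev R4 : Type := Fin 4 → ℝ
abbrev SO4 : Type := Matrix.specialOrthogonalGroup (Fin 4) ℝ

/-- The pairing of `so(4)*` with `so(4)`. -/
def pairSo (b α : Mat4) : ℝ := (1 / 2) * (bᵀ * α).trace

/-- The bracket `[V, x] ∈ so(4)*` of `V ∈ ℝ⁴*` and `x ∈ ℝ⁴`. -/
def mixedBracket (V x : R4) : Mat4 := vecMulVec x V - vecMulVec V x

/-- Invariance of the pairing: `⟨[V, x], α⟩ = ⟨V, [x, α]⟩`, where `[x, α] = -α x`. -/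
theorem pairSo_mixedBracket (V x : R4) (α : Mat4) (hα : αᵀ = -α) :
    pairSo (mixedBracket V x) α = V ⬝ᵥ (-(α *ᵥ x)) := by
  have h : ∀ i j, α i j = -α j i := fun i j => by
    have := congrFun (congrFun hα j) i
    simpa using this
  have h0 : ∀ i, α i i = 0 := fun i => by have := h i i; linarith
  simp only [pairSo, mixedBracket, trace, diag, mul_apply, transpose_apply, Matrix.sub_apply,
    vecMulVec_apply, dotProduct, mulVec, Pi.neg_apply, Fin.sum_univ_four, h0]
  rw [h 1 0, h 2 0, h 3 0, h 2 1, h 3 1, h 3 2]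
  ring

/-! ### Standard simplices and integration over them -/

/-- The standard `k`-simplex in `ℝᵏ`, with vertices `0, e₀, …, e_{k-1}`. -/
def stdCell (k : ℕ) : Set (Fin k → ℝ) := {s | (∀ i, 0 ≤ s i) ∧ ∑ i, s i ≤ 1}

/-- The ordered vertices of the standard simplex. -/
def stdVertex (k : ℕ) : Fin (k + 1) → (Fin k → ℝ) :=
  Fin.cons 0 (fun i => Pi.single i 1)

/-- The affine map that sends the ordered vertices of the standard `k`-simplex to `v`. -/
def affineSimplex {F : Type*} [AddCommGroup F] [Module ℝ F] {k : ℕ} (v : Fin (k + 1) → F)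
    (s : Fin k → ℝ) : F :=
  v 0 + ∑ i, s i • (v i.succ - v 0)

/-- The `i`-th face (opposite to the `i`-th vertex) of the standard tetrahedron, parametrized by
the standard triangle. -/
def face (i : Fin 4) : (Fin 2 → ℝ) → (Fin 3 → ℝ) :=
  affineSimplex (stdVertex 3 ∘ i.succAbove)

/-! ### Differential forms on a 3-manifold -/

section Forms

variable {M : Type*} [TopologicalSpace M] [ChartedSpace (EuclideanSpace ℝ (Fin 3)) M]

/-- `V`-valued `k`-forms on `M`. -/
abbrev Form (M : Type*) [TopologicalSpace M] [ChartedSpace (EuclideanSpace ℝ (Fin 3)) M]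
    (k : ℕ) (V : Type*) [NormedAddCommGroup V] [NormedSpace ℝ V] :=
  (x : M) → (TangentSpace (𝓡 3) x) [⋀^Fin k]→L[ℝ] V

/-- The values on tangent vectors of a `V`-valued `k`-form on `M`. -/
abbrev FormValues (M : Type*) [TopologicalSpace M] [ChartedSpace (EuclideanSpace ℝ (Fin 3)) M]
    (k : ℕ) (V : Type*) :=
  (x : M) → (Fin k → TangentSpace (𝓡 3) x) → V

/-- The pullback of a form on `M` along `f : F → M`. -/
def pullback {F : Type*} [NormedAddCommGroup F] [NormedSpace ℝ F] {k : ℕ} {V : Type*}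
    [NormedAddCommGroup V] [NormedSpace ℝ V] (f : F → M) (α : Form M k V) :
    F → F [⋀^Fin k]→L[ℝ] V :=
  fun y => (α (f y)).compContinuousLinearMap (mfderiv 𝓘(ℝ, F) (𝓡 3) f y)

/-- The differential of a function on `M`. -/
def dFun {V : Type*} [NormedAddCommGroup V] [NormedSpace ℝ V] (f : M → V) : FormValues M 1 V :=
  fun x u => mfderiv (𝓡 3) 𝓘(ℝ, V) f x (u 0)

/-- The exterior derivative of a form on `M`, computed at `x` in the preferred chart at `x`. -/
def extd {k : ℕ} {V : Type*} [NormedAddCommGroup V] [NormedSpace ℝ V] (α : Form M k V) :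
    Form M (k + 1) V :=
  fun x => (extDeriv (pullback (extChartAt (𝓡 3) x).symm α)
    (extChartAt (𝓡 3) x x)).compContinuousLinearMap
      (mfderiv (𝓡 3) 𝓘(ℝ, EuclideanSpace ℝ (Fin 3)) (extChartAt (𝓡 3) x) x)

/-- A one-parameter family of forms is jointly smooth, in the parameter and the point of `M`,
at `(t, x)`. -/
def SmoothFormFamilyAt {k : ℕ} {V : Type*} [NormedAddCommGroup V] [NormedSpace ℝ V]
    (α : ℝ → Form M k V) (t : ℝ) (x : M) : Prop :=
  ContDiffAt ℝ ∞ (fun q : ℝ × EuclideanSpace ℝ (Fin 3) =>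
    pullback (extChartAt (𝓡 3) x).symm (α q.1) q.2) (t, extChartAt (𝓡 3) x x)

/-- A one-parameter family of functions is jointly smooth, in the parameter and the point of `M`,
at `(t, x)`. -/
def SmoothFamilyAt {V : Type*} [NormedAddCommGroup V] [NormedSpace ℝ V]
    (f : ℝ → M → V) (t : ℝ) (x : M) : Prop :=
  ContMDiffAt (𝓘(ℝ, ℝ).prod (𝓡 3)) 𝓘(ℝ, V) ∞ (fun q : ℝ × M => f q.1 q.2) (t, x)

/-- The values of the pullback of a form along `f : F → M`. -/
def pullValues {F : Type*} [NormedAddCommGroup F] [NormedSpace ℝ F] {k : ℕ} {V : Type*}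
    (f : F → M) (η : FormValues M k V) (s : F) (w : Fin k → F) : V :=
  η (f s) (fun i => mfderiv 𝓘(ℝ, F) (𝓡 3) f s (w i))

/-- The integral of a `k`-form over the singular simplex `f : Δᵏ → M`. -/
def integrate {k : ℕ} {V : Type*} [NormedAddCommGroup V] [NormedSpace ℝ V]
    (f : (Fin k → ℝ) → M) (η : FormValues M k V) : V :=
  ∫ s in stdCell k, pullValues f η s (fun i => Pi.single i 1)

/-- The value on three vectors of `⟨α ∧ β⟩`, for a 2-form `α` and a 1-form `β`. -/
def wedge21 {V W : Type*} (pair : V → W → ℝ) (α : FormValues M 2 V) (β : FormValues M 1 W) :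
    FormValues M 3 ℝ := fun x u =>
  pair (α x ![u 0, u 1]) (β x ![u 2]) - pair (α x ![u 0, u 2]) (β x ![u 1])
    + pair (α x ![u 1, u 2]) (β x ![u 0])

/-- The value on three vectors of `⟨α ∧ β⟩`, for a 1-form `α` and a 2-form `β`. -/
def wedge12 {V W : Type*} (pair : V → W → ℝ) (α : FormValues M 1 V) (β : FormValues M 2 W) :
    FormValues M 3 ℝ := fun x u =>
  pair (α x ![u 0]) (β x ![u 1, u 2]) - pair (α x ![u 1]) (β x ![u 0, u 2])
    + pair (α x ![u 2]) (β x ![u 0, u 1])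

/-- The variation `δη` of a one-parameter family of forms, at parameter `0`. -/
def variation {k : ℕ} {V : Type*} [NormedAddCommGroup V] [NormedSpace ℝ V]
    (η : ℝ → FormValues M k V) : FormValues M k V :=
  fun x u => deriv (fun t => η t x u) 0

end Forms

/-! ### Cellular decompositions into tetrahedra -/

/-- A coherently oriented decomposition of a closed 3-manifold `M` into smoothly embedded
tetrahedra, each carrying an order of its vertices, in which every triangle is shared by exactly
two tetrahedra. The triangles are indexed by the dual oriented links: the link `l` goes from the
tetrahedron `(source l).1` to the tetrahedron `(target l).1` through the common triangle, which is
the face `(source l).2` of the former and the face `(target l).2` of the latter. -/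
structure Triangulation (M : Type*) [TopologicalSpace M]
    [ChartedSpace (EuclideanSpace ℝ (Fin 3)) M] (Cell Link : Type*) where
  param : Cell → (Fin 3 → ℝ) → M
  smooth : ∀ c, ∀ p ∈ stdCell 3, ContMDiffAt 𝓘(ℝ, Fin 3 → ℝ) (𝓡 3) ∞ (param c) p
  immersion : ∀ c, ∀ p ∈ stdCell 3,
    Function.Injective (mfderiv 𝓘(ℝ, Fin 3 → ℝ) (𝓡 3) (param c) p)
  injOn : ∀ c, InjOn (param c) (stdCell 3)
  cover : ⋃ c, param c '' stdCell 3 = univ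
  disjoint : ∀ c c', c ≠ c' →
    Disjoint (param c '' interior (stdCell 3)) (param c' '' stdCell 3)
  source : Link → Cell × Fin 4
  target : Link → Cell × Fin 4
  /-- every face of every tetrahedron is the source or the target face of exactly one link -/
  faces : Function.Bijective (Sum.elim source target)
  /-- the bijection between the vertices of the two faces glued along a link -/
  glue : Link → Equiv.Perm (Fin 3)
  glue_eq : ∀ l, EqOn (param (source l).1 ∘ face (source l).2)
    (param (target l).1 ∘ affineSimplex (stdVertex 3 ∘ (target l).2.succAbove ∘ glue l))
    (stdCell 2)
  /-- the two tetrahedra induce opposite orientations on the common triangle -/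
  coherent : ∀ l, (-1 : ℤ) ^ ((source l).2 : ℕ) * (Equiv.Perm.sign (glue l) : ℤ)
    = -(-1 : ℤ) ^ ((target l).2 : ℕ)

section Potential

variable {M : Type*} [TopologicalSpace M] [ChartedSpace (EuclideanSpace ℝ (Fin 3)) M]
  {Cell Link : Type*}

/-- The closed tetrahedron `c*` in `M`. -/
def Triangulation.cellSet (T : Triangulation M Cell Link) (c : Cell) : Set M :=
  T.param c '' stdCell 3

/-- The triangle dual to the link `l`, parametrized as a face of its source tetrahedron. -/
def Triangulation.triangle (T : Triangulation M Cell Link) (l : Link) : (Fin 2 → ℝ) → M :=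
  T.param (T.source l).1 ∘ face (T.source l).2

/-- The integral of a 2-form over the triangle dual to `l`, oriented as part of the boundary of
the source tetrahedron of `l`. -/
def Triangulation.triangleIntegral (T : Triangulation M Cell Link) {V : Type*}
    [NormedAddCommGroup V] [NormedSpace ℝ V] (l : Link) (η : FormValues M 2 V) : V :=
  (-1 : ℝ) ^ ((T.source l).2 : ℕ) • integrate (T.triangle l) η

/-- The integral of a 2-form over the oriented boundary of the tetrahedron `c*`. -/
def Triangulation.boundaryIntegral (T : Triangulation M Cell Link) (c : Cell)
    (η : FormValues M 2 ℝ) : ℝ :=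
  ∑ i : Fin 4, (-1 : ℝ) ^ (i : ℕ) * integrate (T.param c ∘ face i) η

/-- Two forms on `M` have the same restriction to the triangle dual to `l`. -/
def Triangulation.AgreeOn (T : Triangulation M Cell Link) {V : Type*} {k : ℕ} (l : Link)
    (η η' : FormValues M k V) : Prop :=
  ∀ s ∈ stdCell 2, ∀ w : Fin k → (Fin 2 → ℝ),
    pullValues (T.triangle l) η s w = pullValues (T.triangle l) η' s w

/-- A smooth one-parameter family (parameter `t`) of the data that parametrize the on-shell fields
in the cells: for each tetrahedron `c`, a rotation `g`, a translation `c`, an `ℝ⁴*`-valued 1-form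
`σ` and an `so(4)*`-valued 1-form `b`. They are smooth near `c*`; their values away from `c*` play
no role. -/
structure OnShellData (T : Triangulation M Cell Link) where
  g : Cell → ℝ → M → SO4
  c : Cell → ℝ → M → R4
  b : Cell → ℝ → Form M 1 Mat4
  σ : Cell → ℝ → Form M 1 R4
  b_skew : ∀ i t x u, (b i t x u)ᵀ = -(b i t x u)
  g_smooth : ∀ i t, ∀ x ∈ T.cellSet i, SmoothFamilyAt (fun t y => (g i t y : Mat4)) t x
  c_smooth : ∀ i t, ∀ x ∈ T.cellSet i, SmoothFamilyAt (c i) t x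
  b_smooth : ∀ i t, ∀ x ∈ T.cellSet i, SmoothFormFamilyAt (b i) t x
  σ_smooth : ∀ i t, ∀ x ∈ T.cellSet i, SmoothFormFamilyAt (σ i) t x

namespace OnShellData

variable {T : Triangulation M Cell Link} (D : OnShellData T)

/-- `db` -/
def db (i : Cell) (t : ℝ) : FormValues M 2 Mat4 := fun x u => extd (D.b i t) x u

/-- `dσ` -/
def dσ (i : Cell) (t : ℝ) : FormValues M 2 R4 := fun x u => extd (D.σ i t) x u

/-- `A = g⁻¹ dg` -/
def A (i : Cell) (t : ℝ) : FormValues M 1 Mat4 := fun x u =>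
  ((D.g i t x)⁻¹ : SO4).1 * dFun (fun y => (D.g i t y : Mat4)) x u

/-- `C = g⁻¹ dc g`; the rotation group acts on the translations by `g⁻¹ v g = g⁻¹ *ᵥ v` -/
def C (i : Cell) (t : ℝ) : FormValues M 1 R4 := fun x u =>
  ((D.g i t x)⁻¹ : SO4).1 *ᵥ dFun (D.c i t) x u

/-- `Σ = g⁻¹ dσ g` -/
def Sig (i : Cell) (t : ℝ) : FormValues M 2 R4 := fun x u =>
  ((D.g i t x)⁻¹ : SO4).1 *ᵥ D.dσ i t x u

/-- `B = g⁻¹ (db + [dσ, c]) g` -/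
def B (i : Cell) (t : ℝ) : FormValues M 2 Mat4 := fun x u =>
  ((D.g i t x)⁻¹ : SO4).1 * (D.db i t x u + mixedBracket (D.dσ i t x u) (D.c i t x))
    * (D.g i t x).1

/-- The fields `A`, `B`, `C`, `Σ` of neighbouring cells agree on the triangle they share. -/
def Continuity : Prop :=
  ∀ l t,
    T.AgreeOn l (D.A (T.source l).1 t) (D.A (T.target l).1 t) ∧
    T.AgreeOn l (D.B (T.source l).1 t) (D.B (T.target l).1 t) ∧
    T.AgreeOn l (D.C (T.source l).1 t) (D.C (T.target l).1 t) ∧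
    T.AgreeOn l (D.Sig (T.source l).1 t) (D.Sig (T.target l).1 t)

/-- The potential `∫ ⟨B ∧ δA⟩ - ∫ ⟨C ∧ δΣ⟩` on the on-shell fields, evaluated on the variation given
by the one-parameter family; the integral over `M` is the sum of the integrals over the cells. -/
def potential [Fintype Cell] : ℝ :=
  ∑ i, (integrate (T.param i) (wedge21 pairSo (D.B i 0) (variation (D.A i)))
    - integrate (T.param i) (wedge12 (fun v w : R4 => v ⬝ᵥ w) (D.C i 0) (variation (D.Sig i))))

/-- `Δg = δg g⁻¹` -/
def Δg (i : Cell) (x : M) : Mat4 :=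
  deriv (fun t => (D.g i t x : Mat4)) 0 * ((D.g i 0 x)⁻¹ : SO4).1

/-- The 2-form `⟨db, Δg⟩ + ⟨[dσ, c], Δg⟩ - ⟨c, dδσ⟩`, whose derivatives are kept on `b` and `σ`. -/
def boundaryForm (i : Cell) : FormValues M 2 ℝ := fun x u =>
  pairSo (D.db i 0 x u) (D.Δg i x) + pairSo (mixedBracket (D.dσ i 0 x u) (D.c i 0 x)) (D.Δg i x)
    - D.c i 0 x ⬝ᵥ variation (D.dσ i) x u

/-- The constants `h_{cc'}` and `x_c^{c'}` of the links solve the continuity equations of `g` and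
`c`: on the triangle, `g_c = h_{cc'} g_{c'}` and `c_{c'} = h_{cc'}⁻¹ (c_c + x_c^{c'}) h_{cc'}`. -/
def IsContinuitySolution (h : Link → ℝ → SO4) (x : Link → ℝ → R4) : Prop :=
  ∀ l t, ∀ s ∈ stdCell 2,
    D.g (T.source l).1 t (T.triangle l s) = h l t * D.g (T.target l).1 t (T.triangle l s) ∧
    D.c (T.target l).1 t (T.triangle l s)
      = ((h l t)⁻¹ : SO4).1 *ᵥ (D.c (T.source l).1 t (T.triangle l s) + x l t)

end OnShellData

end Potential

/-! ### The phase space of a link -/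

/-- The ambient linear space of the variables `(h, x, b, V)` of a link and its dual triangle. -/
abbrev LinkVars : Type := Mat4 × R4 × Mat4 × R4

/-- `SO(4) × ℝ⁴ × so(4)* × ℝ⁴*` -/
def linkPhaseSpace : Set LinkVars :=
  {p | p.1 ∈ Matrix.specialOrthogonalGroup (Fin 4) ℝ ∧ p.2.2.1ᵀ = -p.2.2.1}

/-- The vectors tangent to `linkPhaseSpace` at its point `p`. -/
def tangentVectors (p : LinkVars) : Set LinkVars :=
  {v | (v.1 * p.1ᵀ)ᵀ = -(v.1 * p.1ᵀ) ∧ v.2.2.1ᵀ = -v.2.2.1}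

/-- `⟨Δh, b⟩ + ⟨[Δh, x], V⟩ + ⟨x, δV⟩` at `p = (h, x, b, V)`, on the variation
`v = (δh, δx, δb, δV)`, with `Δh = δh h⁻¹`. -/
def bfcgLinkPotential (p v : LinkVars) : ℝ :=
  pairSo p.2.2.1 (v.1 * p.1ᵀ) + ((v.1 * p.1ᵀ) *ᵥ p.2.1) ⬝ᵥ p.2.2.2 + p.2.1 ⬝ᵥ v.2.2.2

/-- The potential `⟨b, Δh⟩ + ⟨V, δx⟩ + ⟨V, [x, Δh]⟩` of the BF discretization. -/
def bfLinkPotential (p v : LinkVars) : ℝ :=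
  pairSo p.2.2.1 (v.1 * p.1ᵀ) + p.2.2.2 ⬝ᵥ v.2.1 + p.2.2.2 ⬝ᵥ (-((v.1 * p.1ᵀ) *ᵥ p.2.1))

/-- The ambient space of `ISO(4) × iso(4)*`; `ISO(4)` consists of the affine `5 × 5` matrices. -/
abbrev CotangentVars : Type := Matrix (Fin 4 ⊕ Unit) (Fin 4 ⊕ Unit) ℝ × Mat4 × R4

/-- `(h, x, b, V) ↦ (e^x h, b + V)`, where `e^x = 1 + x` is the translation by `x`. -/
def toCotangent (p : LinkVars) : CotangentVars :=
  (fromBlocks 1 (replicateCol Unit p.2.1) 0 1 * fromBlocks p.1 0 0 1, p.2.2)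

/-- The canonical one-form `⟨β, δ𝒢 𝒢⁻¹⟩` of `T*ISO(4)`, trivialized by right translations as
`ISO(4) × iso(4)*`, at `q = (𝒢, b + V)`. -/
def canonicalForm (q w : CotangentVars) : ℝ :=
  pairSo q.2.1 (w.1 * q.1⁻¹).toBlocks₁₁
    + q.2.2 ⬝ᵥ (fun i => (w.1 * q.1⁻¹) (Sum.inl i) (Sum.inr ()))

/-- Change of the sign of `V`. -/
def flipV (p : LinkVars) : LinkVars := (p.1, p.2.1, p.2.2.1, -p.2.2.2)

/-- The exterior derivative of the one-form `θ` at `p`, on the vectors `u`, `v`. -/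
def extDOne (θ : LinkVars → LinkVars → ℝ) (p u v : LinkVars) : ℝ :=
  fderiv ℝ (fun q => θ q v) p u - fderiv ℝ (fun q => θ q u) p v

/-- The variables `(h, x, b, V)` of the link `l`, with `b = ∫ db_c` and `V = ∫ dσ_c` over the
triangle dual to `l`, where `c` is the source of `l`. -/
def linkVars {M : Type*} [TopologicalSpace M] [ChartedSpace (EuclideanSpace ℝ (Fin 3)) M]
    {Cell Link : Type*} {T : Triangulation M Cell Link} (D : OnShellData T)
    (h : Link → ℝ → SO4) (x : Link → ℝ → R4) (l : Link) (t : ℝ) : LinkVars :=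
  ((h l t : Mat4), x l t, T.triangleIntegral l (D.db (T.source l).1 t),
    T.triangleIntegral l (D.dσ (T.source l).1 t))

end BFCG

end

noncomputable section

namespace BFCG

open Filter Topology

/-! On shell, the variation of A is g⁻¹ d(Δg) g and the variation of Σ is g⁻¹ (dδσ - Δg dσ). Both
pairings are invariant under rotations, so g disappears from the integrand. Invariance of the
pairing under the mixed bracket then brings the integrand to ⟨db + [dσ, c], dΔg⟩ + ⟨[dσ, dc], Δg⟩ -
⟨dc, dδσ⟩. As db, dσ and dδσ are closed, this is the exterior derivative of ⟨db, Δg⟩ + ⟨[dσ, c], Δg⟩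
- ⟨c, dδσ⟩ (`extDeriv_pulledBoundaryForm`). Stokes on the standard tetrahedron (`stokes_stdCell`,
proved by Fubini and the fundamental theorem of calculus) gives the boundary integrals. All calculus
is done on Euclidean simplices, to which `extDeriv_pullback_eq` transfers the exterior derivative of
M.

Every triangle occurs twice with opposite orientations, so the boundary integrals combine into one
difference of boundary forms per link (`sum_boundaryIntegral_eq`). Agreement of A on the triangle
says that g_c g_{c'}⁻¹ has zero derivative there, hence is a constant h. Agreement of C then makes h
c_{c'} - c_c a constant x. Agreement of Σ and B gives the rules for dσ and db. In the difference of
the boundary forms, Δg_{c'} = h⁻¹ (Δg_c - Δh) h and the variation of dσ_{c'} is h⁻¹ (dδσ_c - Δh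
dσ_c). Every term containing g_c or c_c cancels, and ⟨db, Δh⟩ + ⟨Δh x, dσ⟩ + ⟨x, dδσ⟩ remains
(`boundaryForm_source_sub_target`). As Δh and x are constant on the triangle, they leave the
integral (`link_contribution`).

The statements on the phase space of a link are linear algebra: the product rule for ⟨x, V⟩, the
inverse of an affine matrix, and one test vector for each component of a vector in the kernel of the
two-form. -/

theorem minSmoothness_two_le : minSmoothness ℝ 2 ≤ ∞ := by
  simp only [minSmoothness_of_isRCLikeNormedField]
  exact WithTop.coe_le_coe.2 (le_top : (2 : ℕ∞) ≤ ⊤)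

/-! ### Pullbacks of forms along smooth maps -/

section Pullback

variable {M : Type*} [TopologicalSpace M] [ChartedSpace (EuclideanSpace ℝ (Fin 3)) M]
  {F : Type*} [NormedAddCommGroup F] [NormedSpace ℝ F]
  {V : Type*} [NormedAddCommGroup V] [NormedSpace ℝ V] {k : ℕ}

/-- The tangent spaces at two points are different types. Reading both in the model space makes the
values comparable. -/
theorem form_congr_point (α : Form M k V) {a b : M} (hab : a = b)
    (v : Fin k → EuclideanSpace ℝ (Fin 3)) :
    (α a : EuclideanSpace ℝ (Fin 3) [⋀^Fin k]→L[ℝ] V) v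
      = (α b : EuclideanSpace ℝ (Fin 3) [⋀^Fin k]→L[ℝ] V) v := by
  subst hab
  rfl

theorem contDiffAt_extChartAt_comp {f : F → M} {p : F}
    (hf : ContMDiffAt 𝓘(ℝ, F) (𝓡 3) ∞ f p) :
    ContDiffAt ℝ ∞ (extChartAt (𝓡 3) (f p) ∘ f) p :=
  ((contMDiffAt_extChartAt (n := ∞)).comp p hf).contDiffAt

variable [IsManifold (𝓡 3) ∞ M]

/-- Near a point, the pullback of a form along `f` factors through the preferred chart. -/
theorem pullback_eventuallyEq_chart {f : F → M} {p : F}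
    (hf : ContMDiffAt 𝓘(ℝ, F) (𝓡 3) ∞ f p) :
    ∀ᶠ y in 𝓝 p, ∀ α : Form M k V, pullback f α y =
      (pullback (extChartAt (𝓡 3) (f p)).symm α
        ((extChartAt (𝓡 3) (f p) ∘ f) y)).compContinuousLinearMap
          (fderiv ℝ (extChartAt (𝓡 3) (f p) ∘ f) y) := by
  -- The neighbourhood depends on `f` only. It therefore serves all forms at once, as a family in
  -- the parameter requires.
  have h1 : ∀ᶠ y in 𝓝 p, f y ∈ (extChartAt (𝓡 3) (f p)).source :=
    hf.continuousAt.preimage_mem_nhds (extChartAt_source_mem_nhds (f p))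
  have h2 : ∀ᶠ y in 𝓝 p, ContMDiffAt 𝓘(ℝ, F) (𝓡 3) 1 f y :=
    (contMDiffAt_iff_contMDiffAt_nhds (by simp)).1 (hf.of_le (m := 1) (by simp))
  filter_upwards [h1, h2] with y hy hfy α
  have hfy' : MDifferentiableAt 𝓘(ℝ, F) (𝓡 3) f y := hfy.mdifferentiableAt one_ne_zero
  have hχ : MDifferentiableAt (𝓡 3) 𝓘(ℝ, EuclideanSpace ℝ (Fin 3)) (extChartAt (𝓡 3) (f p))
      (f y) := mdifferentiableAt_extChartAt (by simpa using hy)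
  have hcomp : fderiv ℝ (extChartAt (𝓡 3) (f p) ∘ f) y =
      (mfderiv (𝓡 3) 𝓘(ℝ, EuclideanSpace ℝ (Fin 3)) (extChartAt (𝓡 3) (f p)) (f y)).comp
        (mfderiv 𝓘(ℝ, F) (𝓡 3) f y) := by
    rw [← mfderiv_eq_fderiv]
    exact mfderiv_comp y hχ hfy'
  have hleft : (extChartAt (𝓡 3) (f p)).symm (extChartAt (𝓡 3) (f p) (f y)) = f y :=
    (extChartAt (𝓡 3) (f p)).left_inv hy
  -- The derivatives of the chart and of its inverse cancel, so a vector pushed forward by `f` may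
  -- be routed through the chart.
  have hinv := mfderivWithin_extChartAt_symm_comp_mfderiv_extChartAt' (I := 𝓡 3) (x := f p) hy
  simp only [ModelWithCorners.range_eq_univ, mfderivWithin_univ] at hinv
  ext v
  have hv : ∀ i, mfderiv 𝓘(ℝ, F) (𝓡 3) f y (v i) =
      mfderiv 𝓘(ℝ, EuclideanSpace ℝ (Fin 3)) (𝓡 3) (extChartAt (𝓡 3) (f p)).symm
        (extChartAt (𝓡 3) (f p) (f y)) (fderiv ℝ (extChartAt (𝓡 3) (f p) ∘ f) y (v i)) := by
    intro i
    rw [hcomp]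
    exact (DFunLike.congr_fun hinv (mfderiv 𝓘(ℝ, F) (𝓡 3) f y (v i))).symm
  refine (congrArg (α (f y)) (funext hv)).trans ?_
  exact (form_congr_point α hleft _).symm

/-- The exterior derivative commutes with pullbacks. -/
theorem extDeriv_pullback_eq {f : F → M} {p : F} (hf : ContMDiffAt 𝓘(ℝ, F) (𝓡 3) ∞ f p)
    {α : ℝ → Form M k V} {t : ℝ} (hα : SmoothFormFamilyAt α t (f p)) :
    extDeriv (pullback f (α t)) p = pullback f (extd (α t)) p := by
  have h1 : (pullback f (α t)) =ᶠ[𝓝 p] _ :=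
    (pullback_eventuallyEq_chart hf).mono fun y hy => hy (α t)
  have hχf := contDiffAt_extChartAt_comp hf
  have hη : DifferentiableAt ℝ (pullback (extChartAt (𝓡 3) (f p)).symm (α t))
      ((extChartAt (𝓡 3) (f p) ∘ f) p) := by
    have := hα.differentiableAt (by simp)
    exact this.comp (f := fun y => (t, y)) _ (by fun_prop)
  -- `extd` at `f p` is by definition computed in the chart at `f p`, so naturality between normed
  -- spaces is enough.
  rw [h1.extDeriv_eq, extDeriv_pullback hη hχf minSmoothness_two_le]
  have hcomp : fderiv ℝ (extChartAt (𝓡 3) (f p) ∘ f) p =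
      (mfderiv (𝓡 3) 𝓘(ℝ, EuclideanSpace ℝ (Fin 3)) (extChartAt (𝓡 3) (f p)) (f p)).comp
        (mfderiv 𝓘(ℝ, F) (𝓡 3) f p) := by
    rw [← mfderiv_eq_fderiv]
    exact mfderiv_comp p (mdifferentiableAt_extChartAt (by simp)) (hf.mdifferentiableAt (by simp))
  rw [hcomp]
  rfl

/-- The pullback of a smooth family of 1-forms is a smooth family. -/
theorem contDiffAt_pullback {f : F → M} {p : F} (hf : ContMDiffAt 𝓘(ℝ, F) (𝓡 3) ∞ f p)
    {α : ℝ → Form M 1 V} {t : ℝ} (hα : SmoothFormFamilyAt α t (f p)) :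
    ContDiffAt ℝ ∞ (fun q : ℝ × F => pullback f (α q.1) q.2) (t, p) := by
  have hχf := contDiffAt_extChartAt_comp hf
  -- As a linear map, a 1-form is pulled back by composition with the derivative, and composition is
  -- smooth in both factors.
  let L := ContinuousAlternatingMap.ofSubsingletonLIE (𝕜 := ℝ) (E := EuclideanSpace ℝ (Fin 3))
    (F := V) (0 : Fin 1)
  let L' := ContinuousAlternatingMap.ofSubsingletonLIE (𝕜 := ℝ) (E := F) (F := V) (0 : Fin 1)
  have h1 : (fun q : ℝ × F => pullback f (α q.1) q.2) =ᶠ[𝓝 (t, p)] fun q =>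
      L' ((L.symm (pullback (extChartAt (𝓡 3) (f p)).symm (α q.1)
        ((extChartAt (𝓡 3) (f p) ∘ f) q.2))).comp
          (fderiv ℝ (extChartAt (𝓡 3) (f p) ∘ f) q.2)) := by
    have h2 : ∀ᶠ q : ℝ × F in 𝓝 (t, p), _ :=
      continuousAt_snd.eventually (pullback_eventuallyEq_chart (k := 1) (V := V) hf)
    filter_upwards [h2] with q hq
    rw [hq (α q.1)]
    ext v
    refine congrArg (pullback (extChartAt (𝓡 3) (f p)).symm (α q.1) _) (funext fun i => ?_)
    simp [Subsingleton.elim i 0]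
  refine ContDiffAt.congr_of_eventuallyEq ?_ h1
  refine L'.toContinuousLinearEquiv.contDiff.contDiffAt.comp _ (ContDiffAt.clm_comp ?_ ?_)
  · refine L.symm.toContinuousLinearEquiv.contDiff.contDiffAt.comp _ ?_
    refine ContDiffAt.comp (t, p) (f := fun q : ℝ × F =>
      (q.1, (extChartAt (𝓡 3) (f p) ∘ f) q.2)) hα ?_
    exact contDiffAt_fst.prodMk
      (ContDiffAt.comp (g := extChartAt (𝓡 3) (f p) ∘ f) (t, p) hχf contDiffAt_snd)
  · exact (hχf.fderiv_right (m := ∞) (by simp)).comp (t, p) contDiffAt_snd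

end Pullback

/-! ### Families depending on a parameter -/

section Families

variable {E : Type*} [NormedAddCommGroup E] [NormedSpace ℝ E]
  {V : Type*} [NormedAddCommGroup V] [NormedSpace ℝ V] {k : ℕ}

theorem contDiffAt_fderiv_family {H : ℝ → E → V} {t : ℝ} {p : E}
    (hH : ContDiffAt ℝ ∞ (fun q : ℝ × E => H q.1 q.2) (t, p)) :
    ContDiffAt ℝ ∞ (fun q : ℝ × E => fderiv ℝ (H q.1) q.2) (t, p) := by
  refine ContDiffAt.fderiv (n := ∞) (f := fun q : ℝ × E => H q.1) (g := Prod.snd) ?_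
    contDiffAt_snd (by simp)
  exact ContDiffAt.comp (f := fun r : (ℝ × E) × E => (r.1.1, r.2)) ((t, p), p) hH (by fun_prop)

theorem contDiffAt_extDeriv_family {η : ℝ → E → E [⋀^Fin k]→L[ℝ] V} {t : ℝ} {p : E}
    (hη : ContDiffAt ℝ ∞ (fun q : ℝ × E => η q.1 q.2) (t, p)) :
    ContDiffAt ℝ ∞ (fun q : ℝ × E => extDeriv (η q.1) q.2) (t, p) := by
  let L : (E →L[ℝ] E [⋀^Fin k]→L[ℝ] V) →L[ℝ] E [⋀^Fin (k + 1)]→L[ℝ] V :=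
    ContinuousAlternatingMap.alternatizeUncurryFinCLM ℝ E V
  exact (contDiffAt_fderiv_family hη).continuousLinearMap_comp L

theorem contDiffAt_of_family {H : ℝ → E → V} {t : ℝ} {p : E} {n : WithTop ℕ∞}
    (hH : ContDiffAt ℝ n (fun q : ℝ × E => H q.1 q.2) (t, p)) : ContDiffAt ℝ n (H t) p :=
  ContDiffAt.comp p hH (f := fun y => (t, y)) (by fun_prop)

theorem contDiffAt_param_of_family {H : ℝ → E → V} {t : ℝ} {p : E} {n : WithTop ℕ∞}
    (hH : ContDiffAt ℝ n (fun q : ℝ × E => H q.1 q.2) (t, p)) :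
    ContDiffAt ℝ n (fun s => H s p) t :=
  ContDiffAt.comp t hH (f := fun s => (s, p)) (by fun_prop)

theorem deriv_family_eq {H : ℝ → E → V} {q : ℝ × E}
    (hH : DifferentiableAt ℝ (fun q : ℝ × E => H q.1 q.2) q) :
    deriv (fun s => H s q.2) q.1 = fderiv ℝ (fun q : ℝ × E => H q.1 q.2) q (1, 0) := by
  have h := HasFDerivAt.comp_hasDerivAt (f := fun s : ℝ => (s, q.2)) q.1 hH.hasFDerivAt
    ((hasDerivAt_id q.1).prodMk (hasDerivAt_const q.1 q.2))
  exact h.deriv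

theorem fderiv_family_eq {H : ℝ → E → V} {q : ℝ × E}
    (hH : DifferentiableAt ℝ (fun q : ℝ × E => H q.1 q.2) q) :
    fderiv ℝ (H q.1) q.2
      = (fderiv ℝ (fun q : ℝ × E => H q.1 q.2) q).comp (ContinuousLinearMap.inr ℝ ℝ E) := by
  have h := HasFDerivAt.comp (f := fun y : E => (q.1, y)) q.2 hH.hasFDerivAt
    (hasFDerivAt_prodMk_right q.1 q.2)
  exact h.fderiv

theorem contDiffAt_deriv_family {H : ℝ → E → V} {t : ℝ} {p : E}
    (hH : ContDiffAt ℝ ∞ (fun q : ℝ × E => H q.1 q.2) (t, p)) :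
    ContDiffAt ℝ ∞ (fun q : ℝ × E => deriv (fun s => H s q.2) q.1) (t, p) := by
  have h1 : ∀ᶠ q in 𝓝 (t, p), ContDiffAt ℝ 1 (fun q : ℝ × E => H q.1 q.2) q :=
    (hH.of_le (m := 1) (by simp)).eventually (by simp)
  refine ContDiffAt.congr_of_eventuallyEq (f := fun q =>
    fderiv ℝ (fun q : ℝ × E => H q.1 q.2) q (1, 0)) ?_ ?_
  · exact (hH.fderiv_right (m := ∞) (by simp)).clm_apply contDiffAt_const
  · filter_upwards [h1] with q hq
    exact deriv_family_eq (hq.differentiableAt one_ne_zero)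

/-- The derivatives in the parameter and in the point commute. -/
theorem hasDerivAt_fderiv_family {H : ℝ → E → V} {t : ℝ} {p : E}
    (hH : ContDiffAt ℝ ∞ (fun q : ℝ × E => H q.1 q.2) (t, p)) :
    HasDerivAt (fun s => fderiv ℝ (H s) p)
      (fderiv ℝ (fun y => deriv (fun s => H s y) t) p) t := by
  set Hu : ℝ × E → V := fun q => H q.1 q.2 with hHu
  have h1 : ∀ᶠ q in 𝓝 (t, p), DifferentiableAt ℝ Hu q :=
    ((hH.of_le (m := 1) (by simp)).eventually (by simp)).mono
      fun q hq => hq.differentiableAt one_ne_zero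
  have h2 : HasFDerivAt (fderiv ℝ Hu) (fderiv ℝ (fderiv ℝ Hu) (t, p)) (t, p) :=
    ((hH.fderiv_right (m := ∞) (by simp)).differentiableAt (by simp)).hasFDerivAt
  -- Both mixed derivatives are values of the second derivative of the joint function, on `(1, 0)`
  -- and `(0, e)` in the two orders.
  have hsymm : IsSymmSndFDerivAt ℝ Hu (t, p) :=
    hH.isSymmSndFDerivAt minSmoothness_two_le
  have h3 : HasFDerivAt (fun y => deriv (fun s => H s y) t)
      ((ContinuousLinearMap.apply ℝ V ((1 : ℝ), (0 : E))).comp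
        ((fderiv ℝ (fderiv ℝ Hu) (t, p)).comp (ContinuousLinearMap.inr ℝ ℝ E))) p := by
    have h := ((ContinuousLinearMap.apply ℝ V ((1 : ℝ), (0 : E))).hasFDerivAt.comp (t, p) h2).comp
      (f := fun y : E => (t, y)) p (hasFDerivAt_prodMk_right t p)
    refine h.congr_of_eventuallyEq ?_
    have h4 : ∀ᶠ y in 𝓝 p, DifferentiableAt ℝ Hu (t, y) :=
      (Continuous.prodMk_right t).continuousAt.eventually h1
    filter_upwards [h4] with y hy
    exact deriv_family_eq hy
  have h5 : HasDerivAt (fun s => fderiv ℝ (H s) p)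
      ((fderiv ℝ (fderiv ℝ Hu) (t, p) (1, 0)).comp (ContinuousLinearMap.inr ℝ ℝ E)) t := by
    have h := (((ContinuousLinearMap.compL ℝ E (ℝ × E) V).flip
      (ContinuousLinearMap.inr ℝ ℝ E)).hasFDerivAt.comp (t, p) h2).comp_hasDerivAt
        (f := fun s : ℝ => (s, p)) t ((hasDerivAt_id t).prodMk (hasDerivAt_const t p))
    refine h.congr_of_eventuallyEq ?_
    have h4 : ∀ᶠ s in 𝓝 t, DifferentiableAt ℝ Hu (s, p) :=
      (Continuous.prodMk_left p).continuousAt.eventually h1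
    filter_upwards [h4] with s hs
    exact fderiv_family_eq hs
  rw [h3.fderiv]
  convert h5 using 1
  ext e
  exact hsymm _ _

end Families

/-! ### Affine simplices -/

section Simplex

variable {F : Type*} [NormedAddCommGroup F] [NormedSpace ℝ F] {k : ℕ}

@[simp]
theorem stdVertex_zero : stdVertex k 0 = 0 := rfl

@[simp]
theorem stdVertex_succ (i : Fin k) : stdVertex k i.succ = Pi.single i 1 := rfl

/-- The linear part of `affineSimplex v`. -/
def affineSimplexLin (v : Fin (k + 1) → F) : (Fin k → ℝ) →L[ℝ] F :=
  ∑ i, (ContinuousLinearMap.proj (R := ℝ) (φ := fun _ : Fin k => ℝ) i).smulRight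
    (v i.succ - v 0)

theorem affineSimplexLin_apply (v : Fin (k + 1) → F) (s : Fin k → ℝ) :
    affineSimplexLin v s = ∑ i, s i • (v i.succ - v 0) := by
  simp [affineSimplexLin]

theorem affineSimplexLin_single (v : Fin (k + 1) → F) (i : Fin k) :
    affineSimplexLin v (Pi.single i 1) = v i.succ - v 0 := by
  rw [affineSimplexLin_apply, Finset.sum_eq_single i] <;> simp +contextual

theorem affineSimplex_eq (v : Fin (k + 1) → F) (s : Fin k → ℝ) :
    affineSimplex v s = v 0 + affineSimplexLin v s := by
  rw [affineSimplexLin_apply, affineSimplex]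

theorem hasFDerivAt_affineSimplex (v : Fin (k + 1) → F) (s : Fin k → ℝ) :
    HasFDerivAt (affineSimplex v) (affineSimplexLin v) s := by
  have h : affineSimplex v = fun s => v 0 + affineSimplexLin v s := funext (affineSimplex_eq v)
  rw [h]
  exact (affineSimplexLin v).hasFDerivAt.const_add _

theorem contDiff_affineSimplex {n : WithTop ℕ∞} (v : Fin (k + 1) → F) :
    ContDiff ℝ n (affineSimplex v) := by
  have h : affineSimplex v = fun s => v 0 + affineSimplexLin v s := funext (affineSimplex_eq v)
  rw [h]
  exact contDiff_const.add (affineSimplexLin v).contDiff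

/-- Barycentric coordinates: vertex `0` has weight 1 - ∑ s, so the points of the standard cell are
those with nonnegative weights. -/
theorem affineSimplex_eq_sum (v : Fin (k + 1) → F) (s : Fin k → ℝ) :
    affineSimplex v s = ∑ j, (Fin.cons (1 - ∑ i, s i) s : Fin (k + 1) → ℝ) j • v j := by
  simp only [affineSimplex, Fin.sum_univ_succ, Fin.cons_zero, Fin.cons_succ, smul_sub,
    Finset.sum_sub_distrib, sub_smul, one_smul, Finset.sum_smul]
  abel

theorem affineSimplex_mem {K : Set F} (hK : Convex ℝ K) {v : Fin (k + 1) → F}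
    (hv : ∀ j, v j ∈ K) {s : Fin k → ℝ} (hs : s ∈ stdCell k) : affineSimplex v s ∈ K := by
  rw [affineSimplex_eq_sum]
  refine hK.sum_mem (fun j _ => ?_) ?_ (fun j _ => hv j)
  · refine Fin.cases ?_ (fun i => ?_) j
    · simpa using hs.2
    · simpa using hs.1 i
  · simp [Fin.sum_univ_succ]

theorem affineSimplex_stdVertex (v : Fin (k + 1) → F) (j : Fin (k + 1)) :
    affineSimplex v (stdVertex k j) = v j := by
  refine Fin.cases ?_ (fun i => ?_) j
  · simp [stdVertex, affineSimplex]
  · rw [affineSimplex_eq]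
    simp [stdVertex, affineSimplexLin_single]

/-- An affine map carries vertices to vertices, so reparametrizations of faces can be compared on
vertices alone. -/
theorem affineSimplex_comp {m : ℕ} (v : Fin (k + 1) → F) (w : Fin (m + 1) → Fin k → ℝ) :
    affineSimplex v ∘ affineSimplex w = affineSimplex (affineSimplex v ∘ w) := by
  funext s
  rw [Function.comp_apply, affineSimplex_eq v, affineSimplex, affineSimplex]
  simp only [Function.comp_apply, affineSimplex_eq v, map_add, map_sum, map_smul,
    map_sub, add_sub_add_left_eq_sub, add_assoc]

theorem affineSimplex_stdVertex_eq_id : affineSimplex (stdVertex k) = id := by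
  funext s
  ext j
  simp [affineSimplex, stdVertex, Finset.sum_apply, Pi.single_apply]

theorem convex_stdCell : Convex ℝ (stdCell k) := by
  have h : stdCell k = (⋂ i, {s : Fin k → ℝ | 0 ≤ s i}) ∩ {s | ∑ i, s i ≤ 1} := by
    ext s; simp [stdCell]
  rw [h]
  refine (convex_iInter fun i => ?_).inter ?_
  · exact convex_halfSpace_ge (f := fun s : Fin k → ℝ => s i) ⟨fun _ _ => rfl, fun _ _ => rfl⟩ 0
  · exact convex_halfSpace_le (f := fun s : Fin k → ℝ => ∑ i, s i)
      ⟨fun _ _ => by simp [Finset.sum_add_distrib], fun _ _ => by simp [Finset.mul_sum]⟩ 1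

theorem isClosed_stdCell : IsClosed (stdCell k) := by
  have h : stdCell k = (⋂ i, {s : Fin k → ℝ | 0 ≤ s i}) ∩ {s | ∑ i, s i ≤ 1} := by
    ext s; simp [stdCell]
  rw [h]
  exact (isClosed_iInter fun i => isClosed_le continuous_const (continuous_apply i)).inter
    (isClosed_le (by fun_prop) continuous_const)

theorem isCompact_stdCell : IsCompact (stdCell k) := by
  refine (isCompact_Icc (a := (0 : Fin k → ℝ)) (b := 1)).of_isClosed_subset isClosed_stdCell ?_
  intro s hs
  refine ⟨fun i => hs.1 i, fun i => ?_⟩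
  exact (Finset.single_le_sum (f := s) (fun j _ => hs.1 j) (Finset.mem_univ i)).trans hs.2

theorem measurableSet_stdCell : MeasurableSet (stdCell k) := isClosed_stdCell.measurableSet

/-- A convex set with an interior point determines derivatives even at its boundary points. The
interior point used is the barycentre. -/
theorem uniqueDiffOn_stdCell : UniqueDiffOn ℝ (stdCell k) := by
  refine uniqueDiffOn_convex convex_stdCell ⟨fun _ => 1 / (k + 1 : ℝ), ?_⟩
  refine interior_maximal (t := {s : Fin k → ℝ | (∀ i, 0 < s i) ∧ ∑ i, s i < 1}) ?_ ?_ ?_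
  · exact fun s hs => ⟨fun i => (hs.1 i).le, hs.2.le⟩
  · have h : {s : Fin k → ℝ | (∀ i, 0 < s i) ∧ ∑ i, s i < 1}
        = (⋂ i, {s : Fin k → ℝ | 0 < s i}) ∩ {s | ∑ i, s i < 1} := by
      ext s; simp
    rw [h]
    exact (isOpen_iInter_of_finite fun i => isOpen_lt continuous_const (continuous_apply i)).inter
      (isOpen_lt (by fun_prop) continuous_const)
  · refine ⟨fun i => by positivity, ?_⟩
    simp only [Finset.sum_const, Finset.card_univ, Fintype.card_fin, nsmul_eq_mul]
    rw [mul_one_div, div_lt_one (by positivity)]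
    linarith

theorem stdVertex_mem (j : Fin (k + 1)) : stdVertex k j ∈ stdCell k := by
  refine Fin.cases ?_ (fun i => ?_) j
  · simp [stdVertex, stdCell]
  · refine ⟨fun l => ?_, ?_⟩
    · simp only [stdVertex, Fin.cons_succ, Pi.single_apply]
      split_ifs <;> norm_num
    · simp [stdVertex, Pi.single_apply]

theorem face_mem (i : Fin 4) {s : Fin 2 → ℝ} (hs : s ∈ stdCell 2) : face i s ∈ stdCell 3 :=
  affineSimplex_mem convex_stdCell (fun _ => stdVertex_mem _) hs

end Simplex

/-! ### Integrals over standard simplices -/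

/-- Fubini with the coordinate `i` singled out: over a point of the smaller cell, that coordinate
runs up to what the other coordinates leave of the total weight one. -/
theorem integral_stdCell_succ {n : ℕ} {f : (Fin (n + 1) → ℝ) → ℝ}
    (hf : ContinuousOn f (stdCell (n + 1))) (i : Fin (n + 1)) :
    ∫ p in stdCell (n + 1), f p
      = ∫ s in stdCell n, ∫ a in (0 : ℝ)..(1 - ∑ j, s j), f (i.insertNth a s) := by
  let e := MeasurableEquiv.piFinSuccAbove (fun _ : Fin (n + 1) => ℝ) i
  have hmp : MeasurePreserving e := volume_preserving_piFinSuccAbove (fun _ => ℝ) i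
  let S : Set (ℝ × (Fin n → ℝ)) := {q | q.2 ∈ stdCell n ∧ q.1 ∈ Icc 0 (1 - ∑ j, q.2 j)}
  have hS : e ⁻¹' S = stdCell (n + 1) := by
    ext p
    have hp : e p = (p i, i.removeNth p) := rfl
    simp only [mem_preimage, hp, S, mem_ofPred_eq, stdCell, Fin.removeNth, mem_Icc]
    rw [Fin.forall_iff_succAbove i, Fin.sum_univ_succAbove _ i]
    constructor
    · rintro ⟨⟨h1, h2⟩, h3, h4⟩
      exact ⟨⟨h3, h1⟩, by linarith⟩
    · rintro ⟨⟨h3, h1⟩, h4⟩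
      exact ⟨⟨h1, by linarith⟩, h3, by linarith⟩
  have hSm : MeasurableSet S := by
    rw [← e.measurableSet_preimage, hS]
    exact measurableSet_stdCell
  let g : ℝ × (Fin n → ℝ) → ℝ := fun q => f (i.insertNth q.1 q.2)
  have hge : ∀ p, g (e p) = f p := fun p => congrArg f (Fin.insertNth_self_removeNth i p)
  have hint : Integrable (S.indicator g) (volume.prod volume) := by
    rw [integrable_indicator_iff hSm]
    have h := (hmp.integrableOn_comp_preimage e.measurableEmbedding (f := g) (s := S)).1
    refine h ?_
    rw [hS]
    exact (hf.integrableOn_compact isCompact_stdCell).congr_fun (fun p _ => (hge p).symm)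
      measurableSet_stdCell
  have h1 : ∫ p in stdCell (n + 1), f p = ∫ q in S, g q := by
    rw [← hmp.setIntegral_preimage_emb e.measurableEmbedding g S, hS]
    exact setIntegral_congr_fun measurableSet_stdCell fun p _ => (hge p).symm
  rw [h1, ← integral_indicator hSm, Measure.volume_eq_prod, integral_prod_symm _ hint,
    ← integral_indicator measurableSet_stdCell]
  refine integral_congr_ae (Eventually.of_forall fun s => ?_)
  by_cases hs : s ∈ stdCell n
  · have h2 : (fun a => S.indicator g (a, s))
        = (Icc 0 (1 - ∑ j, s j)).indicator fun a => f (i.insertNth a s) := by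
      funext a
      by_cases ha : a ∈ Icc 0 (1 - ∑ j, s j)
      · rw [indicator_of_mem ha, indicator_of_mem (show (a, s) ∈ S from ⟨hs, ha⟩)]
      · rw [indicator_of_notMem ha, indicator_of_notMem (fun h : (a, s) ∈ S => ha h.2)]
    simp only [h2, indicator_of_mem hs]
    rw [integral_indicator measurableSet_Icc, integral_Icc_eq_integral_Ioc,
      intervalIntegral.integral_of_le (by linarith [hs.2])]
  · have h2 : (fun a => S.indicator g (a, s)) = fun _ => 0 :=
      funext fun a => indicator_of_notMem (fun h : (a, s) ∈ S => hs h.1) _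
    simp only [h2, indicator_of_notMem hs, integral_zero]

theorem insertNth_mem_stdCell {n : ℕ} (i : Fin (n + 1)) {s : Fin n → ℝ} (hs : s ∈ stdCell n)
    {a : ℝ} (ha : a ∈ Icc 0 (1 - ∑ j, s j)) : i.insertNth a s ∈ stdCell (n + 1) := by
  refine ⟨(Fin.forall_iff_succAbove i).2 ⟨by simpa using ha.1, fun j => by simpa using hs.1 j⟩, ?_⟩
  rw [Fin.sum_univ_succAbove _ i]
  simp only [Fin.insertNth_apply_same, Fin.insertNth_apply_succAbove]
  linarith [ha.2]

theorem continuousOn_fderiv_apply {E V : Type*} [NormedAddCommGroup E] [NormedSpace ℝ E]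
    [NormedAddCommGroup V] [NormedSpace ℝ V] {f : E → V} {K : Set E}
    (hf : ∀ p ∈ K, ContDiffAt ℝ 1 f p) (e : E) : ContinuousOn (fun p => fderiv ℝ f p e) K :=
  fun p hp => (((hf p hp).fderiv_right (m := 0) (by simp)).continuousAt.clm_apply
    continuousAt_const).continuousWithinAt

/-- The fundamental theorem of calculus in the direction `i`, on a simplex. -/
theorem integral_stdCell_fderiv_single {n : ℕ} {f : (Fin (n + 1) → ℝ) → ℝ}
    (hf : ∀ p ∈ stdCell (n + 1), ContDiffAt ℝ 1 f p) (i : Fin (n + 1)) :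
    ∫ p in stdCell (n + 1), fderiv ℝ f p (Pi.single i 1)
      = (∫ s in stdCell n, f (i.insertNth (1 - ∑ j, s j) s))
        - ∫ s in stdCell n, f (i.insertNth 0 s) := by
  have hc := continuousOn_fderiv_apply hf (Pi.single i 1)
  have hfc : ContinuousOn f (stdCell (n + 1)) :=
    fun p hp => (hf p hp).continuousAt.continuousWithinAt
  rw [integral_stdCell_succ hc i, ← integral_sub]
  -- The upper end of each fibre lies on the face opposite to the origin, the lower end on the
  -- coordinate face where the `i`-th coordinate vanishes.
  · refine setIntegral_congr_fun measurableSet_stdCell fun s hs => ?_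
    have hle : (0 : ℝ) ≤ 1 - ∑ j, s j := by linarith [hs.2]
    refine intervalIntegral.integral_eq_sub_of_hasDerivAt (f := fun a => f (i.insertNth a s))
      (fun a ha => ?_) ?_
    · rw [uIcc_of_le hle] at ha
      have h1 : HasDerivAt (fun a : ℝ => (i.insertNth a s : Fin (n + 1) → ℝ))
          (Pi.single i 1) a := by
        rw [hasDerivAt_pi, Fin.forall_iff_succAbove i]
        refine ⟨by simpa using! hasDerivAt_id a, fun j => ?_⟩
        simpa using hasDerivAt_const a (s j)
      exact ((hf _ (insertNth_mem_stdCell i hs ha)).differentiableAt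
        one_ne_zero).hasFDerivAt.comp_hasDerivAt a h1
    · refine ContinuousOn.intervalIntegrable ?_
      rw [uIcc_of_le hle]
      refine hc.comp (Continuous.continuousOn ?_) fun a ha => insertNth_mem_stdCell i hs ha
      exact Continuous.finInsertNth (A := fun _ => ℝ) i continuous_id continuous_const
  · refine (hfc.comp (Continuous.continuousOn ?_) fun s hs => insertNth_mem_stdCell i hs
      ⟨by linarith [hs.2], le_rfl⟩).integrableOn_compact isCompact_stdCell
    exact Continuous.finInsertNth i (by fun_prop) continuous_id
  · refine (hfc.comp (Continuous.continuousOn ?_) fun s hs => insertNth_mem_stdCell i hs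
      ⟨le_rfl, by linarith [hs.2]⟩).integrableOn_compact isCompact_stdCell
    exact Continuous.finInsertNth i continuous_const continuous_id

/-! ### Permutations of the vertices of a triangle -/

theorem affineSimplex_perm_inv {k : ℕ} (π : Equiv.Perm (Fin (k + 1))) :
    affineSimplex (stdVertex k ∘ π) ∘ affineSimplex (stdVertex k ∘ π.symm) = id := by
  rw [affineSimplex_comp, ← affineSimplex_stdVertex_eq_id]
  congr 1
  funext j
  simp [affineSimplex_stdVertex]

theorem affineSimplex_perm_image {k : ℕ} (π : Equiv.Perm (Fin (k + 1))) :
    affineSimplex (stdVertex k ∘ π) '' stdCell k = stdCell k := by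
  refine Subset.antisymm ?_ fun s hs => ?_
  · rintro _ ⟨s, hs, rfl⟩
    exact affineSimplex_mem convex_stdCell (fun _ => stdVertex_mem _) hs
  · exact ⟨_, affineSimplex_mem convex_stdCell (fun _ => stdVertex_mem _) hs,
      congrFun (affineSimplex_perm_inv π) s⟩

theorem affineSimplex_perm_injective {k : ℕ} (π : Equiv.Perm (Fin (k + 1))) :
    Function.Injective (affineSimplex (stdVertex k ∘ π)) := by
  have h := affineSimplex_perm_inv π.symm
  rw [Equiv.symm_symm] at h
  exact Function.LeftInverse.injective (congrFun h)

/-- The vertices of a permuted triangle span a parallelogram of signed area `sign π`. -/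
theorem stdVertex_perm_area (π : Equiv.Perm (Fin 3)) :
    (stdVertex 2 (π 1) 0 - stdVertex 2 (π 0) 0) * (stdVertex 2 (π 2) 1 - stdVertex 2 (π 0) 1)
      - (stdVertex 2 (π 1) 1 - stdVertex 2 (π 0) 1) * (stdVertex 2 (π 2) 0 - stdVertex 2 (π 0) 0)
      = ((Equiv.Perm.sign π : ℤ) : ℝ) := by
  -- The vertex coordinates are 0 or 1, so the identity lives over the integers and is checked on
  -- the six permutations.
  have h : ∀ π : Equiv.Perm (Fin 3), ∀ a b : Fin 3 → ℤ, a = ![0, 1, 0] → b = ![0, 0, 1] →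
      (a (π 1) - a (π 0)) * (b (π 2) - b (π 0)) - (b (π 1) - b (π 0)) * (a (π 2) - a (π 0))
        = (Equiv.Perm.sign π : ℤ) := by
    rintro π _ _ rfl rfl
    revert π
    decide
  have ha : ∀ j, stdVertex 2 j 0 = ((![0, 1, 0] : Fin 3 → ℤ) j : ℝ) := by
    intro j
    refine Fin.cases ?_ (fun i => ?_) j
    · simp
    · fin_cases i <;> simp only [stdVertex_succ] <;> simp
  have hb : ∀ j, stdVertex 2 j 1 = ((![0, 0, 1] : Fin 3 → ℤ) j : ℝ) := by
    intro j
    refine Fin.cases ?_ (fun i => ?_) j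
    · simp
    · fin_cases i <;> simp only [stdVertex_succ] <;> simp
  simp only [ha, hb]
  exact_mod_cast h π _ _ rfl rfl

theorem det_affineSimplexLin_perm (π : Equiv.Perm (Fin 3)) :
    (affineSimplexLin (stdVertex 2 ∘ π)).det = ((Equiv.Perm.sign π : ℤ) : ℝ) := by
  rw [ContinuousLinearMap.det, ← LinearMap.det_toMatrix', Matrix.det_fin_two,
    ← stdVertex_perm_area]
  simp only [LinearMap.toMatrix'_apply, ContinuousLinearMap.coe_coe, affineSimplexLin_single]
  simp only [Function.comp_apply, Pi.sub_apply, Fin.succ_zero_eq_one, Fin.succ_one_eq_two]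
  ring

/-- The substitution maps the triangle bijectively onto itself with determinant 1 or -1. The change
of variables uses only its absolute value, so orientation signs must come from the forms. -/
theorem integral_stdCell_perm {V : Type*} [NormedAddCommGroup V] [NormedSpace ℝ V]
    (π : Equiv.Perm (Fin 3)) (f : (Fin 2 → ℝ) → V) :
    ∫ s in stdCell 2, f (affineSimplex (stdVertex 2 ∘ π) s) = ∫ s in stdCell 2, f s := by
  have h := integral_image_eq_integral_abs_det_fderiv_smul volume measurableSet_stdCell
    (fun s _ => (hasFDerivAt_affineSimplex (stdVertex 2 ∘ π) s).hasFDerivWithinAt)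
    (affineSimplex_perm_injective π).injOn f
  rw [affineSimplex_perm_image] at h
  rw [h]
  refine setIntegral_congr_fun measurableSet_stdCell fun s _ => ?_
  rw [det_affineSimplexLin_perm]
  rcases Int.units_eq_one_or (Equiv.Perm.sign π) with h | h <;> simp [h]

/-- An alternating form on the edges of a permuted triangle. -/
theorem alternating_perm (φ : (Fin 2 → ℝ) [⋀^Fin 2]→L[ℝ] ℝ) (π : Equiv.Perm (Fin 3)) :
    φ (fun i => affineSimplexLin (stdVertex 2 ∘ π) (Pi.single i 1))
      = ((Equiv.Perm.sign π : ℤ) : ℝ) * φ (fun i => Pi.single i 1) := by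
  -- A form of top degree is a multiple of the determinant, so a linear substitution multiplies it
  -- by its own determinant.
  have h := φ.toAlternatingMap.eq_smul_basis_det (Pi.basisFun ℝ (Fin 2))
  have h2 : ∀ u, φ u = φ (fun i => Pi.single i 1) * (Pi.basisFun ℝ (Fin 2)).det u := by
    intro u
    have h3 := congrArg (fun ψ : (Fin 2 → ℝ) [⋀^Fin 2]→ₗ[ℝ] ℝ => ψ u) h
    have h4 : ⇑(Pi.basisFun ℝ (Fin 2)) = fun i => Pi.single i 1 := by ext; simp
    rw [h4] at h3
    exact h3
  have h5 := (Pi.basisFun ℝ (Fin 2)).det_comp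
    (affineSimplexLin (stdVertex 2 ∘ π) : (Fin 2 → ℝ) →ₗ[ℝ] (Fin 2 → ℝ)) (fun i => Pi.single i 1)
  rw [← ContinuousLinearMap.det, det_affineSimplexLin_perm] at h5
  have h6 := h2 (fun i => affineSimplexLin (stdVertex 2 ∘ π) (Pi.single i 1))
  refine h6.trans ((congrArg (fun z => φ (fun i => Pi.single i 1) * z) h5).trans ?_)
  conv_rhs => rw [h2]
  ring

/-! ### The theorem of Stokes on the standard tetrahedron -/

/-- The vertices of this face are the origin and the two remaining unit vectors in increasing order,
so no permutation intervenes, unlike for the face opposite to the origin. -/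
theorem face_succ (i : Fin 3) (s : Fin 2 → ℝ) : face i.succ s = i.insertNth 0 s := by
  rw [face, affineSimplex, eq_comm, Fin.insertNth_eq_iff]
  constructor
  · simp [Fin.succ_succAbove_succ]
  · funext j
    simp only [Function.comp_apply, Fin.succ_succAbove_succ, Fin.succ_succAbove_zero,
      stdVertex_zero, stdVertex_succ, Fin.removeNth]
    fin_cases j <;> simp

/-- The map `s ↦ insertNth i (1 - ∑ s) s` parametrizes the face opposite to the origin. -/
theorem insertNth_one_sub (i : Fin 3) (s : Fin 2 → ℝ) :
    (i.insertNth (1 - ∑ j, s j) s : Fin 3 → ℝ)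
      = face 0 (affineSimplex (stdVertex 2 ∘ i.cycleRange.symm) s) := by
  have h := congrFun (affineSimplex_comp (stdVertex 3 ∘ (0 : Fin 4).succAbove)
    (stdVertex 2 ∘ i.cycleRange.symm)) s
  -- The origin of the triangle goes to the `i`-th unit vector and the other two vertices keep their
  -- order; `i.cycleRange.symm` is this rearrangement.
  have h2 : affineSimplex (stdVertex 3 ∘ (0 : Fin 4).succAbove) ∘ stdVertex 2 ∘ i.cycleRange.symm
      = fun j => Pi.single (i.cycleRange.symm j) 1 := by
    funext j
    simp [affineSimplex_stdVertex]
  rw [h2] at h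
  refine Eq.trans ?_ h.symm
  rw [affineSimplex_eq_sum, Fin.insertNth_eq_iff, Fin.sum_univ_succ (n := 2)]
  simp only [Fin.cons_zero, Fin.cons_succ, Fin.cycleRange_symm_zero, Fin.cycleRange_symm_succ]
  constructor
  · simp
  · funext j
    fin_cases j <;> simp [Fin.removeNth]

theorem contDiffAt_alternating_apply {E F V : Type*} [NormedAddCommGroup E] [NormedSpace ℝ E]
    [NormedAddCommGroup F] [NormedSpace ℝ F] [NormedAddCommGroup V] [NormedSpace ℝ V]
    {k : ℕ} {n : WithTop ℕ∞} {η : F → E [⋀^Fin k]→L[ℝ] V} {p : F} (hη : ContDiffAt ℝ n η p)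
    (v : Fin k → E) : ContDiffAt ℝ n (fun p => η p v) p :=
  hη.continuousLinearMap_comp (ContinuousAlternatingMap.apply ℝ E V v)

theorem alternating_swap {E V : Type*} [NormedAddCommGroup E] [NormedSpace ℝ E]
    [NormedAddCommGroup V] [NormedSpace ℝ V] (φ : E [⋀^Fin 2]→L[ℝ] V) (a b : E) :
    φ ![a, b] = -φ ![b, a] := by
  have h := φ.toAlternatingMap.map_swap ![b, a] (show (0 : Fin 2) ≠ 1 by decide)
  have h2 : ![b, a] ∘ Equiv.swap (0 : Fin 2) 1 = ![a, b] := by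
    funext j
    fin_cases j <;> simp
  rwa [h2] at h

/-- For unit vectors this splits the form on the edges of the slanted face into its three coordinate
components, with the signs that Stokes needs. -/
theorem alternating_sub_sub {E V : Type*} [NormedAddCommGroup E] [NormedSpace ℝ E]
    [NormedAddCommGroup V] [NormedSpace ℝ V] (φ : E [⋀^Fin 2]→L[ℝ] V) (a b c : E) :
    φ ![b - a, c - a] = φ ![b, c] - φ ![a, c] + φ ![a, b] := by
  have h : φ ![a, a] = 0 := φ.map_eq_zero_of_eq (i := 0) (j := 1) _ rfl (by decide)
  rw [φ.map_vecCons_sub, alternating_swap φ b, alternating_swap φ a (c - a), φ.map_vecCons_sub,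
    φ.map_vecCons_sub, h, alternating_swap φ b c, alternating_swap φ a c, alternating_swap φ a b]
  abel

/-- The theorem of Stokes for a 2-form on the standard tetrahedron. -/
theorem stokes_stdCell {η : (Fin 3 → ℝ) → (Fin 3 → ℝ) [⋀^Fin 2]→L[ℝ] ℝ}
    (hη : ∀ p ∈ stdCell 3, ContDiffAt ℝ 1 η p) :
    ∫ p in stdCell 3, extDeriv η p (fun i => Pi.single i 1)
      = ∑ i : Fin 4, (-1 : ℝ) ^ (i : ℕ) * ∫ s in stdCell 2, η (face i s)
          (fun j => affineSimplexLin (stdVertex 3 ∘ i.succAbove) (Pi.single j 1)) := by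
  let e : Fin 3 → Fin 3 → ℝ := fun i => Pi.single i 1
  let f : Fin 3 → (Fin 3 → ℝ) → ℝ := fun i p => η p (i.removeNth e)
  have hf : ∀ i, ∀ p ∈ stdCell 3, ContDiffAt ℝ 1 (f i) p :=
    fun i p hp => contDiffAt_alternating_apply (hη p hp) _
  have h1 : ∀ p ∈ stdCell 3, extDeriv η p e
      = ∑ i : Fin 3, (-1 : ℝ) ^ (i : ℕ) * fderiv ℝ (f i) p (Pi.single i 1) := by
    intro p hp
    rw [extDeriv_apply ((hη p hp).differentiableAt one_ne_zero)]
    simp [f, e]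
  have hface : ContinuousOn (face 0) (stdCell 2) :=
    (contDiff_affineSimplex (n := 0) _).continuous.continuousOn
  have hint : ∀ i, IntegrableOn (fun s => f i (face 0 s)) (stdCell 2) := fun i =>
    (ContinuousOn.comp (t := stdCell 3)
      (fun p hp => (hf i p hp).continuousAt.continuousWithinAt) hface
      fun s hs => face_mem 0 hs).integrableOn_compact isCompact_stdCell
  -- The face opposite to the origin sees all three components of the form; each of the other faces
  -- sees one.
  have h0 : ∫ s in stdCell 2, η (face 0 s)
      (fun j => affineSimplexLin (stdVertex 3 ∘ (0 : Fin 4).succAbove) (Pi.single j 1))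
        = ∑ i : Fin 3, (-1 : ℝ) ^ (i : ℕ) * ∫ s in stdCell 2, f i (face 0 s) := by
    simp only [← integral_const_mul]
    rw [← integral_finsetSum _ fun i _ => (hint i).const_mul _]
    refine setIntegral_congr_fun measurableSet_stdCell fun s _ => ?_
    have hv : (fun j => affineSimplexLin (stdVertex 3 ∘ (0 : Fin 4).succAbove) (Pi.single j 1))
        = ![e 1 - e 0, e 2 - e 0] := by
      funext j
      rw [affineSimplexLin_single]
      fin_cases j <;> rfl
    have hr : ∀ i : Fin 3, i.removeNth e = ![e (i.succAbove 0), e (i.succAbove 1)] := by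
      intro i
      funext j
      fin_cases j <;> rfl
    simp only [hv, f, hr, Fin.sum_univ_three, alternating_sub_sub]
    simp [Fin.succAbove, sub_eq_add_neg]
  rw [setIntegral_congr_fun measurableSet_stdCell h1, integral_finsetSum]
  · rw [Fin.sum_univ_succ (n := 3), h0]
    simp only [Fin.val_zero, pow_zero, one_mul]
    rw [← Finset.sum_add_distrib]
    refine Finset.sum_congr rfl fun i _ => ?_
    -- For each `i`, the upper end contributes the `i`-th component on the slanted face. The lower
    -- end contributes the face `i.succ`, and its minus sign is the shift of the exponent by one.
    rw [integral_const_mul, integral_stdCell_fderiv_single (hf i)]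
    simp only [insertNth_one_sub, integral_stdCell_perm i.cycleRange.symm fun s => f i (face 0 s)]
    have hv : (fun j => affineSimplexLin (stdVertex 3 ∘ i.succ.succAbove) (Pi.single j 1))
        = i.removeNth e := by
      funext j
      simp [affineSimplexLin_single, Fin.succ_succAbove_succ, e, Fin.removeNth]
    simp only [hv, face_succ, Fin.val_succ, pow_succ, f]
    ring
  · intro i _
    exact ((continuousOn_fderiv_apply (hf i) _).integrableOn_compact isCompact_stdCell).const_mul _

/-! ### Derivatives of bilinear expressions -/

section Bilinear

variable {E V W X : Type*} [NormedAddCommGroup E] [NormedSpace ℝ E]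
  [NormedAddCommGroup V] [NormedSpace ℝ V] [FiniteDimensional ℝ V]
  [NormedAddCommGroup W] [NormedSpace ℝ W] [FiniteDimensional ℝ W]
  [NormedAddCommGroup X] [NormedSpace ℝ X]

/-- In finite dimension a bilinear map is continuous. One set of product rules thus serves matrix
products, the action on vectors, both pairings and the mixed bracket. -/
theorem contDiffAt_bilin {B : V → W → X} (hB : IsBilinearMap ℝ B) {f : E → V} {g : E → W} {p : E}
    {n : WithTop ℕ∞} (hf : ContDiffAt ℝ n f p) (hg : ContDiffAt ℝ n g p) :
    ContDiffAt ℝ n (fun q => B (f q) (g q)) p :=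
  (hB.toContinuousBilinearMap.contDiff.contDiffAt.comp p hf).clm_apply hg

theorem hasDerivAt_bilin {B : V → W → X} (hB : IsBilinearMap ℝ B) {f : ℝ → V} {g : ℝ → W} {t : ℝ}
    {f' : V} {g' : W} (hf : HasDerivAt f f' t) (hg : HasDerivAt g g' t) :
    HasDerivAt (fun s => B (f s) (g s)) (B f' (g t) + B (f t) g') t :=
  (hB.toContinuousBilinearMap.hasFDerivAt.comp_hasDerivAt t hf).clm_apply hg

theorem fderiv_bilin {B : V → W → X} (hB : IsBilinearMap ℝ B) {f : E → V} {g : E → W} {p : E}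
    (hf : DifferentiableAt ℝ f p) (hg : DifferentiableAt ℝ g p) (e : E) :
    fderiv ℝ (fun q => B (f q) (g q)) p e = B (fderiv ℝ f p e) (g p) + B (f p) (fderiv ℝ g p e) := by
  have h := hB.toContinuousBilinearMap.fderiv_of_bilinear hf hg
  have h2 := congrArg (fun L : E →L[ℝ] X => L e) h
  refine h2.trans ?_
  rw [add_comm]
  rfl

theorem fderiv_eq_of_hasDerivAt_line {f : E → X} {p e : E} {f' : X} (hf : DifferentiableAt ℝ f p)
    (h : HasDerivAt (fun s : ℝ => f (p + s • e)) f' 0) : fderiv ℝ f p e = f' := by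
  rw [← hf.lineDeriv_eq_fderiv]
  exact h.deriv

end Bilinear

/-! ### Bilinearity of the products and pairings, and transposition -/

theorem isBilinearMap_mul {n : Type*} [Fintype n] :
    IsBilinearMap ℝ (fun A B : Matrix n n ℝ => A * B) where
  add_left := Matrix.add_mul
  smul_left := fun c A B => Matrix.smul_mul c A B
  add_right := Matrix.mul_add
  smul_right := fun c A B => Matrix.mul_smul A c B

theorem isBilinearMap_mulVec : IsBilinearMap ℝ (fun (A : Mat4) (v : R4) => A *ᵥ v) where
  add_left := Matrix.add_mulVec
  smul_left := fun c A v => Matrix.smul_mulVec c A v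
  add_right := Matrix.mulVec_add
  smul_right := fun c A v => Matrix.mulVec_smul A c v

theorem isBilinearMap_dotProduct : IsBilinearMap ℝ (fun v w : R4 => v ⬝ᵥ w) where
  add_left := add_dotProduct
  smul_left := smul_dotProduct
  add_right := dotProduct_add
  smul_right := fun c v w => dotProduct_smul c v w

theorem isBilinearMap_pairSo : IsBilinearMap ℝ pairSo where
  add_left := fun a b c => by simp [pairSo, Matrix.add_mul, mul_add]
  smul_left := fun r a b => by simp [pairSo]; ring
  add_right := fun a b c => by simp [pairSo, mul_add]
  smul_right := fun r a b => by simp [pairSo]; ring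

theorem isBilinearMap_mixedBracket : IsBilinearMap ℝ mixedBracket where
  add_left := fun a b c => by
    ext i j; simp [mixedBracket, vecMulVec_apply]; ring
  smul_left := fun r a b => by
    ext i j; simp [mixedBracket, vecMulVec_apply]; ring
  add_right := fun a b c => by
    ext i j; simp [mixedBracket, vecMulVec_apply]; ring
  smul_right := fun r a b => by
    ext i j; simp [mixedBracket, vecMulVec_apply]; ring

/-- Transposition as a continuous linear map. -/
def transposeL : Mat4 →L[ℝ] Mat4 :=
  LinearMap.toContinuousLinearMap (Matrix.transposeLinearEquiv (Fin 4) (Fin 4) ℝ ℝ).toLinearMap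

theorem transposeL_apply (A : Mat4) : transposeL A = Aᵀ := rfl

theorem hasDerivAt_transpose {f : ℝ → Mat4} {f' : Mat4} {t : ℝ} (hf : HasDerivAt f f' t) :
    HasDerivAt (fun s => (f s)ᵀ) f'ᵀ t :=
  transposeL.hasFDerivAt.comp_hasDerivAt t hf

theorem contDiffAt_transpose {E : Type*} [NormedAddCommGroup E] [NormedSpace ℝ E] {f : E → Mat4}
    {p : E} {n : WithTop ℕ∞} (hf : ContDiffAt ℝ n f p) : ContDiffAt ℝ n (fun q => (f q)ᵀ) p :=
  hf.continuousLinearMap_comp transposeL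

/-! ### The phase space of a link -/

theorem pairSo_add_left (a b c : Mat4) : pairSo (a + b) c = pairSo a c + pairSo b c :=
  isBilinearMap_pairSo.add_left a b c

theorem pairSo_add_right (a b c : Mat4) : pairSo a (b + c) = pairSo a b + pairSo a c :=
  isBilinearMap_pairSo.add_right a b c

theorem pairSo_smul_left (r : ℝ) (a b : Mat4) : pairSo (r • a) b = r * pairSo a b :=
  isBilinearMap_pairSo.smul_left r a b

theorem pairSo_smul_right (r : ℝ) (a b : Mat4) : pairSo a (r • b) = r * pairSo a b :=
  isBilinearMap_pairSo.smul_right r a b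

theorem pairSo_neg_right (a b : Mat4) : pairSo a (-b) = -pairSo a b := by
  simpa using pairSo_smul_right (-1) a b

theorem pairSo_sub_right (a b c : Mat4) : pairSo a (b - c) = pairSo a b - pairSo a c := by
  rw [sub_eq_add_neg, pairSo_add_right, pairSo_neg_right, sub_eq_add_neg]

theorem pairSo_zero_left (a : Mat4) : pairSo 0 a = 0 := by simp [pairSo]

theorem pairSo_zero_right (a : Mat4) : pairSo a 0 = 0 := by simp [pairSo]

/-- The pairing of a skew matrix with itself is positive definite. -/
theorem eq_zero_of_pairSo_self {a : Mat4} (h : pairSo a a = 0) : a = 0 := by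
  have h1 : (aᴴ * a).trace = 0 := by
    have h2 : (aᵀ * a).trace = 0 := by
      simpa [pairSo] using h
    rwa [← conjTranspose_eq_transpose_of_trivial] at h2
  exact Matrix.trace_conjTranspose_mul_self_eq_zero_iff.1 h1

theorem hasDerivAt_line {V : Type*} [NormedAddCommGroup V] [NormedSpace ℝ V] (a b : V) :
    HasDerivAt (fun s : ℝ => a + s • b) b 0 := by
  simpa using ((hasDerivAt_id (0 : ℝ)).smul_const b).const_add a

theorem differentiableAt_bfcgLinkPotential (p v : LinkVars) :
    DifferentiableAt ℝ (fun q => bfcgLinkPotential q v) p := by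
  have h1 : ContDiffAt ℝ 1 (fun q : LinkVars => v.1 * q.1ᵀ) p :=
    contDiffAt_bilin isBilinearMap_mul contDiffAt_const (contDiffAt_transpose contDiffAt_fst)
  have h2 : ContDiffAt ℝ 1 (fun q : LinkVars => q.2.1) p := contDiffAt_snd.fst
  have h3 : ContDiffAt ℝ 1 (fun q : LinkVars => q.2.2.1) p := contDiffAt_snd.snd.fst
  have h4 : ContDiffAt ℝ 1 (fun q : LinkVars => q.2.2.2) p := contDiffAt_snd.snd.snd
  exact (((contDiffAt_bilin isBilinearMap_pairSo h3 h1).add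
    (contDiffAt_bilin isBilinearMap_dotProduct (contDiffAt_bilin isBilinearMap_mulVec h1 h2) h4)).add
    (contDiffAt_bilin isBilinearMap_dotProduct h2 contDiffAt_const)).differentiableAt one_ne_zero

theorem differentiableAt_bfLinkPotential (p v : LinkVars) :
    DifferentiableAt ℝ (fun q => bfLinkPotential q v) p := by
  have h1 : ContDiffAt ℝ 1 (fun q : LinkVars => v.1 * q.1ᵀ) p :=
    contDiffAt_bilin isBilinearMap_mul contDiffAt_const (contDiffAt_transpose contDiffAt_fst)
  have h2 : ContDiffAt ℝ 1 (fun q : LinkVars => q.2.1) p := contDiffAt_snd.fst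
  have h3 : ContDiffAt ℝ 1 (fun q : LinkVars => q.2.2.1) p := contDiffAt_snd.snd.fst
  have h4 : ContDiffAt ℝ 1 (fun q : LinkVars => q.2.2.2) p := contDiffAt_snd.snd.snd
  exact (((contDiffAt_bilin isBilinearMap_pairSo h3 h1).add
    (contDiffAt_bilin isBilinearMap_dotProduct h4 contDiffAt_const)).add
    (contDiffAt_bilin isBilinearMap_dotProduct h4
      (contDiffAt_bilin isBilinearMap_mulVec h1 h2).neg)).differentiableAt one_ne_zero

/-- The derivative of `bfcgLinkPotential q v` with respect to `q` in the direction `u`. -/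
theorem fderiv_bfcgLinkPotential (p u v : LinkVars) :
    fderiv ℝ (fun q => bfcgLinkPotential q v) p u
      = pairSo u.2.2.1 (v.1 * p.1ᵀ) + pairSo p.2.2.1 (v.1 * u.1ᵀ)
        + (((v.1 * u.1ᵀ) *ᵥ p.2.1 + (v.1 * p.1ᵀ) *ᵥ u.2.1) ⬝ᵥ p.2.2.2
          + ((v.1 * p.1ᵀ) *ᵥ p.2.1) ⬝ᵥ u.2.2.2) + u.2.1 ⬝ᵥ v.2.2.2 := by
  refine fderiv_eq_of_hasDerivAt_line (differentiableAt_bfcgLinkPotential p v) ?_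
  have h1 := hasDerivAt_bilin isBilinearMap_mul (hasDerivAt_const (0 : ℝ) v.1)
    (hasDerivAt_transpose (hasDerivAt_line p.1 u.1))
  have h2 := hasDerivAt_line p.2.1 u.2.1
  have h3 := hasDerivAt_line p.2.2.1 u.2.2.1
  have h4 := hasDerivAt_line p.2.2.2 u.2.2.2
  have h := ((hasDerivAt_bilin isBilinearMap_pairSo h3 h1).add
    (hasDerivAt_bilin isBilinearMap_dotProduct (hasDerivAt_bilin isBilinearMap_mulVec h1 h2) h4)).add
    (hasDerivAt_bilin isBilinearMap_dotProduct h2 (hasDerivAt_const (0 : ℝ) v.2.2.2))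
  simp only [zero_smul, add_zero, Matrix.zero_mul, zero_add, dotProduct_zero] at h
  exact h

/-- The derivative of `bfLinkPotential q v` with respect to `q` in the direction `u`. -/
theorem fderiv_bfLinkPotential (p u v : LinkVars) :
    fderiv ℝ (fun q => bfLinkPotential q v) p u
      = pairSo u.2.2.1 (v.1 * p.1ᵀ) + pairSo p.2.2.1 (v.1 * u.1ᵀ) + u.2.2.2 ⬝ᵥ v.2.1
        + (u.2.2.2 ⬝ᵥ (-((v.1 * p.1ᵀ) *ᵥ p.2.1))
          + p.2.2.2 ⬝ᵥ (-((v.1 * u.1ᵀ) *ᵥ p.2.1 + (v.1 * p.1ᵀ) *ᵥ u.2.1))) := by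
  refine fderiv_eq_of_hasDerivAt_line (differentiableAt_bfLinkPotential p v) ?_
  have h1 := hasDerivAt_bilin isBilinearMap_mul (hasDerivAt_const (0 : ℝ) v.1)
    (hasDerivAt_transpose (hasDerivAt_line p.1 u.1))
  have h2 := hasDerivAt_line p.2.1 u.2.1
  have h3 := hasDerivAt_line p.2.2.1 u.2.2.1
  have h4 := hasDerivAt_line p.2.2.2 u.2.2.2
  have h := ((hasDerivAt_bilin isBilinearMap_pairSo h3 h1).add
    (hasDerivAt_bilin isBilinearMap_dotProduct h4 (hasDerivAt_const (0 : ℝ) v.2.1))).add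
    (hasDerivAt_bilin isBilinearMap_dotProduct h4 (hasDerivAt_bilin isBilinearMap_mulVec h1 h2).neg)
  simp only [Pi.neg_apply, zero_smul, add_zero, Matrix.zero_mul, zero_add, dotProduct_zero] at h
  exact h

/-- The potentials differ by the differential of ⟨x, V⟩, which the exterior derivative kills. Here
both sides are expanded by the derivative formulas, so the identity holds on the whole ambient
space. -/
theorem extDOne_bfcg_eq_flip (p u v : LinkVars) :
    extDOne bfcgLinkPotential p u v
      = extDOne bfLinkPotential (flipV p) (flipV u) (flipV v) := by
  simp only [extDOne, fderiv_bfcgLinkPotential, fderiv_bfLinkPotential, flipV, dotProduct_neg,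
    neg_dotProduct, add_dotProduct, dotProduct_add, neg_add, neg_neg]
  simp only [dotProduct_comm _ p.2.2.2, dotProduct_comm _ u.2.2.2, dotProduct_comm _ v.2.2.2]
  ring

/-- The two-form is non-degenerate on the tangent vectors. -/
theorem extDOne_bfcg_nondegenerate {p : LinkVars} (hp : p ∈ linkPhaseSpace) {u : LinkVars}
    (hu : u ∈ tangentVectors p)
    (h : ∀ v ∈ tangentVectors p, extDOne bfcgLinkPotential p u v = 0) : u = 0 := by
  have hO : p.1ᵀ * p.1 = 1 := by
    have := (Matrix.mem_specialOrthogonalGroup_iff.1 hp.1).1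
    simpa [star_eq_conjTranspose] using (Matrix.mem_orthogonalGroup_iff' (Fin 4) ℝ).1 this
  have hO' : p.1 * p.1ᵀ = 1 := mul_eq_one_comm.1 hO
  obtain ⟨u1, u2, u3, u4⟩ := u
  obtain ⟨hu1, hu3⟩ := hu
  simp only at hu1 hu3
  -- Conjugate directions isolate the components of `u`, each tested against itself: a variation of
  -- b detects δh, of V detects δx, of x detects δV and of h detects δb. The order matters, since
  -- the later tests use that the earlier components vanish.
  have e1 : u1 * p.1ᵀ = 0 := by
    have := h (0, 0, u1 * p.1ᵀ, 0) ⟨by simp, hu1⟩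
    simp only [extDOne, fderiv_bfcgLinkPotential] at this
    refine eq_zero_of_pairSo_self ?_
    simpa [pairSo_zero_left, pairSo_zero_right] using this
  have e1' : u1 = 0 := by
    have : u1 * p.1ᵀ * p.1 = 0 := by rw [e1, Matrix.zero_mul]
    rwa [Matrix.mul_assoc, hO, Matrix.mul_one] at this
  subst e1'
  have e2 : u2 = 0 := by
    have := h (0, 0, 0, u2) ⟨by simp, by simp⟩
    simp only [extDOne, fderiv_bfcgLinkPotential] at this
    refine dotProduct_self_eq_zero.1 ?_
    simpa [pairSo_zero_left, pairSo_zero_right] using this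
  subst e2
  have e4 : u4 = 0 := by
    have := h (0, u4, 0, 0) ⟨by simp, by simp⟩
    simp only [extDOne, fderiv_bfcgLinkPotential] at this
    refine dotProduct_self_eq_zero.1 ?_
    simpa [pairSo_zero_left, pairSo_zero_right] using this
  subst e4
  have e3 : u3 = 0 := by
    -- The variation `u3 * p.1` of h has logarithmic derivative `u3`, which is skew, so it is
    -- tangent to the rotations.
    have hv : u3 * p.1 * p.1ᵀ = u3 := by rw [Matrix.mul_assoc, hO', Matrix.mul_one]
    have := h (u3 * p.1, 0, 0, 0) ⟨by simp only [hv]; exact hu3, by simp⟩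
    simp only [extDOne, fderiv_bfcgLinkPotential, hv] at this
    refine eq_zero_of_pairSo_self ?_
    simpa [pairSo_zero_left, pairSo_zero_right] using this
  rw [e3]
  rfl

/-- Flipping V turns ⟨V, δx⟩ into its negative, which the product rule for ⟨x, V⟩ cancels, leaving
⟨x, δV⟩. The other V-term becomes ⟨V, Δh x⟩ because [x, Δh] = -Δh x. -/
theorem bfcgLinkPotential_eq (p v : LinkVars) :
    bfcgLinkPotential p v = bfLinkPotential (flipV p) (flipV v)
      + fderiv ℝ (fun q : LinkVars => q.2.1 ⬝ᵥ q.2.2.2) p v := by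
  have hd : fderiv ℝ (fun q : LinkVars => q.2.1 ⬝ᵥ q.2.2.2) p v
      = v.2.1 ⬝ᵥ p.2.2.2 + p.2.1 ⬝ᵥ v.2.2.2 := by
    refine fderiv_eq_of_hasDerivAt_line ?_ ?_
    · exact (contDiffAt_bilin (n := 1) isBilinearMap_dotProduct contDiffAt_snd.fst
        contDiffAt_snd.snd.snd).differentiableAt one_ne_zero
    · have h := hasDerivAt_bilin isBilinearMap_dotProduct (hasDerivAt_line p.2.1 v.2.1)
        (hasDerivAt_line p.2.2.2 v.2.2.2)
      simp only [zero_smul, add_zero] at h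
      exact h
  rw [hd]
  simp only [bfcgLinkPotential, bfLinkPotential, flipV, dotProduct_neg, neg_dotProduct, neg_neg,
    dotProduct_comm p.2.2.2]
  ring

theorem toCotangent_eq (p : LinkVars) :
    toCotangent p = (fromBlocks p.1 (replicateCol Unit p.2.1) 0 1, p.2.2) := by
  simp [toCotangent, fromBlocks_multiply]

/-- The affine matrix e^x h has linear part h and translation part x. Its right logarithmic
derivative has rotation part Δh and translation part δx - Δh x = δx + [x, Δh]. -/
theorem bfLinkPotential_eq_canonicalForm {p : LinkVars} (hp : p ∈ linkPhaseSpace) (v : LinkVars) :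
    bfLinkPotential p v = canonicalForm (toCotangent p) (fderiv ℝ toCotangent p v) := by
  have hO : p.1ᵀ * p.1 = 1 := by
    have := (Matrix.mem_specialOrthogonalGroup_iff.1 hp.1).1
    simpa [star_eq_conjTranspose] using (Matrix.mem_orthogonalGroup_iff' (Fin 4) ℝ).1 this
  have hO' : p.1 * p.1ᵀ = 1 := mul_eq_one_comm.1 hO
  let L : LinkVars →ₗ[ℝ] CotangentVars :=
    { toFun := fun q => (fromBlocks q.1 (replicateCol Unit q.2.1) 0 0, q.2.2)
      map_add' := fun a b => by
        refine Prod.ext ?_ rfl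
        ext (i | i) (j | j) <;> simp
      map_smul' := fun c a => by
        refine Prod.ext ?_ rfl
        ext (i | i) (j | j) <;> simp }
  -- The map is affine in the ambient coordinates, so its derivative is the linear part `L`
  -- everywhere.
  have hL : toCotangent = fun q => (fromBlocks 0 0 0 1, 0) + L.toContinuousLinearMap q := by
    funext q
    rw [toCotangent_eq]
    refine Prod.ext ?_ ?_
    · ext (i | i) (j | j) <;> simp [L]
    · simp [L]
  have hfd : fderiv ℝ toCotangent p v = L v := by
    rw [hL, fderiv_const_add, ContinuousLinearMap.fderiv]
    rfl
  have hinv : (fromBlocks p.1 (replicateCol Unit p.2.1) 0 1 :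
      Matrix (Fin 4 ⊕ Unit) (Fin 4 ⊕ Unit) ℝ)⁻¹
        = fromBlocks p.1ᵀ (-(p.1ᵀ * replicateCol Unit p.2.1)) 0 1 := by
    refine Matrix.inv_eq_left_inv ?_
    simp [fromBlocks_multiply, hO]
  have hprod : (L v).1 * (toCotangent p).1⁻¹ = fromBlocks (v.1 * p.1ᵀ)
      (replicateCol Unit (v.2.1 - (v.1 * p.1ᵀ) *ᵥ p.2.1)) 0 0 := by
    rw [toCotangent_eq, hinv]
    change fromBlocks v.1 (replicateCol Unit v.2.1) 0 0 * _ = _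
    rw [fromBlocks_multiply]
    congr 1
    · simp
    · rw [Matrix.mul_neg, ← Matrix.mul_assoc, ← replicateCol_mulVec]
      ext i j
      simp
      ring
    · simp
    · simp
  rw [hfd, canonicalForm, hprod, toCotangent_eq]
  simp only [toBlocks_fromBlocks₁₁, fromBlocks_apply₁₂, replicateCol_apply, bfLinkPotential]
  rw [add_assoc, ← dotProduct_add, ← sub_eq_add_neg]

/-! ### Rotations -/

theorem coe_inv_SO4 (g : SO4) : ((g⁻¹ : SO4) : Mat4) = (g : Mat4)ᵀ := by
  rfl

theorem transpose_mul_SO4 (g : SO4) : (g : Mat4)ᵀ * (g : Mat4) = 1 := by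
  rw [← coe_inv_SO4]
  exact congrArg Subtype.val (inv_mul_cancel g)

theorem mul_transpose_SO4 (g : SO4) : (g : Mat4) * (g : Mat4)ᵀ = 1 := by
  rw [← coe_inv_SO4]
  exact congrArg Subtype.val (mul_inv_cancel g)

theorem pairSo_conj {g : Mat4} (hg : g * gᵀ = 1) (a b : Mat4) :
    pairSo (gᵀ * a * g) (gᵀ * b * g) = pairSo a b := by
  have h : (gᵀ * a * g)ᵀ * (gᵀ * b * g) = gᵀ * (aᵀ * b) * g := by
    calc (gᵀ * a * g)ᵀ * (gᵀ * b * g) = gᵀ * aᵀ * (g * gᵀ) * b * g := by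
          simp only [transpose_mul, transpose_transpose, Matrix.mul_assoc]
      _ = gᵀ * (aᵀ * b) * g := by rw [hg, Matrix.mul_one]; simp only [Matrix.mul_assoc]
  rw [pairSo, h, trace_mul_comm, ← Matrix.mul_assoc, hg, Matrix.one_mul, pairSo]

theorem dotProduct_transpose_mulVec {g : Mat4} (hg : g * gᵀ = 1) (a b : R4) :
    (gᵀ *ᵥ a) ⬝ᵥ (gᵀ *ᵥ b) = a ⬝ᵥ b := by
  rw [dotProduct_mulVec, vecMul_transpose, mulVec_mulVec, hg, one_mulVec]

theorem mulVec_dotProduct_skew {a : Mat4} (ha : aᵀ = -a) (v w : R4) :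
    (a *ᵥ v) ⬝ᵥ w = -(v ⬝ᵥ (a *ᵥ w)) := by
  rw [dotProduct_mulVec v, ← mulVec_transpose, ha, neg_mulVec, neg_dotProduct, neg_neg]

/-- The derivative of a curve of rotations, multiplied by the inverse, is skew. -/
theorem skew_of_hasDerivAt {g : ℝ → SO4} {g' : Mat4} {t : ℝ}
    (hg : HasDerivAt (fun s => (g s : Mat4)) g' t) :
    (g' * (g t : Mat4)ᵀ)ᵀ = -(g' * (g t : Mat4)ᵀ) := by
  have h := hasDerivAt_bilin isBilinearMap_mul hg (hasDerivAt_transpose hg)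
  have h2 : (fun s => (g s : Mat4) * (g s : Mat4)ᵀ) = fun _ => (1 : Mat4) :=
    funext fun s => mul_transpose_SO4 (g s)
  rw [h2] at h
  have h3 := h.unique (hasDerivAt_const t (1 : Mat4))
  rw [transpose_mul, transpose_transpose]
  exact eq_neg_of_add_eq_zero_right h3

/-! ### On-shell data pulled back along a map into a cell -/

section Pulled

variable {M : Type*} [TopologicalSpace M] [ChartedSpace (EuclideanSpace ℝ (Fin 3)) M]
  {Cell Link : Type*} {T : Triangulation M Cell Link}
  {F : Type*} [NormedAddCommGroup F] [NormedSpace ℝ F]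
  {V : Type*} [NormedAddCommGroup V] [NormedSpace ℝ V]

theorem contDiffAt_comp_family {φ : ℝ → M → V} {f : F → M} {t : ℝ} {p : F}
    (hφ : SmoothFamilyAt φ t (f p)) (hf : ContMDiffAt 𝓘(ℝ, F) (𝓡 3) ∞ f p) :
    ContDiffAt ℝ ∞ (fun q : ℝ × F => φ q.1 (f q.2)) (t, p) := by
  have hfst : ContMDiffAt 𝓘(ℝ, ℝ × F) 𝓘(ℝ, ℝ) ∞ (Prod.fst : ℝ × F → ℝ) (t, p) :=
    contDiffAt_fst.contMDiffAt
  have hsnd : ContMDiffAt 𝓘(ℝ, ℝ × F) 𝓘(ℝ, F) ∞ (Prod.snd : ℝ × F → F) (t, p) :=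
    contDiffAt_snd.contMDiffAt
  have h : ContMDiffAt 𝓘(ℝ, ℝ × F) (𝓘(ℝ, ℝ).prod (𝓡 3)) ∞
      (fun q : ℝ × F => (q.1, f q.2)) (t, p) :=
    hfst.prodMk (ContMDiffAt.comp (t, p) hf hsnd)
  exact (ContMDiffAt.comp (g := fun q : ℝ × M => φ q.1 q.2) (f := fun q : ℝ × F => (q.1, f q.2))
    (t, p) hφ h).contDiffAt

theorem mdifferentiableAt_of_family {φ : ℝ → M → V} {t : ℝ} {x : M}
    (hφ : SmoothFamilyAt φ t x) : MDifferentiableAt (𝓡 3) 𝓘(ℝ, V) (φ t) x := by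
  have h : ContMDiffAt (𝓡 3) (𝓘(ℝ, ℝ).prod (𝓡 3)) ∞ (fun y : M => (t, y)) x :=
    contMDiffAt_const.prodMk contMDiffAt_id
  exact (ContMDiffAt.comp (g := fun q : ℝ × M => φ q.1 q.2) x hφ h).mdifferentiableAt (by simp)

theorem dFun_pull {φ : ℝ → M → V} {f : F → M} {t : ℝ} {p : F}
    (hφ : SmoothFamilyAt φ t (f p)) (hf : ContMDiffAt 𝓘(ℝ, F) (𝓡 3) ∞ f p) (w : Fin 1 → F) :
    pullValues f (dFun (φ t)) p w = fderiv ℝ (fun y => φ t (f y)) p (w 0) := by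
  rw [← mfderiv_eq_fderiv]
  have h := mfderiv_comp p (mdifferentiableAt_of_family hφ) (hf.mdifferentiableAt (by simp))
  exact (DFunLike.congr_fun h (w 0)).symm

variable (D : OnShellData T) {i : Cell} {f : F → M} {p : F}

theorem contDiffAt_g (hf : ContMDiffAt 𝓘(ℝ, F) (𝓡 3) ∞ f p) (hp : f p ∈ T.cellSet i) (t : ℝ) :
    ContDiffAt ℝ ∞ (fun q : ℝ × F => (D.g i q.1 (f q.2) : Mat4)) (t, p) :=
  contDiffAt_comp_family (D.g_smooth i t _ hp) hf

theorem contDiffAt_c (hf : ContMDiffAt 𝓘(ℝ, F) (𝓡 3) ∞ f p) (hp : f p ∈ T.cellSet i) (t : ℝ) :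
    ContDiffAt ℝ ∞ (fun q : ℝ × F => D.c i q.1 (f q.2)) (t, p) :=
  contDiffAt_comp_family (D.c_smooth i t _ hp) hf

variable [IsManifold (𝓡 3) ∞ M]

/-- This and its analogue for σ replace the chart-dependent `extd` by an exterior derivative on a
normed space, where the calculus is done. -/
theorem pullValues_db (hf : ContMDiffAt 𝓘(ℝ, F) (𝓡 3) ∞ f p) (hp : f p ∈ T.cellSet i) (t : ℝ)
    (w : Fin 2 → F) :
    pullValues f (D.db i t) p w = extDeriv (pullback f (D.b i t)) p w := by
  rw [extDeriv_pullback_eq hf (D.b_smooth i t _ hp)]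
  rfl

theorem pullValues_dσ (hf : ContMDiffAt 𝓘(ℝ, F) (𝓡 3) ∞ f p) (hp : f p ∈ T.cellSet i) (t : ℝ)
    (w : Fin 2 → F) :
    pullValues f (D.dσ i t) p w = extDeriv (pullback f (D.σ i t)) p w := by
  rw [extDeriv_pullback_eq hf (D.σ_smooth i t _ hp)]
  rfl

theorem contDiffAt_db (hf : ContMDiffAt 𝓘(ℝ, F) (𝓡 3) ∞ f p) (hp : f p ∈ T.cellSet i) (t : ℝ) :
    ContDiffAt ℝ ∞ (fun q : ℝ × F => extDeriv (pullback f (D.b i q.1)) q.2) (t, p) :=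
  contDiffAt_extDeriv_family (η := fun t => pullback f (D.b i t))
    (contDiffAt_pullback hf (D.b_smooth i t _ hp))

theorem contDiffAt_dσ (hf : ContMDiffAt 𝓘(ℝ, F) (𝓡 3) ∞ f p) (hp : f p ∈ T.cellSet i) (t : ℝ) :
    ContDiffAt ℝ ∞ (fun q : ℝ × F => extDeriv (pullback f (D.σ i q.1)) q.2) (t, p) :=
  contDiffAt_extDeriv_family (η := fun t => pullback f (D.σ i t))
    (contDiffAt_pullback hf (D.σ_smooth i t _ hp))

theorem extDeriv_db (hf : ContMDiffAt 𝓘(ℝ, F) (𝓡 3) ∞ f p) (hp : f p ∈ T.cellSet i) (t : ℝ) :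
    extDeriv (fun y => extDeriv (pullback f (D.b i t)) y) p = 0 :=
  extDeriv_extDeriv_apply (contDiffAt_of_family (H := fun t => pullback f (D.b i t))
    (contDiffAt_pullback hf (D.b_smooth i t _ hp))) minSmoothness_two_le

theorem extDeriv_dσ (hf : ContMDiffAt 𝓘(ℝ, F) (𝓡 3) ∞ f p) (hp : f p ∈ T.cellSet i) (t : ℝ) :
    extDeriv (fun y => extDeriv (pullback f (D.σ i t)) y) p = 0 :=
  extDeriv_extDeriv_apply (contDiffAt_of_family (H := fun t => pullback f (D.σ i t))
    (contDiffAt_pullback hf (D.σ_smooth i t _ hp))) minSmoothness_two_le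

end Pulled

/-- The exterior derivative commutes with the derivative in the parameter. -/
theorem extDeriv_deriv_family_eq_zero {E V : Type*} [NormedAddCommGroup E] [NormedSpace ℝ E]
    [NormedAddCommGroup V] [NormedSpace ℝ V] {k : ℕ} {η : ℝ → E → E [⋀^Fin k]→L[ℝ] V} {t : ℝ}
    {p : E} (hη : ContDiffAt ℝ ∞ (fun q : ℝ × E => η q.1 q.2) (t, p))
    (h0 : ∀ s, extDeriv (η s) p = 0) :
    extDeriv (fun y => deriv (fun s => η s y) t) p = 0 := by
  have h := hasDerivAt_fderiv_family hη
  let L : (E →L[ℝ] E [⋀^Fin k]→L[ℝ] V) →L[ℝ] E [⋀^Fin (k + 1)]→L[ℝ] V :=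
    ContinuousAlternatingMap.alternatizeUncurryFinCLM ℝ E V
  have h2 := L.hasFDerivAt.comp_hasDerivAt t h
  have h3 : (L ∘ fun s => fderiv ℝ (η s) p) = fun _ => 0 := funext h0
  rw [h3] at h2
  exact h2.unique (hasDerivAt_const t _)

/-! ### The boundary form and its exterior derivative -/

section BoundaryForm

variable {E : Type*} [NormedAddCommGroup E] [NormedSpace ℝ E]

/-- The variation `δg g⁻¹` of a family of rotations. -/
def logVariation (g : ℝ → E → SO4) (y : E) : Mat4 :=
  deriv (fun t => (g t y : Mat4)) 0 * (g 0 y : Mat4)ᵀ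

variable {g : ℝ → E → SO4} {p : E}

theorem contDiffAt_logVariation
    (hg : ContDiffAt ℝ ∞ (fun q : ℝ × E => (g q.1 q.2 : Mat4)) (0, p)) :
    ContDiffAt ℝ ∞ (logVariation g) p := by
  have h1 := contDiffAt_of_family (H := fun t y => deriv (fun s => (g s y : Mat4)) t)
    (contDiffAt_deriv_family (H := fun t y => (g t y : Mat4)) hg)
  have h2 := contDiffAt_of_family (H := fun t y => (g t y : Mat4)) hg
  exact contDiffAt_bilin (B := fun A B : Mat4 => A * B) isBilinearMap_mul h1
    (contDiffAt_transpose h2)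

theorem logVariation_skew
    (hg : ContDiffAt ℝ ∞ (fun q : ℝ × E => (g q.1 q.2 : Mat4)) (0, p)) :
    (logVariation g p)ᵀ = -logVariation g p :=
  skew_of_hasDerivAt (g := fun t => g t p)
    ((contDiffAt_param_of_family (H := fun t y => (g t y : Mat4)) hg).differentiableAt
      (by simp)).hasDerivAt

theorem hasFDerivAt_transpose {f : E → Mat4} (hf : DifferentiableAt ℝ f p) :
    HasFDerivAt (fun y => (f y)ᵀ) (transposeL.comp (fderiv ℝ f p)) p :=
  transposeL.hasFDerivAt.comp p hf.hasFDerivAt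

theorem fderiv_transpose {f : E → Mat4} (hf : DifferentiableAt ℝ f p) (e : E) :
    fderiv ℝ (fun y => (f y)ᵀ) p e = (fderiv ℝ f p e)ᵀ :=
  DFunLike.congr_fun (hasFDerivAt_transpose hf).fderiv e

/-- This is the derivative of the orthogonality relation. -/
theorem fderiv_rotation {f : E → SO4} (hf : DifferentiableAt ℝ (fun y => (f y : Mat4)) p) (e : E) :
    (fderiv ℝ (fun y => (f y : Mat4)) p e)ᵀ * (f p : Mat4)
      + (f p : Mat4)ᵀ * fderiv ℝ (fun y => (f y : Mat4)) p e = 0 := by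
  have h := fderiv_bilin isBilinearMap_mul (hasFDerivAt_transpose hf).differentiableAt hf e
  have h2 : (fun y => (f y : Mat4)ᵀ * (f y : Mat4)) = fun _ => (1 : Mat4) :=
    funext fun y => transpose_mul_SO4 _
  rw [h2, fderiv_transpose hf] at h
  simpa using h.symm

/-- The variation of `g⁻¹ dg` is `g⁻¹ d(δg g⁻¹) g`. -/
theorem hasDerivAt_maurerCartan
    (hg : ContDiffAt ℝ ∞ (fun q : ℝ × E => (g q.1 q.2 : Mat4)) (0, p)) (e : E) :
    HasDerivAt (fun t => (g t p : Mat4)ᵀ * fderiv ℝ (fun y => (g t y : Mat4)) p e)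
      ((g 0 p : Mat4)ᵀ * fderiv ℝ (logVariation g) p e * (g 0 p : Mat4)) 0 := by
  have hgt := ((contDiffAt_param_of_family (H := fun t y => (g t y : Mat4)) hg).differentiableAt
    (by simp)).hasDerivAt
  have hgp := (contDiffAt_of_family (H := fun t y => (g t y : Mat4)) hg).differentiableAt
    (by simp)
  have hgd := (contDiffAt_of_family (H := fun t y => deriv (fun s => (g s y : Mat4)) t)
    (contDiffAt_deriv_family (H := fun t y => (g t y : Mat4)) hg)).differentiableAt (by simp)
  have h1 : HasDerivAt (fun s => fderiv ℝ (fun y => (g s y : Mat4)) p e)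
      (fderiv ℝ (fun y => deriv (fun s => (g s y : Mat4)) 0) p e) 0 :=
    (ContinuousLinearMap.apply ℝ Mat4 e).hasFDerivAt.comp_hasDerivAt 0
      (hasDerivAt_fderiv_family (H := fun t y => (g t y : Mat4)) hg)
  have h2 := hasDerivAt_bilin isBilinearMap_mul (hasDerivAt_transpose hgt) h1
  have h3 : fderiv ℝ (logVariation g) p e = _ := fderiv_bilin isBilinearMap_mul hgd
    (hasFDerivAt_transpose hgp).differentiableAt e
  rw [fderiv_transpose hgp] at h3
  have h4 := fderiv_rotation (f := g 0) hgp e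
  -- The orthogonality relation is differentiated once more, now in the parameter instead of the
  -- point.
  have h7 : (deriv (fun t => (g t p : Mat4)) 0)ᵀ * (g 0 p : Mat4)
      + (g 0 p : Mat4)ᵀ * deriv (fun t => (g t p : Mat4)) 0 = 0 := by
    have h5 := hasDerivAt_bilin isBilinearMap_mul (hasDerivAt_transpose hgt) hgt
    have h6 : (fun t => (g t p : Mat4)ᵀ * (g t p : Mat4)) = fun _ => (1 : Mat4) :=
      funext fun y => transpose_mul_SO4 _
    rw [h6] at h5
    exact h5.unique (hasDerivAt_const _ _)
  refine h2.congr_deriv (Eq.symm ?_)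
  rw [h3]
  have h8 := transpose_mul_SO4 (g 0 p)
  have h9 := mul_transpose_SO4 (g 0 p)
  generalize (g 0 p : Mat4) = G at *
  generalize deriv (fun t => (g t p : Mat4)) 0 = G' at *
  generalize fderiv ℝ (fun y => (g 0 y : Mat4)) p e = Ge at *
  generalize fderiv ℝ (fun y => deriv (fun s => (g s y : Mat4)) 0) p e = Ge' at *
  -- In the cross term both factors change sign by the two differentiated orthogonality relations,
  -- and the inner `G * Gᵀ` is the identity.
  calc Gᵀ * (Ge' * Gᵀ + G' * Geᵀ) * G = Gᵀ * Ge' * (Gᵀ * G) + (Gᵀ * G') * (Geᵀ * G) := by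
        simp only [Matrix.mul_add, Matrix.add_mul, Matrix.mul_assoc]
    _ = Gᵀ * Ge' + G'ᵀ * (G * Gᵀ) * Ge := by
        rw [eq_neg_of_add_eq_zero_left h4, eq_neg_of_add_eq_zero_right h7, h8]
        simp only [Matrix.mul_one, Matrix.neg_mul, Matrix.mul_neg, neg_neg, Matrix.mul_assoc]
    _ = G'ᵀ * Ge + Gᵀ * Ge' := by rw [h9, Matrix.mul_one, add_comm]

/-- The variation of `g⁻¹ s`. -/
theorem hasDerivAt_rotated
    (hg : ContDiffAt ℝ ∞ (fun q : ℝ × E => (g q.1 q.2 : Mat4)) (0, p)) {s : ℝ → R4} {s' : R4}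
    (hs : HasDerivAt s s' 0) :
    HasDerivAt (fun t => (g t p : Mat4)ᵀ *ᵥ s t)
      ((g 0 p : Mat4)ᵀ *ᵥ (s' - logVariation g p *ᵥ s 0)) 0 := by
  have hgt := ((contDiffAt_param_of_family (H := fun t y => (g t y : Mat4)) hg).differentiableAt
    (by simp)).hasDerivAt
  have h := hasDerivAt_bilin isBilinearMap_mulVec (hasDerivAt_transpose hgt) hs
  refine h.congr_deriv (Eq.symm ?_)
  -- Skewness of Δg replaces it by minus its transpose g (δg)ᵀ, whose factor g cancels.
  have h2 : (g 0 p : Mat4)ᵀ * logVariation g p = -(deriv (fun t => (g t p : Mat4)) 0)ᵀ := by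
    rw [← neg_eq_iff_eq_neg, ← Matrix.mul_neg, ← logVariation_skew hg, logVariation,
      transpose_mul, transpose_transpose, ← Matrix.mul_assoc, transpose_mul_SO4, Matrix.one_mul]
  rw [mulVec_sub, mulVec_mulVec, h2, neg_mulVec, sub_neg_eq_add, add_comm]

/-- The form `⟨β, Δ⟩ + ⟨[ς, c], Δ⟩ - ⟨c, ς'⟩`. -/
def boundaryFormOf (Δ : E → Mat4) (c : E → R4) (β : E → E [⋀^Fin 2]→L[ℝ] Mat4)
    (ς ς' : E → E [⋀^Fin 2]→L[ℝ] R4) (y : E) : E [⋀^Fin 2]→L[ℝ] ℝ :=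
  (isBilinearMap_pairSo.toContinuousBilinearMap.flip (Δ y)).compContinuousAlternatingMap
    (β y + (isBilinearMap_mixedBracket.toContinuousBilinearMap.flip
      (c y)).compContinuousAlternatingMap (ς y))
  - (isBilinearMap_dotProduct.toContinuousBilinearMap (c y)).compContinuousAlternatingMap (ς' y)

theorem boundaryFormOf_apply (Δ : E → Mat4) (c : E → R4) (β : E → E [⋀^Fin 2]→L[ℝ] Mat4)
    (ς ς' : E → E [⋀^Fin 2]→L[ℝ] R4) (y : E) (v : Fin 2 → E) :
    boundaryFormOf Δ c β ς ς' y v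
      = pairSo (β y v + mixedBracket (ς y v) (c y)) (Δ y) - c y ⬝ᵥ ς' y v := rfl

variable {Δ : E → Mat4} {c : E → R4} {β : E → E [⋀^Fin 2]→L[ℝ] Mat4}
  {ς ς' : E → E [⋀^Fin 2]→L[ℝ] R4}

theorem contDiffAt_boundaryFormOf {n : WithTop ℕ∞} (hΔ : ContDiffAt ℝ n Δ p)
    (hc : ContDiffAt ℝ n c p) (hβ : ContDiffAt ℝ n β p) (hς : ContDiffAt ℝ n ς p)
    (hς' : ContDiffAt ℝ n ς' p) : ContDiffAt ℝ n (boundaryFormOf Δ c β ς ς') p := by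
  have key : ∀ {V W : Type} [NormedAddCommGroup V] [NormedSpace ℝ V] [NormedAddCommGroup W]
      [NormedSpace ℝ W] {L : E → V →L[ℝ] W} {φ : E → E [⋀^Fin 2]→L[ℝ] V},
      ContDiffAt ℝ n L p → ContDiffAt ℝ n φ p →
      ContDiffAt ℝ n (fun y => (L y).compContinuousAlternatingMap (φ y)) p := by
    intro V W _ _ _ _ L φ hL hφ
    exact (hL.continuousLinearMap_comp
      (ContinuousLinearMap.compContinuousAlternatingMapCLM ℝ E V W (Fin 2))).clm_apply hφ
  refine ContDiffAt.sub (key ?_ (hβ.add (key ?_ hς))) (key ?_ hς')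
  · exact hΔ.continuousLinearMap_comp isBilinearMap_pairSo.toContinuousBilinearMap.flip
  · exact hc.continuousLinearMap_comp isBilinearMap_mixedBracket.toContinuousBilinearMap.flip
  · exact hc.continuousLinearMap_comp isBilinearMap_dotProduct.toContinuousBilinearMap

theorem differentiableAt_alternating_apply {V : Type*} [NormedAddCommGroup V] [NormedSpace ℝ V]
    {k : ℕ} {η : E → E [⋀^Fin k]→L[ℝ] V} (hη : DifferentiableAt ℝ η p) (v : Fin k → E) :
    DifferentiableAt ℝ (fun y => η y v) p :=
  ((ContinuousAlternatingMap.apply ℝ E V v).hasFDerivAt.comp p hη.hasFDerivAt).differentiableAt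

/-- The terms are grouped so that the second bracket contains derivatives of `β`, `ς` and `ς'` only.
Its alternating sum vanishes once these forms are closed. -/
theorem fderiv_boundaryFormOf_apply (hΔ : DifferentiableAt ℝ Δ p)
    (hc : DifferentiableAt ℝ c p) (hβ : DifferentiableAt ℝ β p) (hς : DifferentiableAt ℝ ς p)
    (hς' : DifferentiableAt ℝ ς' p) (v : Fin 2 → E) (e : E) :
    fderiv ℝ (fun y => boundaryFormOf Δ c β ς ς' y v) p e
      = (pairSo (β p v + mixedBracket (ς p v) (c p)) (fderiv ℝ Δ p e)
          + pairSo (mixedBracket (ς p v) (fderiv ℝ c p e)) (Δ p) - fderiv ℝ c p e ⬝ᵥ ς' p v)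
        + (pairSo (fderiv ℝ (fun y => β y v) p e) (Δ p)
          + pairSo (mixedBracket (fderiv ℝ (fun y => ς y v) p e) (c p)) (Δ p)
          - c p ⬝ᵥ fderiv ℝ (fun y => ς' y v) p e) := by
  have hβv := differentiableAt_alternating_apply hβ v
  have hςv := differentiableAt_alternating_apply hς v
  have hςv' := differentiableAt_alternating_apply hς' v
  have hm : DifferentiableAt ℝ (fun y => mixedBracket (ς y v) (c y)) p :=
    ((isBilinearMap_mixedBracket.toContinuousBilinearMap.hasFDerivAt.comp p
      hςv.hasFDerivAt).clm_apply hc.hasFDerivAt).differentiableAt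
  have hp1 : DifferentiableAt ℝ
      (fun y => pairSo (β y v + mixedBracket (ς y v) (c y)) (Δ y)) p :=
    ((isBilinearMap_pairSo.toContinuousBilinearMap.hasFDerivAt.comp p
      (hβv.add hm).hasFDerivAt).clm_apply hΔ.hasFDerivAt).differentiableAt
  have hp2 : DifferentiableAt ℝ (fun y => c y ⬝ᵥ ς' y v) p :=
    ((isBilinearMap_dotProduct.toContinuousBilinearMap.hasFDerivAt.comp p
      hc.hasFDerivAt).clm_apply hςv'.hasFDerivAt).differentiableAt
  have h1 : fderiv ℝ (fun y => boundaryFormOf Δ c β ς ς' y v) p e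
      = fderiv ℝ (fun y => pairSo (β y v + mixedBracket (ς y v) (c y)) (Δ y)) p e
        - fderiv ℝ (fun y => c y ⬝ᵥ ς' y v) p e := by
    simp only [boundaryFormOf_apply]
    rw [fderiv_fun_sub hp1 hp2]
    rfl
  have h2 : fderiv ℝ (fun y => β y v + mixedBracket (ς y v) (c y)) p e
      = fderiv ℝ (fun y => β y v) p e + fderiv ℝ (fun y => mixedBracket (ς y v) (c y)) p e := by
    rw [fderiv_fun_add hβv hm]
    rfl
  rw [h1, fderiv_bilin isBilinearMap_pairSo (hβv.fun_add hm) hΔ,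
    fderiv_bilin isBilinearMap_dotProduct hc hςv', h2,
    fderiv_bilin isBilinearMap_mixedBracket hςv hc]
  simp only [pairSo_add_left]
  ring

theorem extDeriv_apply_three {V : Type*} [NormedAddCommGroup V] [NormedSpace ℝ V]
    {η : E → E [⋀^Fin 2]→L[ℝ] V} (hη : DifferentiableAt ℝ η p) (v : Fin 3 → E) :
    extDeriv η p v = fderiv ℝ (fun y => η y ![v 1, v 2]) p (v 0)
      - fderiv ℝ (fun y => η y ![v 0, v 2]) p (v 1)
      + fderiv ℝ (fun y => η y ![v 0, v 1]) p (v 2) := by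
  have hr : ∀ i : Fin 3, i.removeNth v = ![v (i.succAbove 0), v (i.succAbove 1)] := by
    intro i
    funext j
    fin_cases j <;> rfl
  rw [extDeriv_apply hη, Fin.sum_univ_three]
  simp only [hr]
  simp [Fin.succAbove, sub_eq_add_neg]

/-- The exterior derivative of the boundary form of closed forms. -/
theorem extDeriv_boundaryFormOf (hΔ : DifferentiableAt ℝ Δ p)
    (hc : DifferentiableAt ℝ c p) (hβ : DifferentiableAt ℝ β p) (hς : DifferentiableAt ℝ ς p)
    (hς' : DifferentiableAt ℝ ς' p) (dβ : extDeriv β p = 0) (dς : extDeriv ς p = 0)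
    (dς' : extDeriv ς' p = 0) (hη : DifferentiableAt ℝ (boundaryFormOf Δ c β ς ς') p)
    (v : Fin 3 → E) (K : (Fin 2 → E) → E → ℝ)
    (hK : ∀ w e, K w e = pairSo (β p w + mixedBracket (ς p w) (c p)) (fderiv ℝ Δ p e)
      + pairSo (mixedBracket (ς p w) (fderiv ℝ c p e)) (Δ p) - fderiv ℝ c p e ⬝ᵥ ς' p w) :
    extDeriv (boundaryFormOf Δ c β ς ς') p v
      = K ![v 1, v 2] (v 0) - K ![v 0, v 2] (v 1) + K ![v 0, v 1] (v 2) := by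
  have e1 := (extDeriv_apply_three hβ v).symm.trans (by rw [dβ]; rfl : _ = (0 : Mat4))
  have e2 := (extDeriv_apply_three hς v).symm.trans (by rw [dς]; rfl : _ = (0 : R4))
  have e3 := (extDeriv_apply_three hς' v).symm.trans (by rw [dς']; rfl : _ = (0 : R4))
  -- Closedness gives three vanishing alternating sums; the linear maps that occur in the boundary
  -- form are applied to them.
  have f1 := congrArg (fun z => pairSo z (Δ p)) e1
  have f2 := congrArg (fun z => pairSo (mixedBracket z (c p)) (Δ p)) e2
  have f3 := congrArg (fun z => c p ⬝ᵥ z) e3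
  have pairSo_neg : ∀ a b, pairSo (-a) b = -pairSo a b := fun a b => by
    simpa using pairSo_smul_left (-1) a b
  have mb_add : ∀ a b d, mixedBracket (a + b) d = mixedBracket a d + mixedBracket b d :=
    isBilinearMap_mixedBracket.add_left
  have mb_neg : ∀ a d, mixedBracket (-a) d = -mixedBracket a d := fun a d => by
    simpa using isBilinearMap_mixedBracket.smul_left (-1) a d
  have mb_zero : ∀ d, mixedBracket 0 d = 0 := fun d => by
    simpa using isBilinearMap_mixedBracket.smul_left 0 0 d
  simp only [sub_eq_add_neg, pairSo_add_left, pairSo_neg, pairSo_zero_left] at f1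
  simp only [sub_eq_add_neg, mb_add, mb_neg, mb_zero, pairSo_add_left, pairSo_neg,
    pairSo_zero_left] at f2
  simp only [sub_eq_add_neg, dotProduct_add, dotProduct_neg, dotProduct_zero] at f3
  rw [extDeriv_apply_three hη]
  -- The terms without derivatives of the closed forms are folded into the atom `K`; what is left is
  -- a combination of the three relations.
  simp only [fderiv_boundaryFormOf_apply hΔ hc hβ hς hς', ← hK]
  linear_combination f1 + f2 - f3

end BoundaryForm

/-- The pairings of conjugated fields. -/
theorem conjugated_pairing {g : SO4} {Δ X DΔ : Mat4} (hΔ : Δᵀ = -Δ) (Dc s s' : R4) :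
    pairSo ((g : Mat4)ᵀ * X * (g : Mat4)) ((g : Mat4)ᵀ * DΔ * (g : Mat4))
      - ((g : Mat4)ᵀ *ᵥ Dc) ⬝ᵥ ((g : Mat4)ᵀ *ᵥ (s' - Δ *ᵥ s))
      = pairSo X DΔ + pairSo (mixedBracket s Dc) Δ - Dc ⬝ᵥ s' := by
  -- Once `g` has dropped out, `Dc` paired with `Δ *ᵥ s` is, by skewness and invariance, the pairing
  -- of [s, Dc] with `Δ`.
  rw [pairSo_conj (mul_transpose_SO4 g), dotProduct_transpose_mulVec (mul_transpose_SO4 g),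
    pairSo_mixedBracket _ _ _ hΔ, dotProduct_sub, dotProduct_neg, ← dotProduct_comm _ s,
    mulVec_dotProduct_skew hΔ]
  ring

section Cell

variable {M : Type*} [TopologicalSpace M] [ChartedSpace (EuclideanSpace ℝ (Fin 3)) M]
  {Cell Link : Type*} {T : Triangulation M Cell Link}
  {F : Type*} [NormedAddCommGroup F] [NormedSpace ℝ F]

/-! ### The fields of a cell, pulled back -/

theorem pullValues_pair {V : Type*} (f : F → M) (η : FormValues M 2 V) (p a b : F) :
    η (f p) ![mfderiv 𝓘(ℝ, F) (𝓡 3) f p a, mfderiv 𝓘(ℝ, F) (𝓡 3) f p b]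
      = pullValues f η p ![a, b] := by
  refine congrArg (η (f p)) (funext fun j => ?_)
  fin_cases j <;> rfl

theorem pullValues_single {V : Type*} (f : F → M) (η : FormValues M 1 V) (p a : F) :
    η (f p) ![mfderiv 𝓘(ℝ, F) (𝓡 3) f p a] = pullValues f η p ![a] := by
  refine congrArg (η (f p)) (funext fun j => ?_)
  fin_cases j
  rfl

theorem pullValues_wedge21 {V W : Type*} (pair : V → W → ℝ) (f : F → M) (α : FormValues M 2 V)
    (β : FormValues M 1 W) (p : F) (e : Fin 3 → F) :
    pullValues f (wedge21 pair α β) p e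
      = pair (pullValues f α p ![e 0, e 1]) (pullValues f β p ![e 2])
        - pair (pullValues f α p ![e 0, e 2]) (pullValues f β p ![e 1])
        + pair (pullValues f α p ![e 1, e 2]) (pullValues f β p ![e 0]) := by
  simp only [← pullValues_pair, ← pullValues_single]
  rfl

theorem pullValues_wedge12 {V W : Type*} (pair : V → W → ℝ) (f : F → M) (α : FormValues M 1 V)
    (β : FormValues M 2 W) (p : F) (e : Fin 3 → F) :
    pullValues f (wedge12 pair α β) p e
      = pair (pullValues f α p ![e 0]) (pullValues f β p ![e 1, e 2])
        - pair (pullValues f α p ![e 1]) (pullValues f β p ![e 0, e 2])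
        + pair (pullValues f α p ![e 2]) (pullValues f β p ![e 0, e 1]) := by
  simp only [← pullValues_pair, ← pullValues_single]
  rfl

theorem pullValues_variation {V : Type*} [NormedAddCommGroup V] [NormedSpace ℝ V] {k : ℕ}
    (f : F → M) (η : ℝ → FormValues M k V) (p : F) (w : Fin k → F) :
    pullValues f (variation η) p w = deriv (fun t => pullValues f (η t) p w) 0 := rfl

variable (D : OnShellData T) (i : Cell) (f : F → M)

/-- The rotations of a cell, pulled back along `f`. -/
def pulledG (t : ℝ) (y : F) : SO4 := D.g i t (f y)

/-- The translations of a cell, pulled back along `f`. -/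
def pulledC (t : ℝ) (y : F) : R4 := D.c i t (f y)

/-- The form `db` of a cell, pulled back along `f`. -/
def pulledDb (t : ℝ) (y : F) : F [⋀^Fin 2]→L[ℝ] Mat4 := extDeriv (pullback f (D.b i t)) y

/-- The form `dσ` of a cell, pulled back along `f`. -/
def pulledDσ (t : ℝ) (y : F) : F [⋀^Fin 2]→L[ℝ] R4 := extDeriv (pullback f (D.σ i t)) y

/-- The variation of `dσ`, pulled back along `f`. -/
def pulledδDσ (y : F) : F [⋀^Fin 2]→L[ℝ] R4 := deriv (fun t => pulledDσ D i f t y) 0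

/-- The boundary form of a cell, pulled back along `f`. -/
def pulledBoundaryForm : F → F [⋀^Fin 2]→L[ℝ] ℝ :=
  boundaryFormOf (logVariation (pulledG D i f)) (pulledC D i f 0) (pulledDb D i f 0)
    (pulledDσ D i f 0) (pulledδDσ D i f)

variable {i f} {p : F}

theorem pullValues_C (hf : ContMDiffAt 𝓘(ℝ, F) (𝓡 3) ∞ f p) (hp : f p ∈ T.cellSet i) (t : ℝ)
    (w : Fin 1 → F) :
    pullValues f (D.C i t) p w
      = (pulledG D i f t p : Mat4)ᵀ *ᵥ fderiv ℝ (pulledC D i f t) p (w 0) :=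
  congrArg (fun z => (pulledG D i f t p : Mat4)ᵀ *ᵥ z) (dFun_pull (D.c_smooth i t _ hp) hf w)

theorem pullValues_A (hf : ContMDiffAt 𝓘(ℝ, F) (𝓡 3) ∞ f p) (hp : f p ∈ T.cellSet i) (t : ℝ)
    (w : Fin 1 → F) :
    pullValues f (D.A i t) p w
      = (pulledG D i f t p : Mat4)ᵀ * fderiv ℝ (fun y => (pulledG D i f t y : Mat4)) p (w 0) :=
  congrArg (fun z => (pulledG D i f t p : Mat4)ᵀ * z) (dFun_pull (D.g_smooth i t _ hp) hf w)

theorem pullValues_variation_A (hf : ContMDiffAt 𝓘(ℝ, F) (𝓡 3) ∞ f p)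
    (hp : f p ∈ T.cellSet i) (w : Fin 1 → F) :
    pullValues f (variation (D.A i)) p w = (pulledG D i f 0 p : Mat4)ᵀ
      * fderiv ℝ (logVariation (pulledG D i f)) p (w 0) * (pulledG D i f 0 p : Mat4) := by
  rw [pullValues_variation]
  simp only [pullValues_A D hf hp]
  exact (hasDerivAt_maurerCartan (g := pulledG D i f) (contDiffAt_g D hf hp 0) (w 0)).deriv

theorem contDiffAt_pulledLogVariation (hf : ContMDiffAt 𝓘(ℝ, F) (𝓡 3) ∞ f p)
    (hp : f p ∈ T.cellSet i) : ContDiffAt ℝ ∞ (logVariation (pulledG D i f)) p :=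
  contDiffAt_logVariation (contDiffAt_g D hf hp 0)

theorem contDiffAt_pulledC (hf : ContMDiffAt 𝓘(ℝ, F) (𝓡 3) ∞ f p)
    (hp : f p ∈ T.cellSet i) (t : ℝ) : ContDiffAt ℝ ∞ (pulledC D i f t) p :=
  contDiffAt_of_family (contDiffAt_c D hf hp t)

variable [IsManifold (𝓡 3) ∞ M]

theorem pullValues_Sig (hf : ContMDiffAt 𝓘(ℝ, F) (𝓡 3) ∞ f p) (hp : f p ∈ T.cellSet i) (t : ℝ)
    (w : Fin 2 → F) :
    pullValues f (D.Sig i t) p w = (pulledG D i f t p : Mat4)ᵀ *ᵥ pulledDσ D i f t p w :=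
  congrArg (fun z => (pulledG D i f t p : Mat4)ᵀ *ᵥ z) (pullValues_dσ D hf hp t w)

theorem pullValues_B (hf : ContMDiffAt 𝓘(ℝ, F) (𝓡 3) ∞ f p) (hp : f p ∈ T.cellSet i) (t : ℝ)
    (w : Fin 2 → F) :
    pullValues f (D.B i t) p w = (pulledG D i f t p : Mat4)ᵀ
      * (pulledDb D i f t p w + mixedBracket (pulledDσ D i f t p w) (pulledC D i f t p))
      * (pulledG D i f t p : Mat4) := by
  rw [pulledDb, pulledDσ, ← pullValues_db D hf hp, ← pullValues_dσ D hf hp]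
  rfl

theorem hasDerivAt_pulledDσ (hf : ContMDiffAt 𝓘(ℝ, F) (𝓡 3) ∞ f p) (hp : f p ∈ T.cellSet i)
    (w : Fin 2 → F) :
    HasDerivAt (fun t => pulledDσ D i f t p w) (pulledδDσ D i f p w) 0 := by
  have h := ((contDiffAt_param_of_family (H := pulledDσ D i f)
    (contDiffAt_dσ D hf hp 0)).differentiableAt (by simp)).hasDerivAt
  exact (ContinuousAlternatingMap.apply ℝ F R4 w).hasFDerivAt.comp_hasDerivAt 0 h

theorem pullValues_variation_Sig (hf : ContMDiffAt 𝓘(ℝ, F) (𝓡 3) ∞ f p)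
    (hp : f p ∈ T.cellSet i) (w : Fin 2 → F) :
    pullValues f (variation (D.Sig i)) p w = (pulledG D i f 0 p : Mat4)ᵀ
      *ᵥ (pulledδDσ D i f p w - logVariation (pulledG D i f) p *ᵥ pulledDσ D i f 0 p w) := by
  rw [pullValues_variation]
  simp only [pullValues_Sig D hf hp]
  exact (hasDerivAt_rotated (g := pulledG D i f) (contDiffAt_g D hf hp 0)
    (hasDerivAt_pulledDσ D hf hp w)).deriv

/-- `D.boundaryForm` is only a function of tangent vectors. This identifies its pullback with a
smooth alternating form, to which Stokes and the permutation rule apply. -/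
theorem pullValues_boundaryForm (hf : ContMDiffAt 𝓘(ℝ, F) (𝓡 3) ∞ f p)
    (hp : f p ∈ T.cellSet i) (w : Fin 2 → F) :
    pullValues f (D.boundaryForm i) p w = pulledBoundaryForm D i f p w := by
  have h1 : pullValues f (D.boundaryForm i) p w
      = pairSo (pullValues f (D.db i 0) p w) (logVariation (pulledG D i f) p)
        + pairSo (mixedBracket (pullValues f (D.dσ i 0) p w) (pulledC D i f 0 p))
          (logVariation (pulledG D i f) p)
        - pulledC D i f 0 p ⬝ᵥ pullValues f (variation (D.dσ i)) p w := rfl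
  have h2 : pullValues f (variation (D.dσ i)) p w = pulledδDσ D i f p w := by
    rw [pullValues_variation]
    simp only [pullValues_dσ D hf hp]
    exact (hasDerivAt_pulledDσ D hf hp w).deriv
  rw [h1, h2, pullValues_db D hf hp, pullValues_dσ D hf hp, pulledBoundaryForm,
    boundaryFormOf_apply, pairSo_add_left]
  rfl

theorem contDiffAt_pulledDb (hf : ContMDiffAt 𝓘(ℝ, F) (𝓡 3) ∞ f p)
    (hp : f p ∈ T.cellSet i) (t : ℝ) : ContDiffAt ℝ ∞ (pulledDb D i f t) p :=
  contDiffAt_of_family (contDiffAt_db D hf hp t)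

theorem contDiffAt_pulledDσ (hf : ContMDiffAt 𝓘(ℝ, F) (𝓡 3) ∞ f p)
    (hp : f p ∈ T.cellSet i) (t : ℝ) : ContDiffAt ℝ ∞ (pulledDσ D i f t) p :=
  contDiffAt_of_family (contDiffAt_dσ D hf hp t)

theorem contDiffAt_pulledδDσ (hf : ContMDiffAt 𝓘(ℝ, F) (𝓡 3) ∞ f p)
    (hp : f p ∈ T.cellSet i) : ContDiffAt ℝ ∞ (pulledδDσ D i f) p :=
  contDiffAt_of_family (H := fun t y => deriv (fun s => pulledDσ D i f s y) t)
    (contDiffAt_deriv_family (H := pulledDσ D i f) (contDiffAt_dσ D hf hp 0))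

theorem contDiffAt_pulledBoundaryForm (hf : ContMDiffAt 𝓘(ℝ, F) (𝓡 3) ∞ f p)
    (hp : f p ∈ T.cellSet i) : ContDiffAt ℝ ∞ (pulledBoundaryForm D i f) p :=
  contDiffAt_boundaryFormOf (contDiffAt_pulledLogVariation D hf hp) (contDiffAt_pulledC D hf hp 0)
    (contDiffAt_pulledDb D hf hp 0) (contDiffAt_pulledDσ D hf hp 0) (contDiffAt_pulledδDσ D hf hp)

/-- The integrand of the potential is the exterior derivative of the boundary form. -/
theorem extDeriv_pulledBoundaryForm (hf : ContMDiffAt 𝓘(ℝ, F) (𝓡 3) ∞ f p)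
    (hp : f p ∈ T.cellSet i) (e : Fin 3 → F) :
    extDeriv (pulledBoundaryForm D i f) p e
      = pullValues f (wedge21 pairSo (D.B i 0) (variation (D.A i))) p e
        - pullValues f (wedge12 (fun v w : R4 => v ⬝ᵥ w) (D.C i 0) (variation (D.Sig i))) p e := by
  have hd : (∞ : WithTop ℕ∞) ≠ 0 := by simp
  rw [pulledBoundaryForm, extDeriv_boundaryFormOf
    ((contDiffAt_pulledLogVariation D hf hp).differentiableAt hd)
    ((contDiffAt_pulledC D hf hp 0).differentiableAt hd)
    ((contDiffAt_pulledDb D hf hp 0).differentiableAt hd)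
    ((contDiffAt_pulledDσ D hf hp 0).differentiableAt hd)
    ((contDiffAt_pulledδDσ D hf hp).differentiableAt hd)
    (extDeriv_db D hf hp 0) (extDeriv_dσ D hf hp 0)
    (extDeriv_deriv_family_eq_zero (η := pulledDσ D i f) (contDiffAt_dσ D hf hp 0)
      (extDeriv_dσ D hf hp))
    ((contDiffAt_pulledBoundaryForm D hf hp).differentiableAt hd) e _ fun _ _ => rfl]
  simp only [pullValues_wedge21, pullValues_wedge12, pullValues_B D hf hp, pullValues_C D hf hp,
    pullValues_variation_A D hf hp, pullValues_variation_Sig D hf hp]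
  have hΔ := logVariation_skew (g := pulledG D i f) (contDiffAt_g D hf hp 0)
  -- Used from right to left, the identity reinserts the conjugations by g and so produces the
  -- components of B, δA, C and δΣ.
  simp only [← conjugated_pairing (g := pulledG D i f 0 p) hΔ]
  simp only [Matrix.cons_val_zero]
  ring

end Cell

/-! ### Integrals depending on a parameter -/

/-- The parameter derivative is continuous on the compact product of a closed unit ball of
parameters and the simplex. It is bounded there, and a constant dominates it. -/
theorem hasDerivAt_integral_stdCell {k : ℕ} {V : Type*} [NormedAddCommGroup V] [NormedSpace ℝ V]
    {H : ℝ → (Fin k → ℝ) → V}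
    (hH : ∀ t, ∀ s ∈ stdCell k,
      ContDiffAt ℝ ∞ (fun q : ℝ × (Fin k → ℝ) => H q.1 q.2) (t, s)) (t : ℝ) :
    HasDerivAt (fun r => ∫ s in stdCell k, H r s)
      (∫ s in stdCell k, deriv (fun r => H r s) t) t := by
  have hcont : ∀ r, ContinuousOn (H r) (stdCell k) := fun r s hs =>
    (contDiffAt_of_family (hH r s hs)).continuousAt.continuousWithinAt
  have hderiv : ∀ r, ContinuousOn (fun s => deriv (fun r => H r s) r) (stdCell k) := fun r s hs =>
    (contDiffAt_of_family (H := fun t y => deriv (fun s => H s y) t)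
      (contDiffAt_deriv_family (hH r s hs))).continuousAt.continuousWithinAt
  have hK : ContinuousOn (fun q : ℝ × (Fin k → ℝ) => deriv (fun r => H r q.2) q.1)
      (Metric.closedBall t 1 ×ˢ stdCell k) := fun q hq =>
    (contDiffAt_deriv_family (hH q.1 q.2 hq.2)).continuousAt.continuousWithinAt
  obtain ⟨C, hC⟩ := ((isCompact_closedBall t 1).prod isCompact_stdCell).exists_bound_of_continuousOn
    hK
  refine (hasDerivAt_integral_of_dominated_loc_of_deriv_le (bound := fun _ => C)
    (F' := fun r s => deriv (fun r => H r s) r)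
    (Metric.closedBall_mem_nhds t one_pos) ?_ ?_ ?_ ?_ ?_ ?_).2
  · exact Eventually.of_forall fun r =>
      (hcont r).aestronglyMeasurable measurableSet_stdCell
  · exact (hcont t).integrableOn_compact isCompact_stdCell
  · exact (hderiv t).aestronglyMeasurable measurableSet_stdCell
  · refine (ae_restrict_iff' measurableSet_stdCell).2 (Eventually.of_forall fun s hs r hr => ?_)
    exact hC (r, s) ⟨hr, hs⟩
  · exact continuousOn_const.integrableOn_compact isCompact_stdCell
  · refine (ae_restrict_iff' measurableSet_stdCell).2 (Eventually.of_forall fun s hs r _ => ?_)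
    exact ((contDiffAt_param_of_family (hH r s hs)).differentiableAt (by simp)).hasDerivAt

/-! ### The potential of a cell -/

section Cell

variable {M : Type*} [TopologicalSpace M] [ChartedSpace (EuclideanSpace ℝ (Fin 3)) M]
  {Cell Link : Type*} {T : Triangulation M Cell Link}

theorem pullValues_comp {E F V : Type*} [NormedAddCommGroup E] [NormedSpace ℝ E]
    [NormedAddCommGroup F] [NormedSpace ℝ F] {k : ℕ} {f : F → M} {a : E → F} {a' : E →L[ℝ] F}
    {s : E} (hf : ContMDiffAt 𝓘(ℝ, F) (𝓡 3) ∞ f (a s)) (ha : HasFDerivAt a a' s)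
    (η : FormValues M k V) (w : Fin k → E) :
    pullValues (f ∘ a) η s w = pullValues f η (a s) (fun j => a' (w j)) := by
  have h := mfderiv_comp s (hf.mdifferentiableAt (by simp)) ha.differentiableAt.mdifferentiableAt
  rw [mfderiv_eq_fderiv, ha.fderiv] at h
  exact congrArg (η (f (a s))) (funext fun j => DFunLike.congr_fun h (w j))

theorem contMDiffAt_param_comp (T : Triangulation M Cell Link) (i : Cell) {k : ℕ}
    {v : Fin (k + 1) → Fin 3 → ℝ} (hv : ∀ j, v j ∈ stdCell 3) {s : Fin k → ℝ}
    (hs : s ∈ stdCell k) :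
    ContMDiffAt 𝓘(ℝ, Fin k → ℝ) (𝓡 3) ∞ (T.param i ∘ affineSimplex v) s :=
  ContMDiffAt.comp s (T.smooth i _ (affineSimplex_mem convex_stdCell hv hs))
    (contDiff_affineSimplex v).contDiffAt.contMDiffAt

theorem param_comp_mem (T : Triangulation M Cell Link) (i : Cell) {k : ℕ}
    {v : Fin (k + 1) → Fin 3 → ℝ} (hv : ∀ j, v j ∈ stdCell 3) {s : Fin k → ℝ}
    (hs : s ∈ stdCell k) : (T.param i ∘ affineSimplex v) s ∈ T.cellSet i :=
  ⟨_, affineSimplex_mem convex_stdCell hv hs, rfl⟩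

variable [IsManifold (𝓡 3) ∞ M] (D : OnShellData T)

/-- Provides the integrability needed to separate the two integrals of the potential. The rotations
cancel in the dot product, which leaves a visibly smooth expression. -/
theorem continuousOn_wedge12 (i : Cell) (e : Fin 3 → Fin 3 → ℝ) :
    ContinuousOn (fun p => pullValues (T.param i)
      (wedge12 (fun v w : R4 => v ⬝ᵥ w) (D.C i 0) (variation (D.Sig i))) p e) (stdCell 3) := by
  have key : ∀ (u : Fin 3 → ℝ) (w : Fin 2 → Fin 3 → ℝ),
      ContinuousOn (fun p => (pullValues (T.param i) (D.C i 0) p ![u])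
        ⬝ᵥ (pullValues (T.param i) (variation (D.Sig i)) p w)) (stdCell 3) := by
    intro u w
    refine ContinuousOn.congr (f := fun p => fderiv ℝ (pulledC D i (T.param i) 0) p u
      ⬝ᵥ (pulledδDσ D i (T.param i) p w
        - logVariation (pulledG D i (T.param i)) p *ᵥ pulledDσ D i (T.param i) 0 p w)) ?_ ?_
    · intro p hp
      have hf := T.smooth i p hp
      have hp' : T.param i p ∈ T.cellSet i := ⟨p, hp, rfl⟩
      have h1 := contDiffAt_alternating_apply (contDiffAt_pulledδDσ D hf hp') w
      have h2 := contDiffAt_alternating_apply (contDiffAt_pulledDσ D hf hp' 0) w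
      have h3 := contDiffAt_pulledLogVariation D hf hp'
      have h4 := ((contDiffAt_pulledC D hf hp' 0).fderiv_right (m := ∞) (by simp)).clm_apply
        (contDiffAt_const (c := u))
      exact (contDiffAt_bilin isBilinearMap_dotProduct h4
        (h1.sub (contDiffAt_bilin isBilinearMap_mulVec h3 h2))).continuousAt.continuousWithinAt
    · intro p hp
      have hf := T.smooth i p hp
      have hp' : T.param i p ∈ T.cellSet i := ⟨p, hp, rfl⟩
      simp only [pullValues_C D hf hp', pullValues_variation_Sig D hf hp',
        dotProduct_transpose_mulVec (mul_transpose_SO4 _)]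
      rfl
  simp only [pullValues_wedge12]
  exact ((key _ _).sub (key _ _)).add (key _ _)

/-- The theorem of Stokes for the potential of a cell. -/
theorem cell_potential_eq (i : Cell) :
    integrate (T.param i) (wedge21 pairSo (D.B i 0) (variation (D.A i)))
      - integrate (T.param i) (wedge12 (fun v w : R4 => v ⬝ᵥ w) (D.C i 0) (variation (D.Sig i)))
      = T.boundaryIntegral i (D.boundaryForm i) := by
  have hη : ∀ p ∈ stdCell 3, ContDiffAt ℝ ∞ (pulledBoundaryForm D i (T.param i)) p :=
    fun p hp => contDiffAt_pulledBoundaryForm D (T.smooth i p hp) ⟨p, hp, rfl⟩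
  have hext : ContinuousOn (fun p => extDeriv (pulledBoundaryForm D i (T.param i)) p
      (fun j => Pi.single j 1)) (stdCell 3) := fun p hp =>
    (contDiffAt_alternating_apply (contDiffAt_of_family (t := 0)
      (H := fun _ => extDeriv (pulledBoundaryForm D i (T.param i)))
      (contDiffAt_extDeriv_family (η := fun _ => pulledBoundaryForm D i (T.param i))
        (ContDiffAt.comp (0, p) (hη p hp) contDiffAt_snd)))
      (fun j => Pi.single j 1)).continuousAt.continuousWithinAt
  have hint2 := (continuousOn_wedge12 D i (fun j => Pi.single j 1)).integrableOn_compact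
    isCompact_stdCell (μ := volume)
  -- Written as an exact form plus the second term, the first term needs no integrability argument
  -- of its own.
  have hsum : ∀ p ∈ stdCell 3, pullValues (T.param i)
      (wedge21 pairSo (D.B i 0) (variation (D.A i))) p (fun j => Pi.single j 1)
      = extDeriv (pulledBoundaryForm D i (T.param i)) p (fun j => Pi.single j 1)
        + pullValues (T.param i) (wedge12 (fun v w : R4 => v ⬝ᵥ w) (D.C i 0)
          (variation (D.Sig i))) p (fun j => Pi.single j 1) := by
    intro p hp
    rw [extDeriv_pulledBoundaryForm D (T.smooth i p hp) ⟨p, hp, rfl⟩]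
    ring
  rw [integrate, integrate, setIntegral_congr_fun measurableSet_stdCell hsum,
    integral_add (hext.integrableOn_compact isCompact_stdCell) hint2, add_sub_cancel_right,
    stokes_stdCell fun p hp => (hη p hp).of_le (by simp), Triangulation.boundaryIntegral]
  refine Finset.sum_congr rfl fun j _ => ?_
  congr 1
  refine setIntegral_congr_fun measurableSet_stdCell fun s hs => ?_
  have hs' : face j s ∈ stdCell 3 := face_mem j hs
  have h := pullValues_comp (T.smooth i _ hs') (hasFDerivAt_affineSimplex _ s) (D.boundaryForm i)
    (fun k => Pi.single k 1)
  refine Eq.trans ?_ h.symm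
  exact (pullValues_boundaryForm D (T.smooth i _ hs') ⟨_, hs', rfl⟩ _).symm

theorem potential_eq_boundary [Fintype Cell] :
    D.potential = ∑ i, T.boundaryIntegral i (D.boundaryForm i) :=
  Finset.sum_congr rfl fun i _ => cell_potential_eq D i

end Cell

section Links

variable {M : Type*} [TopologicalSpace M] [ChartedSpace (EuclideanSpace ℝ (Fin 3)) M]
  {Cell Link : Type*} {T : Triangulation M Cell Link}

/-! ### The triangle of a link -/

theorem contMDiffAt_triangle (T : Triangulation M Cell Link) (l : Link) {s : Fin 2 → ℝ}
    (hs : s ∈ stdCell 2) : ContMDiffAt 𝓘(ℝ, Fin 2 → ℝ) (𝓡 3) ∞ (T.triangle l) s :=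
  contMDiffAt_param_comp T _ (fun _ => stdVertex_mem _) hs

theorem triangle_mem_source (T : Triangulation M Cell Link) (l : Link) {s : Fin 2 → ℝ}
    (hs : s ∈ stdCell 2) : T.triangle l s ∈ T.cellSet (T.source l).1 :=
  param_comp_mem T _ (fun _ => stdVertex_mem _) hs

theorem triangle_mem_target (T : Triangulation M Cell Link) (l : Link) {s : Fin 2 → ℝ}
    (hs : s ∈ stdCell 2) : T.triangle l s ∈ T.cellSet (T.target l).1 := by
  have h := T.glue_eq l hs
  rw [Triangulation.triangle, h]
  exact param_comp_mem T _ (fun _ => stdVertex_mem _) hs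

theorem zero_mem_stdCell {k : ℕ} : (0 : Fin k → ℝ) ∈ stdCell k := stdVertex_mem 0

variable (D : OnShellData T)

/-! ### Solution of the continuity equations -/

/-- The triangle is convex, and its unique differentiability makes the derivative within it the full
derivative. -/
theorem eq_of_fderiv_eq_zero {V : Type*} [NormedAddCommGroup V] [NormedSpace ℝ V]
    {f : (Fin 2 → ℝ) → V} (hf : ∀ s ∈ stdCell 2, DifferentiableAt ℝ f s)
    (h0 : ∀ s ∈ stdCell 2, ∀ e, fderiv ℝ f s e = 0) {s : Fin 2 → ℝ} (hs : s ∈ stdCell 2) :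
    f s = f 0 := by
  refine convex_stdCell.is_const_of_fderivWithin_eq_zero (𝕜 := ℝ)
    (fun s hs => (hf s hs).differentiableWithinAt) (fun s hs => ?_) hs zero_mem_stdCell
  rw [(hf s hs).fderivWithin (uniqueDiffOn_stdCell s hs)]
  exact ContinuousLinearMap.ext (h0 s hs)

theorem differentiableAt_pulledG {F : Type*} [NormedAddCommGroup F] [NormedSpace ℝ F]
    {i : Cell} {f : F → M} {p : F} (hf : ContMDiffAt 𝓘(ℝ, F) (𝓡 3) ∞ f p)
    (hp : f p ∈ T.cellSet i) (t : ℝ) :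
    DifferentiableAt ℝ (fun y => (pulledG D i f t y : Mat4)) p :=
  (contDiffAt_of_family (H := fun t y => (pulledG D i f t y : Mat4))
    (contDiffAt_g D hf hp t)).differentiableAt (by simp)

/-- The derivative of g_c g_{c'}⁻¹ is g_c (A_c - A_{c'}) g_{c'}⁻¹, and the two connections agree
along the triangle. -/
theorem rotation_quotient_const (hD : D.Continuity) (l : Link) (t : ℝ) {s : Fin 2 → ℝ}
    (hs : s ∈ stdCell 2) :
    D.g (T.source l).1 t (T.triangle l s) * (D.g (T.target l).1 t (T.triangle l s))⁻¹
      = D.g (T.source l).1 t (T.triangle l 0) * (D.g (T.target l).1 t (T.triangle l 0))⁻¹ := by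
  refine Subtype.ext ?_
  refine eq_of_fderiv_eq_zero (f := fun y => (pulledG D (T.source l).1 (T.triangle l) t y : Mat4)
    * (pulledG D (T.target l).1 (T.triangle l) t y : Mat4)ᵀ) (fun s hs => ?_) (fun s hs e => ?_) hs
  all_goals
    have hf := contMDiffAt_triangle T l hs
    have h1 := differentiableAt_pulledG D hf (triangle_mem_source T l hs) t
    have h2 := differentiableAt_pulledG D hf (triangle_mem_target T l hs) t
    have h2T := (hasFDerivAt_transpose h2).differentiableAt
  · exact ((isBilinearMap_mul.toContinuousBilinearMap.hasFDerivAt.comp s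
      h1.hasFDerivAt).clm_apply h2T.hasFDerivAt).differentiableAt
  · have hA := (hD l t).1 s hs ![e]
    rw [pullValues_A D hf (triangle_mem_source T l hs),
      pullValues_A D hf (triangle_mem_target T l hs)] at hA
    simp only [Matrix.cons_val_zero] at hA
    have h3 := fderiv_rotation (f := pulledG D (T.target l).1 (T.triangle l) t) h2 e
    rw [fderiv_bilin isBilinearMap_mul h1 h2T, fderiv_transpose h2]
    have h4 := mul_transpose_SO4 (pulledG D (T.source l).1 (T.triangle l) t s)
    have h5 := mul_transpose_SO4 (pulledG D (T.target l).1 (T.triangle l) t s)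
    generalize (pulledG D (T.source l).1 (T.triangle l) t s : Mat4) = A at *
    generalize (pulledG D (T.target l).1 (T.triangle l) t s : Mat4) = B at *
    generalize fderiv ℝ (fun y => (pulledG D (T.source l).1 (T.triangle l) t y : Mat4)) s e = A' at *
    generalize fderiv ℝ (fun y => (pulledG D (T.target l).1 (T.triangle l) t y : Mat4)) s e = B' at *
    calc A' * Bᵀ + A * B'ᵀ = A * Aᵀ * A' * Bᵀ + A * B'ᵀ * (B * Bᵀ) := by
          rw [h4, h5, Matrix.one_mul, Matrix.mul_one]
      _ = A * (B'ᵀ * B + Aᵀ * A') * Bᵀ := by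
          simp only [Matrix.mul_add, Matrix.add_mul, Matrix.mul_assoc]
          abel
      _ = 0 := by rw [hA, h3, Matrix.mul_zero, Matrix.zero_mul]

/-- With g_c = h g_{c'}, agreement of g_c⁻¹ dc_c and g_{c'}⁻¹ dc_{c'} means dc_c = h dc_{c'} along
the triangle. -/
theorem translation_difference_const (hD : D.Continuity) (l : Link) (t : ℝ) (h : SO4)
    (hh : ∀ s ∈ stdCell 2, D.g (T.source l).1 t (T.triangle l s)
      = h * D.g (T.target l).1 t (T.triangle l s)) {s : Fin 2 → ℝ} (hs : s ∈ stdCell 2) :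
    (h : Mat4) *ᵥ D.c (T.target l).1 t (T.triangle l s) - D.c (T.source l).1 t (T.triangle l s)
      = (h : Mat4) *ᵥ D.c (T.target l).1 t (T.triangle l 0)
        - D.c (T.source l).1 t (T.triangle l 0) := by
  have hd : ∀ s ∈ stdCell 2, DifferentiableAt ℝ (pulledC D (T.source l).1 (T.triangle l) t) s ∧
      DifferentiableAt ℝ (pulledC D (T.target l).1 (T.triangle l) t) s := fun s hs =>
    ⟨(contDiffAt_pulledC D (contMDiffAt_triangle T l hs)
        (triangle_mem_source T l hs) t).differentiableAt (by simp),
      (contDiffAt_pulledC D (contMDiffAt_triangle T l hs)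
        (triangle_mem_target T l hs) t).differentiableAt (by simp)⟩
  let L : R4 →L[ℝ] R4 := isBilinearMap_mulVec.toContinuousBilinearMap (h : Mat4)
  have hder : ∀ s ∈ stdCell 2, HasFDerivAt
      (fun y => L (pulledC D (T.target l).1 (T.triangle l) t y)
        - pulledC D (T.source l).1 (T.triangle l) t y)
      (L.comp (fderiv ℝ (pulledC D (T.target l).1 (T.triangle l) t) s)
        - fderiv ℝ (pulledC D (T.source l).1 (T.triangle l) t) s) s := fun s hs =>
    (L.hasFDerivAt.comp s (hd s hs).2.hasFDerivAt).sub (hd s hs).1.hasFDerivAt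
  refine eq_of_fderiv_eq_zero (f := fun y => L (pulledC D (T.target l).1 (T.triangle l) t y)
    - pulledC D (T.source l).1 (T.triangle l) t y) (fun s hs => (hder s hs).differentiableAt)
    (fun s hs e => ?_) hs
  rw [(hder s hs).fderiv]
  have hf := contMDiffAt_triangle T l hs
  have hC := (hD l t).2.2.1 s hs ![e]
  rw [pullValues_C D hf (triangle_mem_source T l hs),
    pullValues_C D hf (triangle_mem_target T l hs)] at hC
  simp only [Matrix.cons_val_zero] at hC
  have hg : (pulledG D (T.source l).1 (T.triangle l) t s : Mat4)
      = (h : Mat4) * (pulledG D (T.target l).1 (T.triangle l) t s : Mat4) :=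
    congrArg Subtype.val (hh s hs)
  have h1 := congrArg (fun z => (pulledG D (T.source l).1 (T.triangle l) t s : Mat4) *ᵥ z) hC
  simp only [mulVec_mulVec] at h1
  rw [mul_transpose_SO4, one_mulVec, hg, Matrix.mul_assoc, mul_transpose_SO4, Matrix.mul_one] at h1
  exact sub_eq_zero.2 h1.symm

/-- The equations at a single vertex already determine the constants. The explicit formula also
supplies their existence and their smoothness in the parameter. -/
theorem continuitySolution_unique {h : Link → ℝ → SO4} {x : Link → ℝ → R4}
    (hs : D.IsContinuitySolution h x) (l : Link) (t : ℝ) :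
    h l t = D.g (T.source l).1 t (T.triangle l 0) * (D.g (T.target l).1 t (T.triangle l 0))⁻¹ ∧
    x l t = (h l t : Mat4) *ᵥ D.c (T.target l).1 t (T.triangle l 0)
      - D.c (T.source l).1 t (T.triangle l 0) := by
  obtain ⟨h1, h2⟩ := hs l t 0 zero_mem_stdCell
  refine ⟨by rw [h1, mul_inv_cancel_right], ?_⟩
  rw [h2, coe_inv_SO4, mulVec_mulVec, mul_transpose_SO4, one_mulVec, add_sub_cancel_left]

theorem existsUnique_continuitySolution (hD : D.Continuity) :
    ∃! d : (Link → ℝ → SO4) × (Link → ℝ → R4), D.IsContinuitySolution d.1 d.2 := by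
  let h : Link → ℝ → SO4 := fun l t =>
    D.g (T.source l).1 t (T.triangle l 0) * (D.g (T.target l).1 t (T.triangle l 0))⁻¹
  let x : Link → ℝ → R4 := fun l t => (h l t : Mat4) *ᵥ D.c (T.target l).1 t (T.triangle l 0)
      - D.c (T.source l).1 t (T.triangle l 0)
  have hh : ∀ l t, ∀ s ∈ stdCell 2, D.g (T.source l).1 t (T.triangle l s)
      = h l t * D.g (T.target l).1 t (T.triangle l s) := fun l t s hs => by
    rw [← mul_inv_eq_iff_eq_mul]
    exact rotation_quotient_const D hD l t hs
  refine ⟨(h, x), fun l t s hs => ⟨hh l t s hs, ?_⟩, ?_⟩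
  · have h1 := translation_difference_const D hD l t (h l t) (hh l t) hs
    have h2 : x l t = _ := h1.symm
    simp only [h2]
    rw [add_sub_cancel, coe_inv_SO4, mulVec_mulVec, transpose_mul_SO4, one_mulVec]
  · rintro ⟨h', x'⟩ hs
    have e1 : h' = h := by
      funext l t
      exact (continuitySolution_unique D hs l t).1
    subst e1
    have e2 : x' = x := by
      funext l t
      exact (continuitySolution_unique D hs l t).2
    rw [e2]

variable {h : Link → ℝ → SO4} {x : Link → ℝ → R4}

theorem contDiff_continuitySolution (hs : D.IsContinuitySolution h x) (l : Link) :
    ContDiff ℝ ∞ (fun t => (h l t : Mat4)) ∧ ContDiff ℝ ∞ (x l) := by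
  have hf := contMDiffAt_triangle T l zero_mem_stdCell
  have hg1 : ∀ t, ContDiffAt ℝ ∞ (fun t => (D.g (T.source l).1 t (T.triangle l 0) : Mat4)) t :=
    fun t => contDiffAt_param_of_family
      (H := fun t y => (D.g (T.source l).1 t (T.triangle l y) : Mat4))
      (contDiffAt_g D hf (triangle_mem_source T l zero_mem_stdCell) t)
  have hg2 : ∀ t, ContDiffAt ℝ ∞ (fun t => (D.g (T.target l).1 t (T.triangle l 0) : Mat4)) t :=
    fun t => contDiffAt_param_of_family
      (H := fun t y => (D.g (T.target l).1 t (T.triangle l y) : Mat4))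
      (contDiffAt_g D hf (triangle_mem_target T l zero_mem_stdCell) t)
  have hc1 : ∀ t, ContDiffAt ℝ ∞ (fun t => D.c (T.source l).1 t (T.triangle l 0)) t :=
    fun t => contDiffAt_param_of_family (H := fun t y => D.c (T.source l).1 t (T.triangle l y))
      (contDiffAt_c D hf (triangle_mem_source T l zero_mem_stdCell) t)
  have hc2 : ∀ t, ContDiffAt ℝ ∞ (fun t => D.c (T.target l).1 t (T.triangle l 0)) t :=
    fun t => contDiffAt_param_of_family (H := fun t y => D.c (T.target l).1 t (T.triangle l y))
      (contDiffAt_c D hf (triangle_mem_target T l zero_mem_stdCell) t)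
  have h1 : ContDiff ℝ ∞ (fun t => (h l t : Mat4)) := by
    have he : (fun t => (h l t : Mat4)) = fun t =>
        (D.g (T.source l).1 t (T.triangle l 0) : Mat4)
          * (D.g (T.target l).1 t (T.triangle l 0) : Mat4)ᵀ :=
      funext fun t => congrArg Subtype.val (continuitySolution_unique D hs l t).1
    rw [he]
    exact contDiff_iff_contDiffAt.2 fun t =>
      contDiffAt_bilin isBilinearMap_mul (hg1 t) (contDiffAt_transpose (hg2 t))
  refine ⟨h1, ?_⟩
  have he : x l = fun t => (h l t : Mat4) *ᵥ D.c (T.target l).1 t (T.triangle l 0)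
      - D.c (T.source l).1 t (T.triangle l 0) :=
    funext fun t => (continuitySolution_unique D hs l t).2
  rw [he]
  exact contDiff_iff_contDiffAt.2 fun t =>
    (contDiffAt_bilin isBilinearMap_mulVec h1.contDiffAt (hc2 t)).sub (hc1 t)

/-! ### Transformation of dσ and db across a triangle -/

theorem mixedBracket_rotate (r : Mat4) (V y : R4) :
    mixedBracket (r *ᵥ V) (r *ᵥ y) = r * mixedBracket V y * rᵀ := by
  simp only [mixedBracket, Matrix.mul_sub, Matrix.sub_mul, mul_vecMulVec, vecMulVec_mul,
    vecMul_transpose]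

/-- In the agreement of Σ, the relation g_c = h g_{c'} allows g_{c'} to be cancelled. -/
theorem dσ_target (hD : D.Continuity) (hs : D.IsContinuitySolution h x) (l : Link) (t : ℝ) :
    T.AgreeOn l (D.dσ (T.target l).1 t)
      (fun y u => ((h l t)⁻¹ : SO4).1 *ᵥ D.dσ (T.source l).1 t y u) := by
  intro s hs2 w
  have hg := (hs l t s hs2).1
  have hS : ((D.g (T.source l).1 t (T.triangle l s))⁻¹ : SO4).1 *ᵥ
      pullValues (T.triangle l) (D.dσ (T.source l).1 t) s w
      = ((D.g (T.target l).1 t (T.triangle l s))⁻¹ : SO4).1 *ᵥ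
      pullValues (T.triangle l) (D.dσ (T.target l).1 t) s w := (hD l t).2.2.2 s hs2 w
  change pullValues (T.triangle l) (D.dσ (T.target l).1 t) s w
    = ((h l t)⁻¹ : SO4).1 *ᵥ pullValues (T.triangle l) (D.dσ (T.source l).1 t) s w
  have h1 := congrArg (fun z => (D.g (T.target l).1 t (T.triangle l s) : Mat4) *ᵥ z) hS
  simp only [mulVec_mulVec] at h1
  rw [hg] at h1
  simp only [coe_inv_SO4, Submonoid.coe_mul, transpose_mul] at h1 ⊢
  rw [← Matrix.mul_assoc, mul_transpose_SO4, Matrix.one_mul, one_mulVec] at h1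
  exact h1.symm

/-- The curvature `db + [dσ, c]` of the target is the rotated one of the source. -/
theorem curvature_target (hD : D.Continuity) (hs : D.IsContinuitySolution h x) (l : Link) (t : ℝ)
    {s : Fin 2 → ℝ} (hs2 : s ∈ stdCell 2) (w : Fin 2 → Fin 2 → ℝ) :
    pullValues (T.triangle l) (D.db (T.target l).1 t) s w
      + mixedBracket (pullValues (T.triangle l) (D.dσ (T.target l).1 t) s w)
        (D.c (T.target l).1 t (T.triangle l s))
      = (h l t : Mat4)ᵀ * (pullValues (T.triangle l) (D.db (T.source l).1 t) s w
      + mixedBracket (pullValues (T.triangle l) (D.dσ (T.source l).1 t) s w)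
        (D.c (T.source l).1 t (T.triangle l s))) * (h l t : Mat4) := by
  have hg : (D.g (T.source l).1 t (T.triangle l s) : Mat4)
      = (h l t : Mat4) * (D.g (T.target l).1 t (T.triangle l s) : Mat4) :=
    congrArg Subtype.val (hs l t s hs2).1
  have hB : (D.g (T.source l).1 t (T.triangle l s) : Mat4)ᵀ
      * (pullValues (T.triangle l) (D.db (T.source l).1 t) s w
        + mixedBracket (pullValues (T.triangle l) (D.dσ (T.source l).1 t) s w)
          (D.c (T.source l).1 t (T.triangle l s))) * (D.g (T.source l).1 t (T.triangle l s) : Mat4)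
      = (D.g (T.target l).1 t (T.triangle l s) : Mat4)ᵀ
      * (pullValues (T.triangle l) (D.db (T.target l).1 t) s w
        + mixedBracket (pullValues (T.triangle l) (D.dσ (T.target l).1 t) s w)
          (D.c (T.target l).1 t (T.triangle l s)))
        * (D.g (T.target l).1 t (T.triangle l s) : Mat4) := (hD l t).2.1 s hs2 w
  rw [hg] at hB
  have h1 := mul_transpose_SO4 (D.g (T.target l).1 t (T.triangle l s))
  generalize (D.g (T.target l).1 t (T.triangle l s) : Mat4) = g at *
  generalize pullValues (T.triangle l) (D.db (T.source l).1 t) s w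
        + mixedBracket (pullValues (T.triangle l) (D.dσ (T.source l).1 t) s w)
          (D.c (T.source l).1 t (T.triangle l s)) = X at *
  generalize pullValues (T.triangle l) (D.db (T.target l).1 t) s w
        + mixedBracket (pullValues (T.triangle l) (D.dσ (T.target l).1 t) s w)
          (D.c (T.target l).1 t (T.triangle l s)) = Y at *
  calc Y = (g * gᵀ) * Y * (g * gᵀ) := by rw [h1, Matrix.one_mul, Matrix.mul_one]
    _ = g * (gᵀ * Y * g) * gᵀ := by simp only [Matrix.mul_assoc]
    _ = (g * gᵀ) * ((h l t : Mat4)ᵀ * X * (h l t : Mat4)) * (g * gᵀ) := by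
        rw [← hB]; simp only [transpose_mul, Matrix.mul_assoc]
    _ = (h l t : Mat4)ᵀ * X * (h l t : Mat4) := by rw [h1, Matrix.one_mul, Matrix.mul_one]

/-- By equivariance, the bracket of the target is the rotated [dσ_c, c_c + x]. Subtracting it from
the rotated curvature cancels c_c and leaves -[dσ_c, x]. -/
theorem db_target (hD : D.Continuity) (hs : D.IsContinuitySolution h x) (l : Link) (t : ℝ) :
    T.AgreeOn l (D.db (T.target l).1 t)
      (fun y u => ((h l t)⁻¹ : SO4).1 * (D.db (T.source l).1 t y u
        - mixedBracket (D.dσ (T.source l).1 t y u) (x l t)) * (h l t).1) := by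
  intro s hs2 w
  have h1 := curvature_target D hD hs l t hs2 w
  have h2 : pullValues (T.triangle l) (D.dσ (T.target l).1 t) s w
    = (h l t : Mat4)ᵀ *ᵥ pullValues (T.triangle l) (D.dσ (T.source l).1 t) s w :=
    dσ_target D hD hs l t s hs2 w
  have h3 : D.c (T.target l).1 t (T.triangle l s)
      = (h l t : Mat4)ᵀ *ᵥ (D.c (T.source l).1 t (T.triangle l s) + x l t) := (hs l t s hs2).2
  rw [h2, h3, mixedBracket_rotate, transpose_transpose, ← eq_sub_iff_add_eq] at h1
  change pullValues (T.triangle l) (D.db (T.target l).1 t) s w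
    = (h l t : Mat4)ᵀ * (pullValues (T.triangle l) (D.db (T.source l).1 t) s w
      - mixedBracket (pullValues (T.triangle l) (D.dσ (T.source l).1 t) s w) (x l t)) * (h l t).1
  rw [h1, isBilinearMap_mixedBracket.add_right]
  simp only [Matrix.mul_add, Matrix.add_mul, Matrix.mul_sub, Matrix.sub_mul]
  abel

end Links

/-! ### One triangle with two parametrizations, and the integrals over it -/

section LinkIntegrals

variable {M : Type*} [TopologicalSpace M] [ChartedSpace (EuclideanSpace ℝ (Fin 3)) M]

/-- The two parametrizations need agree on the closed triangle only. Unique differentiability forces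
equal derivatives, also on its edges. -/
theorem mfderiv_eq_of_eqOn {f f' : (Fin 2 → ℝ) → M} (he : EqOn f f' (stdCell 2)) {s : Fin 2 → ℝ}
    (hs : s ∈ stdCell 2) (hf : ContMDiffAt 𝓘(ℝ, Fin 2 → ℝ) (𝓡 3) ∞ f s)
    (hf' : ContMDiffAt 𝓘(ℝ, Fin 2 → ℝ) (𝓡 3) ∞ f' s) (w : Fin 2 → ℝ) :
    (mfderiv 𝓘(ℝ, Fin 2 → ℝ) (𝓡 3) f s w : EuclideanSpace ℝ (Fin 3))
      = mfderiv 𝓘(ℝ, Fin 2 → ℝ) (𝓡 3) f' s w := by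
  have hu : UniqueMDiffWithinAt 𝓘(ℝ, Fin 2 → ℝ) (stdCell 2) s :=
    (uniqueDiffOn_stdCell s hs).uniqueMDiffWithinAt
  have h1 := mfderivWithin_eq_mfderiv hu (hf.mdifferentiableAt (by simp))
  have h2 := mfderivWithin_eq_mfderiv hu (hf'.mdifferentiableAt (by simp))
  have h3 := mfderivWithin_congr (I := 𝓘(ℝ, Fin 2 → ℝ)) (I' := 𝓡 3) he (he hs)
  rw [h1] at h3
  have h4 := DFunLike.congr_fun h3 w
  refine h4.trans ?_
  exact DFunLike.congr_fun h2 w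

theorem pullValues_eq_of_eqOn {V : Type*} {k : ℕ} {f f' : (Fin 2 → ℝ) → M}
    (he : EqOn f f' (stdCell 2)) {s : Fin 2 → ℝ}
    (hs : s ∈ stdCell 2) (hf : ContMDiffAt 𝓘(ℝ, Fin 2 → ℝ) (𝓡 3) ∞ f s)
    (hf' : ContMDiffAt 𝓘(ℝ, Fin 2 → ℝ) (𝓡 3) ∞ f' s) (η : FormValues M k V)
    (w : Fin k → Fin 2 → ℝ) : pullValues f η s w = pullValues f' η s w := by
  have key : ∀ (a b : M) (hab : a = b) (u v : Fin k → EuclideanSpace ℝ (Fin 3)), u = v →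
      η a u = η b v := by
    rintro a _ rfl u _ rfl
    rfl
  exact key _ _ (he hs) _ _ (funext fun j => mfderiv_eq_of_eqOn he hs hf hf' (w j))

variable [IsManifold (𝓡 3) ∞ M] {Cell Link : Type*} {T : Triangulation M Cell Link}
  (D : OnShellData T)

/-! ### The variables of a link -/

theorem extDeriv_skew {E : Type*} [NormedAddCommGroup E] [NormedSpace ℝ E] {k : ℕ}
    {η : E → E [⋀^Fin k]→L[ℝ] Mat4} {p : E} (hη : DifferentiableAt ℝ η p)
    (hs : ∀ y v, (η y v)ᵀ = -η y v) (v : Fin (k + 1) → E) :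
    (extDeriv η p v)ᵀ = -extDeriv η p v := by
  rw [extDeriv_apply hη, transpose_sum, ← Finset.sum_neg_distrib]
  refine Finset.sum_congr rfl fun i _ => ?_
  have h1 := fderiv_transpose (differentiableAt_alternating_apply hη (i.removeNth v)) (v i)
  simp only [hs] at h1
  rw [transpose_smul, ← h1, fderiv_fun_neg, _root_.neg_apply, smul_neg]

theorem triangleIntegral_db (l : Link) (t : ℝ) :
    T.triangleIntegral l (D.db (T.source l).1 t) = (-1 : ℝ) ^ ((T.source l).2 : ℕ) •
      ∫ s in stdCell 2, pulledDb D (T.source l).1 (T.triangle l) t s (fun j => Pi.single j 1) :=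
  congrArg _ (setIntegral_congr_fun measurableSet_stdCell fun _ hs =>
    pullValues_db D (contMDiffAt_triangle T l hs) (triangle_mem_source T l hs) t _)

theorem triangleIntegral_dσ (l : Link) (t : ℝ) :
    T.triangleIntegral l (D.dσ (T.source l).1 t) = (-1 : ℝ) ^ ((T.source l).2 : ℕ) •
      ∫ s in stdCell 2, pulledDσ D (T.source l).1 (T.triangle l) t s (fun j => Pi.single j 1) :=
  congrArg _ (setIntegral_congr_fun measurableSet_stdCell fun _ hs =>
    pullValues_dσ D (contMDiffAt_triangle T l hs) (triangle_mem_source T l hs) t _)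

theorem integrableOn_pulledDb (l : Link) (t : ℝ) :
    IntegrableOn (fun s => pulledDb D (T.source l).1 (T.triangle l) t s (fun j => Pi.single j 1))
      (stdCell 2) :=
  ContinuousOn.integrableOn_compact isCompact_stdCell fun _ hs =>
    (contDiffAt_alternating_apply (contDiffAt_pulledDb D (contMDiffAt_triangle T l hs)
      (triangle_mem_source T l hs) t) _).continuousAt.continuousWithinAt

theorem integrableOn_pulledDσ (l : Link) (t : ℝ) :
    IntegrableOn (fun s => pulledDσ D (T.source l).1 (T.triangle l) t s (fun j => Pi.single j 1))
      (stdCell 2) :=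
  ContinuousOn.integrableOn_compact isCompact_stdCell fun _ hs =>
    (contDiffAt_alternating_apply (contDiffAt_pulledDσ D (contMDiffAt_triangle T l hs)
      (triangle_mem_source T l hs) t) _).continuousAt.continuousWithinAt

theorem integrableOn_pulledδDσ (l : Link) :
    IntegrableOn (fun s => pulledδDσ D (T.source l).1 (T.triangle l) s (fun j => Pi.single j 1))
      (stdCell 2) :=
  ContinuousOn.integrableOn_compact isCompact_stdCell fun _ hs =>
    (contDiffAt_alternating_apply (contDiffAt_pulledδDσ D (contMDiffAt_triangle T l hs)
      (triangle_mem_source T l hs)) _).continuousAt.continuousWithinAt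

theorem triangleIntegral_db_skew (l : Link) (t : ℝ) :
    (T.triangleIntegral l (D.db (T.source l).1 t))ᵀ
      = -T.triangleIntegral l (D.db (T.source l).1 t) := by
  rw [triangleIntegral_db, transpose_smul, ← smul_neg, ← transposeL_apply,
    ← ContinuousLinearMap.integral_comp_comm _ (integrableOn_pulledDb D l t), ← integral_neg]
  congr 1
  refine setIntegral_congr_fun measurableSet_stdCell fun s hs => ?_
  refine extDeriv_skew ?_ (fun y v => ?_) _
  · exact (contDiffAt_of_family (H := fun t => pullback (T.triangle l) (D.b (T.source l).1 t))
      (contDiffAt_pullback (contMDiffAt_triangle T l hs)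
        (D.b_smooth _ t _ (triangle_mem_source T l hs)))).differentiableAt (by simp)
  · exact D.b_skew _ _ _ _

theorem differentiableAt_triangleIntegral_db (l : Link) (t : ℝ) :
    DifferentiableAt ℝ (fun t => T.triangleIntegral l (D.db (T.source l).1 t)) t := by
  simp only [triangleIntegral_db]
  exact (HasDerivAt.const_smul ((-1 : ℝ) ^ ((T.source l).2 : ℕ)) (hasDerivAt_integral_stdCell
    (H := fun t s => pulledDb D (T.source l).1 (T.triangle l) t s (fun j => Pi.single j 1))
    (fun t s hs => contDiffAt_alternating_apply (contDiffAt_db D (contMDiffAt_triangle T l hs)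
      (triangle_mem_source T l hs) t) _) t)).differentiableAt

theorem hasDerivAt_triangleIntegral_dσ (l : Link) (t : ℝ) :
    HasDerivAt (fun t => T.triangleIntegral l (D.dσ (T.source l).1 t))
      ((-1 : ℝ) ^ ((T.source l).2 : ℕ) • ∫ s in stdCell 2, deriv (fun t =>
        pulledDσ D (T.source l).1 (T.triangle l) t s (fun j => Pi.single j 1)) t) t := by
  simp only [triangleIntegral_dσ]
  exact HasDerivAt.const_smul ((-1 : ℝ) ^ ((T.source l).2 : ℕ)) (hasDerivAt_integral_stdCell
    (H := fun t s => pulledDσ D (T.source l).1 (T.triangle l) t s (fun j => Pi.single j 1))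
    (fun t s hs => contDiffAt_alternating_apply (contDiffAt_dσ D (contMDiffAt_triangle T l hs)
      (triangle_mem_source T l hs) t) _) t)

theorem deriv_triangleIntegral_dσ (l : Link) :
    deriv (fun t => T.triangleIntegral l (D.dσ (T.source l).1 t)) 0
      = (-1 : ℝ) ^ ((T.source l).2 : ℕ) • ∫ s in stdCell 2,
        pulledδDσ D (T.source l).1 (T.triangle l) s (fun j => Pi.single j 1) := by
  refine (hasDerivAt_triangleIntegral_dσ D l 0).deriv.trans (congrArg _ ?_)
  exact setIntegral_congr_fun measurableSet_stdCell fun s hs =>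
    (hasDerivAt_pulledDσ D (contMDiffAt_triangle T l hs) (triangle_mem_source T l hs) _).deriv

variable {h : Link → ℝ → SO4} {x : Link → ℝ → R4}

theorem linkVars_mem (h : Link → ℝ → SO4) (x : Link → ℝ → R4) (l : Link) (t : ℝ) :
    linkVars D h x l t ∈ linkPhaseSpace :=
  ⟨(h l t).2, triangleIntegral_db_skew D l t⟩

theorem hasDerivAt_linkVars (hs : D.IsContinuitySolution h x) (l : Link) (t : ℝ) :
    HasDerivAt (linkVars D h x l) (deriv (fun t => (h l t : Mat4)) t, deriv (x l) t,
      deriv (fun t => T.triangleIntegral l (D.db (T.source l).1 t)) t,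
      deriv (fun t => T.triangleIntegral l (D.dσ (T.source l).1 t)) t) t := by
  obtain ⟨h1, h2⟩ := contDiff_continuitySolution D hs l
  exact ((h1.differentiable (by simp)) t).hasDerivAt.prodMk
    (((h2.differentiable (by simp)) t).hasDerivAt.prodMk
      ((differentiableAt_triangleIntegral_db D l t).hasDerivAt.prodMk
        (hasDerivAt_triangleIntegral_dσ D l t).differentiableAt.hasDerivAt))

/-! ### The two sides of a triangle -/

/-- The integral over the triangle of a link, seen as a face of its target tetrahedron. -/
theorem integrate_triangle_target (l : Link) :
    integrate (T.triangle l) (D.boundaryForm (T.target l).1)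
      = ((Equiv.Perm.sign (T.glue l) : ℤ) : ℝ)
        * integrate (T.param (T.target l).1 ∘ face (T.target l).2)
          (D.boundaryForm (T.target l).1) := by
  let Q := T.param (T.target l).1 ∘ face (T.target l).2
  let τ := affineSimplex (stdVertex 2 ∘ T.glue l)
  -- The gluing map factors as the target face after a permutation of the vertices of the standard
  -- triangle.
  have hcomp : T.param (T.target l).1
      ∘ affineSimplex (stdVertex 3 ∘ (T.target l).2.succAbove ∘ T.glue l) = Q ∘ τ := by
    have h := affineSimplex_comp (stdVertex 3 ∘ (T.target l).2.succAbove)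
      (stdVertex 2 ∘ T.glue l)
    have h2 : affineSimplex (stdVertex 3 ∘ (T.target l).2.succAbove) ∘ stdVertex 2 ∘ T.glue l
        = stdVertex 3 ∘ (T.target l).2.succAbove ∘ T.glue l := by
      funext j
      simp [affineSimplex_stdVertex]
    rw [h2] at h
    rw [← h]
    rfl
  have hτ : ∀ s ∈ stdCell 2, τ s ∈ stdCell 2 := fun s hs =>
    affineSimplex_mem convex_stdCell (fun _ => stdVertex_mem _) hs
  have hQ : ∀ s ∈ stdCell 2, ContMDiffAt 𝓘(ℝ, Fin 2 → ℝ) (𝓡 3) ∞ Q s := fun s hs =>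
    contMDiffAt_param_comp T _ (fun _ => stdVertex_mem _) hs
  have hQm : ∀ s ∈ stdCell 2, Q s ∈ T.cellSet (T.target l).1 := fun s hs =>
    param_comp_mem T _ (fun _ => stdVertex_mem _) hs
  have hval : ∀ s ∈ stdCell 2, pullValues (T.triangle l) (D.boundaryForm (T.target l).1) s
      (fun j => Pi.single j 1) = ((Equiv.Perm.sign (T.glue l) : ℤ) : ℝ)
        * pullValues Q (D.boundaryForm (T.target l).1) (τ s) (fun j => Pi.single j 1) := by
    intro s hs
    have he : EqOn (T.triangle l) (Q ∘ τ) (stdCell 2) := by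
      rw [← hcomp]
      exact T.glue_eq l
    have hf' : ContMDiffAt 𝓘(ℝ, Fin 2 → ℝ) (𝓡 3) ∞ (Q ∘ τ) s :=
      ContMDiffAt.comp s (hQ _ (hτ s hs)) (contDiff_affineSimplex _).contDiffAt.contMDiffAt
    rw [pullValues_eq_of_eqOn he hs (contMDiffAt_triangle T l hs) hf',
      pullValues_comp (hQ _ (hτ s hs)) (hasFDerivAt_affineSimplex _ s),
      pullValues_boundaryForm D (hQ _ (hτ s hs)) (hQm _ (hτ s hs)),
      pullValues_boundaryForm D (hQ _ (hτ s hs)) (hQm _ (hτ s hs)), alternating_perm]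
  -- The sign of the gluing comes from the alternating form alone; the integral is unchanged by the
  -- permutation.
  rw [integrate, setIntegral_congr_fun measurableSet_stdCell hval, integral_const_mul,
    integral_stdCell_perm (T.glue l) fun s =>
      pullValues Q (D.boundaryForm (T.target l).1) s (fun j => Pi.single j 1)]
  rfl

/-- The sum of the boundary integrals of the cells is a sum over the links. -/
theorem sum_boundaryIntegral_eq [Fintype Cell] [Fintype Link] :
    ∑ i, T.boundaryIntegral i (D.boundaryForm i)
      = ∑ l, (-1 : ℝ) ^ ((T.source l).2 : ℕ)
        * (integrate (T.triangle l) (D.boundaryForm (T.source l).1)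
          - integrate (T.triangle l) (D.boundaryForm (T.target l).1)) := by
  simp only [Triangulation.boundaryIntegral]
  rw [← Fintype.sum_prod_type' (f := fun i (j : Fin 4) => (-1 : ℝ) ^ (j : ℕ)
      * integrate (T.param i ∘ face j) (D.boundaryForm i)), ← T.faces.sum_comp,
    Fintype.sum_sum_type, ← Finset.sum_add_distrib]
  refine Finset.sum_congr rfl fun l _ => ?_
  -- The pairs of a cell and a face are the source and target sides of the links. Coherence turns
  -- the boundary sign of the target face into minus that of the source face.
  have hco : (-1 : ℝ) ^ ((T.source l).2 : ℕ) * ((Equiv.Perm.sign (T.glue l) : ℤ) : ℝ)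
      = -(-1 : ℝ) ^ ((T.target l).2 : ℕ) := by
    exact_mod_cast T.coherent l
  rw [integrate_triangle_target]
  simp only [Sum.elim_inl, Sum.elim_inr, Triangulation.triangle]
  linear_combination integrate (T.param (T.target l).1 ∘ face (T.target l).2)
    (D.boundaryForm (T.target l).1) * hco

/-- The difference of the boundary forms of the two cells that share a triangle. -/
theorem boundaryForm_source_sub_target (hD : D.Continuity) (hs : D.IsContinuitySolution h x)
    (l : Link) {s : Fin 2 → ℝ} (hs2 : s ∈ stdCell 2) (w : Fin 2 → Fin 2 → ℝ) :
    pulledBoundaryForm D (T.source l).1 (T.triangle l) s w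
      - pulledBoundaryForm D (T.target l).1 (T.triangle l) s w
      = pairSo (pulledDb D (T.source l).1 (T.triangle l) 0 s w)
          (deriv (fun t => (h l t : Mat4)) 0 * (h l 0 : Mat4)ᵀ)
        + ((deriv (fun t => (h l t : Mat4)) 0 * (h l 0 : Mat4)ᵀ) *ᵥ x l 0)
          ⬝ᵥ pulledDσ D (T.source l).1 (T.triangle l) 0 s w
        + x l 0 ⬝ᵥ pulledδDσ D (T.source l).1 (T.triangle l) s w := by
  have hf := contMDiffAt_triangle T l hs2
  have hps := triangle_mem_source T l hs2
  have hpt := triangle_mem_target T l hs2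
  have hh1 := (contDiff_continuitySolution D hs l).1
  have hh := ((hh1.differentiable (by simp)) 0).hasDerivAt
  -- `h` is regarded as a family over a dummy space variable, so that the rule for the variation of
  -- a rotated vector applies to it.
  have hhg : ContDiffAt ℝ ∞ (fun q : ℝ × ℝ => (h l q.1 : Mat4)) (0, 0) :=
    hh1.contDiffAt.comp (0, 0) contDiffAt_fst
  have hskew := skew_of_hasDerivAt hh
  have hgs := ((contDiffAt_param_of_family
    (H := fun t y => (pulledG D (T.source l).1 (T.triangle l) t y : Mat4))
    (contDiffAt_g D hf hps 0)).differentiableAt (by simp)).hasDerivAt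
  have hgt := ((contDiffAt_param_of_family
    (H := fun t y => (pulledG D (T.target l).1 (T.triangle l) t y : Mat4))
    (contDiffAt_g D hf hpt 0)).differentiableAt (by simp)).hasDerivAt
  have hg : ∀ t, (pulledG D (T.source l).1 (T.triangle l) t s : Mat4)
      = (h l t : Mat4) * (pulledG D (T.target l).1 (T.triangle l) t s : Mat4) :=
    fun t => congrArg Subtype.val (hs l t s hs2).1
  have hO := mul_transpose_SO4 (h l 0)
  have hO' := transpose_mul_SO4 (h l 0)
  have hX := curvature_target D hD hs l 0 hs2 w
  rw [pullValues_db D hf hps, pullValues_dσ D hf hps, pullValues_db D hf hpt,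
    pullValues_dσ D hf hpt] at hX
  -- The product rule for g_c = h g_{c'} gives Δg_c = Δh + h Δg_{c'} h⁻¹, solved here for Δg_{c'}.
  have hΔ : logVariation (pulledG D (T.target l).1 (T.triangle l)) s
      = (h l 0 : Mat4)ᵀ * (logVariation (pulledG D (T.source l).1 (T.triangle l)) s
        - deriv (fun t => (h l t : Mat4)) 0 * (h l 0 : Mat4)ᵀ) * (h l 0 : Mat4) := by
    have h1 := hgs.unique ((hasDerivAt_bilin isBilinearMap_mul hh hgt).congr_of_eventuallyEq
      (Eventually.of_forall hg))
    have h2 := mul_transpose_SO4 (pulledG D (T.target l).1 (T.triangle l) 0 s)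
    simp only [logVariation, h1, hg 0]
    generalize deriv (fun t => (pulledG D (T.target l).1 (T.triangle l) t s : Mat4)) 0 = G' at *
    generalize (pulledG D (T.target l).1 (T.triangle l) 0 s : Mat4) = G at *
    generalize deriv (fun t => (h l t : Mat4)) 0 = H' at *
    generalize (h l 0 : Mat4) = H at *
    have h3 : (H' * G + H * G') * (H * G)ᵀ - H' * Hᵀ = H * (G' * Gᵀ) * Hᵀ := by
      calc (H' * G + H * G') * (H * G)ᵀ - H' * Hᵀ
          = H' * (G * Gᵀ) * Hᵀ + H * (G' * Gᵀ) * Hᵀ - H' * Hᵀ := by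
            simp only [transpose_mul, Matrix.add_mul, Matrix.mul_assoc]
        _ = H * (G' * Gᵀ) * Hᵀ := by rw [h2, Matrix.mul_one]; abel
    rw [h3]
    calc G' * Gᵀ = (Hᵀ * H) * (G' * Gᵀ) * (Hᵀ * H) := by
          rw [hO', Matrix.one_mul, Matrix.mul_one]
      _ = Hᵀ * (H * (G' * Gᵀ) * Hᵀ) * H := by simp only [Matrix.mul_assoc]
  have hδ : pulledδDσ D (T.target l).1 (T.triangle l) s w
      = (h l 0 : Mat4)ᵀ *ᵥ (pulledδDσ D (T.source l).1 (T.triangle l) s w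
        - (deriv (fun t => (h l t : Mat4)) 0 * (h l 0 : Mat4)ᵀ)
          *ᵥ pulledDσ D (T.source l).1 (T.triangle l) 0 s w) := by
    have h1 := hasDerivAt_rotated (g := fun t (_ : ℝ) => h l t) hhg
      (hasDerivAt_pulledDσ D hf hps w)
    refine (hasDerivAt_pulledDσ D hf hpt w).unique (h1.congr_of_eventuallyEq
      (Eventually.of_forall fun t => ?_))
    have h2 := dσ_target D hD hs l t s hs2 w
    rw [pullValues_dσ D hf hpt] at h2
    refine h2.trans ?_
    exact congrArg (fun z => (h l t : Mat4)ᵀ *ᵥ z) (pullValues_dσ D hf hps t w)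
  have hc : pulledC D (T.target l).1 (T.triangle l) 0 s
      = (h l 0 : Mat4)ᵀ *ᵥ (pulledC D (T.source l).1 (T.triangle l) 0 s + x l 0) :=
    (hs l 0 s hs2).2
  have hX' : pulledDb D (T.target l).1 (T.triangle l) 0 s w
      + mixedBracket (pulledDσ D (T.target l).1 (T.triangle l) 0 s w)
        (pulledC D (T.target l).1 (T.triangle l) 0 s)
      = (h l 0 : Mat4)ᵀ * (pulledDb D (T.source l).1 (T.triangle l) 0 s w
        + mixedBracket (pulledDσ D (T.source l).1 (T.triangle l) 0 s w)
          (pulledC D (T.source l).1 (T.triangle l) 0 s)) * (h l 0 : Mat4) := hX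
  rw [pulledBoundaryForm, pulledBoundaryForm, boundaryFormOf_apply, boundaryFormOf_apply, hX', hΔ,
    hδ, hc, pairSo_conj hO, dotProduct_transpose_mulVec hO, pairSo_sub_right]
  -- The terms with Δg of the source cancel. Skewness of Δh cancels ⟨[dσ, c], Δh⟩ against the
  -- pairing of c with Δh dσ, so that only x survives.
  rw [pairSo_add_left _ _ (deriv (fun t => (h l t : Mat4)) 0 * (h l 0 : Mat4)ᵀ),
    pairSo_mixedBracket _ _ _ hskew, mulVec_dotProduct_skew hskew, dotProduct_neg,
    dotProduct_comm _ ((deriv (fun t => (h l t : Mat4)) 0 * (h l 0 : Mat4)ᵀ)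
      *ᵥ pulledC D (T.source l).1 (T.triangle l) 0 s), mulVec_dotProduct_skew hskew,
    dotProduct_sub, add_dotProduct, add_dotProduct]
  ring

/-- The contribution of a link to the potential. -/
theorem link_contribution (hD : D.Continuity) (hs : D.IsContinuitySolution h x) (l : Link) :
    (-1 : ℝ) ^ ((T.source l).2 : ℕ)
        * (integrate (T.triangle l) (D.boundaryForm (T.source l).1)
          - integrate (T.triangle l) (D.boundaryForm (T.target l).1))
      = bfcgLinkPotential (linkVars D h x l 0) (deriv (linkVars D h x l) 0) := by
  have hint : ∀ i : Cell, (∀ s ∈ stdCell 2, T.triangle l s ∈ T.cellSet i) →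
      IntegrableOn (fun s => pullValues (T.triangle l) (D.boundaryForm i) s
        (fun j => Pi.single j 1)) (stdCell 2) := by
    intro i hi
    refine ContinuousOn.integrableOn_compact isCompact_stdCell ?_
    refine ContinuousOn.congr (f := fun s => pulledBoundaryForm D i (T.triangle l) s
      (fun j => Pi.single j 1)) (fun s hs => ?_) fun s hs =>
        pullValues_boundaryForm D (contMDiffAt_triangle T l hs) (hi s hs) _
    exact (contDiffAt_alternating_apply (contDiffAt_pulledBoundaryForm D
      (contMDiffAt_triangle T l hs) (hi s hs)) _).continuousAt.continuousWithinAt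
  have hval : ∀ s ∈ stdCell 2, _ := fun s hs2 =>
    (congrArg₂ (· - ·)
      (pullValues_boundaryForm D (contMDiffAt_triangle T l hs2) (triangle_mem_source T l hs2)
        (fun j => Pi.single j 1))
      (pullValues_boundaryForm D (contMDiffAt_triangle T l hs2) (triangle_mem_target T l hs2)
        (fun j => Pi.single j 1))).trans
      (boundaryForm_source_sub_target D hD hs l hs2 (fun j => Pi.single j 1))
  rw [integrate, integrate, ← integral_sub (hint _ fun s hs2 => triangle_mem_source T l hs2)
    (hint _ fun s hs2 => triangle_mem_target T l hs2),
    setIntegral_congr_fun measurableSet_stdCell hval, (hasDerivAt_linkVars D hs l 0).deriv,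
    bfcgLinkPotential]
  simp only [linkVars]
  rw [deriv_triangleIntegral_dσ]
  simp only [triangleIntegral_db, triangleIntegral_dσ]
  generalize deriv (fun t => (h l t : Mat4)) 0 * (h l 0 : Mat4)ᵀ = Δh
  have i1 := integrableOn_pulledDb D l 0
  have i2 := integrableOn_pulledDσ D l 0
  have i3 := integrableOn_pulledδDσ D l
  -- Since `Δh` and `x l 0` do not depend on the point of the triangle, the pairings with them are
  -- fixed continuous linear maps and commute with the integral.
  let L1 := isBilinearMap_pairSo.toContinuousBilinearMap.flip Δh
  let L2 := isBilinearMap_dotProduct.toContinuousBilinearMap (Δh *ᵥ x l 0)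
  let L3 := isBilinearMap_dotProduct.toContinuousBilinearMap (x l 0)
  have e1 := L1.integral_comp_comm i1
  have e2 := L2.integral_comp_comm i2
  have e3 := L3.integral_comp_comm i3
  rw [pairSo_smul_left, dotProduct_smul, dotProduct_smul]
  have j1 := L1.integrable_comp i1
  have j2 := L2.integrable_comp i2
  have j3 := L3.integrable_comp i3
  have e4 := (integral_add (j1.add j2) j3).trans
    (congrArg₂ (· + ·) ((integral_add j1 j2).trans (congrArg₂ (· + ·) e1 e2)) e3)
  refine (congrArg _ e4).trans ?_
  rw [mul_add, mul_add]
  rfl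

theorem potential_eq_sum_links [Fintype Cell] [Fintype Link] (hD : D.Continuity)
    (hs : D.IsContinuitySolution h x) :
    D.potential = ∑ l, bfcgLinkPotential (linkVars D h x l 0) (deriv (linkVars D h x l) 0) := by
  rw [potential_eq_boundary, sum_boundaryIntegral_eq]
  exact Finset.sum_congr rfl fun l _ => link_contribution D hD hs l

end LinkIntegrals

end BFCG

end

/-! ### Assembly of the theorem -/

theorem mainTheorem2 {M : Type*} [TopologicalSpace M]
    [ChartedSpace (EuclideanSpace ℝ (Fin 3)) M] [IsManifold (𝓡 3) ∞ M]
    {Cell Link : Type*} [Fintype Cell] [Fintype Link]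
    (T : BFCG.Triangulation M Cell Link) (D : BFCG.OnShellData T) (hD : D.Continuity) :
    -- the continuity equations of `g` and `c` are solved by unique constants on the links
    (∃! d : (Link → ℝ → BFCG.SO4) × (Link → ℝ → BFCG.R4), D.IsContinuitySolution d.1 d.2) ∧
    -- evaluation of the potential
    (∀ (h : Link → ℝ → BFCG.SO4) (x : Link → ℝ → BFCG.R4), D.IsContinuitySolution h x →
      (∀ l, ContDiff ℝ ∞ (fun t => (h l t : BFCG.Mat4)) ∧ ContDiff ℝ ∞ (x l)) ∧
      (∀ l t,
        T.AgreeOn l (D.dσ (T.target l).1 t)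
          (fun y u => ((h l t)⁻¹ : BFCG.SO4).1 *ᵥ D.dσ (T.source l).1 t y u) ∧
        T.AgreeOn l (D.db (T.target l).1 t)
          (fun y u => ((h l t)⁻¹ : BFCG.SO4).1 * (D.db (T.source l).1 t y u
            - BFCG.mixedBracket (D.dσ (T.source l).1 t y u) (x l t)) * (h l t).1)) ∧
      (∀ l t, BFCG.linkVars D h x l t ∈ BFCG.linkPhaseSpace ∧
        DifferentiableAt ℝ (BFCG.linkVars D h x l) t) ∧
      D.potential = ∑ i, T.boundaryIntegral i (D.boundaryForm i) ∧
      D.potential =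
        ∑ l, BFCG.bfcgLinkPotential (BFCG.linkVars D h x l 0)
          (deriv (BFCG.linkVars D h x l) 0)) ∧
    -- each summand is a potential of `T*ISO(4)`; it differs from the one of the BF discretization
    -- by the sign of `V`, up to a total variation
    (∀ p ∈ BFCG.linkPhaseSpace, ∀ v ∈ BFCG.tangentVectors p,
      BFCG.bfLinkPotential p v
        = BFCG.canonicalForm (BFCG.toCotangent p) (fderiv ℝ BFCG.toCotangent p v) ∧
      BFCG.bfcgLinkPotential p v
        = BFCG.bfLinkPotential (BFCG.flipV p) (BFCG.flipV v)
          + fderiv ℝ (fun q : BFCG.LinkVars => q.2.1 ⬝ᵥ q.2.2.2) p v) ∧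
    (∀ p ∈ BFCG.linkPhaseSpace, ∀ u ∈ BFCG.tangentVectors p,
      (∀ v ∈ BFCG.tangentVectors p,
        BFCG.extDOne BFCG.bfcgLinkPotential p u v
          = BFCG.extDOne BFCG.bfLinkPotential (BFCG.flipV p) (BFCG.flipV u) (BFCG.flipV v)) ∧
      ((∀ v ∈ BFCG.tangentVectors p, BFCG.extDOne BFCG.bfcgLinkPotential p u v = 0) → u = 0)) := by
  exact ⟨BFCG.existsUnique_continuitySolution D hD,
    fun h x hs => ⟨fun l => BFCG.contDiff_continuitySolution D hs l,
      fun l t => ⟨BFCG.dσ_target D hD hs l t, BFCG.db_target D hD hs l t⟩,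
      fun l t => ⟨BFCG.linkVars_mem D h x l t, (BFCG.hasDerivAt_linkVars D hs l t).differentiableAt⟩,
      BFCG.potential_eq_boundary D, BFCG.potential_eq_sum_links D hD hs⟩,
    fun p hp v _ => ⟨BFCG.bfLinkPotential_eq_canonicalForm hp v, BFCG.bfcgLinkPotential_eq p v⟩,
    fun p hp u hu => ⟨fun v _ => BFCG.extDOne_bfcg_eq_flip p u v,
      BFCG.extDOne_bfcg_nondegenerate hp hu⟩⟩
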